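/- **Setting.** Let $M=(\mathcal S,\mathcal A,P,r,H,s_1)$ be an episodic MDP with horizon $H\ge 1$, discrete transition probabilities $P_h(\cdot\mid s,a)$, deterministic rewards $r_h(s,a)\in[0,1]$ and fixed initial state $s_1$. For a deterministic policy $\pi=(\pi_h)_{h\in[H]}$ let $V_h^\pi,Q_h^\pi$ be its value functions, let $V_h^*=\sup_\pi V_h^\pi$, $Q_h^*=\sup_\pi Q_h^\pi$, $\mathrm{gap}_h(s,a)=V_h^*(s)-Q_h^*(s,a)$, and assume that $\mathrm{gap}_{\min}$, the smallest nonzero gap, is positive. There are $K\ge 1$ episodes, $T=KH$, and $\mathrm{Regret}(K)=\sum_{k=1}^K (V_1^*(s_1)-V_1^{\pi^k}(s_1))$, where $\pi^k$ is the policy played in episode $k$. Let $\mathcal F$ be a class of functions $\mathcal S\times\mathcal A\to[0,H+1]$ such that for all $h\in[H]$ and all $V:\mathcal S\to[0,H]$ the function $(s,a)\mapsto r_h(s,a)+\sum_{s'}P_h(s'\mid s,a)V(s')$ lies in $\mathcal F$. Let $\mathcal N(\mathcal F,\epsilon)$ and $\mathcal N(\mathcal S\times\mathcal A,\epsilon)$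 be nonincreasing functions of $\epsilon>0$ that bound the sizes of a suitable $\epsilon$-cover of $\mathcal F$ in the sup norm (with elements in $\mathcal F$), and of $\mathcal S\times\mathcal A$ in the pseudometric $\sup_{f\in\mathcal F}|f(z)-f(z')|$. For a finite multiset $\mathcal Z\subseteq\mathcal S\times\mathcal A$ write $\|f\|_{\mathcal Z}^2=\sum_{z\in\mathcal Z}f(z)^2$. A point $x$ is $\epsilon$-independent of $\mathcal Z$ if there are $f,f'\in\mathcal F$ with $\|f-f'\|_{\mathcal Z}\le\epsilon$ and $|f(x)-f'(x)|>\epsilon$. Let $\dim_E(\mathcal F,\epsilon)$ be the length of the longest sequence for which there is an $\epsilon'\ge\epsilon$ such that every element is $\epsilon'$-independent of its predecessors, and assume that $\dim_E(\mathcal F,1/T)$ is finite. **Algorithm** (parameters $\delta\in(0,1)$, $K$, $\beta$, and an absolute constant $c$). Start with empty multisets $\hat{\mathcal Z}_h$, $h\in[H]$. Before each episode $k\ge2$, for every $h$ independently: let $z=(s_h^{k-1},a_h^{k-1})$ and $$\mathrm{sens}(z)=\min\Big\{1,\sup_{f_1,f_2\in\mathcal F}\frac{(f_1(z)-f_2(z))^2}{\min\{\|f_1-f_2\|^2_{\hat{\mathcal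 Z}_h},T(H+1)^2\}+\beta}\Big\};$$ let $p_z$ be the smallest number with $1/p_z$ an integer and $p_z\ge\min\{1,c\,\mathrm{sens}(z)\log(T\mathcal N(\mathcal F,\sqrt{\delta/(64T^3)})/\delta)\}$; and with probability $p_z$ add to $\hat{\mathcal Z}_h$ $1/p_z$ copies of a point $\hat z$ of a fixed cover of $\mathcal S\times\mathcal A$ of accuracy $\epsilon_0=1/(16\sqrt{64T^3/\delta})$ and size at most $\mathcal N(\mathcal S\times\mathcal A,\epsilon_0)$, with $\sup_{f\in\mathcal F}|f(z)-f(\hat z)|\le\epsilon_0$. In the first episode, and whenever some $\hat{\mathcal Z}_h$ has changed since the policy was last computed, recompute the policy: set $Q_{H+1}=V_{H+1}=0$ and, for $h=H,\dots,1$, $$f_h\in\operatorname*{arg\,min}_{f\in\mathcal F}\sum_{j<k}\big(f(s_h^j,a_h^j)-r_h(s_h^j,a_h^j)-V_{h+1}(s_{h+1}^j)\big)^2,\qquad Q_h=\min\{f_h+b_h,H\},$$ $V_h=\max_aQ_h(\cdot,a)$, $\pi_h=\arg\max_aQ_h(\cdot,a)$, where $b_h(z)=\sup|f_1(z)-f_2(z)|$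 over all $f_1,f_2\in\mathcal F$ with $\min\{\|f_1-f_2\|^2_{\hat{\mathcal Z}_h},T(H+1)^2\}\le\beta$; otherwise keep the policy. Then play the episode with the policy. It is assumed that the minima and maxima in the algorithm are attained; ties may be broken by any fixed rule. **Theorem.** There are absolute constants $c,C_\beta,C,C'>0$ such that the following holds for all such $M,\mathcal F,\mathcal N,K$, all $\delta\in(0,1)$ and $\tau>0$, and for each of the two accuracies $\epsilon=\delta/T^2$ and $\epsilon=\delta/T^3$ that satisfies $\mathcal N(\mathcal S\times\mathcal A,\epsilon)\ge2\delta$. Run the algorithm with $$\beta=C_\beta\,\log\frac{\mathcal N(\mathcal F,\epsilon)}{\delta}\;\dim_E(\mathcal F,1/T)\;\log\frac{\mathcal N(\mathcal S\times\mathcal A,\epsilon)}{\delta}\;H^2\log^4T .$$ Then with probability at least $1-\lceil\log T\rceil e^{-\tau}-\delta$ both $$\mathrm{Regret}(K)\le\frac{C\,d_{\mathcal F}\,H^5\log^4T}{\mathrm{gap}_{\min}}+\frac{16H^2\tau}{3}+2,\qquad d_{\mathcal F}=\dim_E^2(\mathcal F,1/T)\,\log\frac{\mathcal N(\mathcal F,\epsilon)}{\delta}\,\log\frac{\mathcal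 N(\mathcal S\times\mathcal A,\epsilon)}{\delta},$$ and the number of policy switches $\#\{k<K:\pi^k\ne\pi^{k+1}\}$ is at most $$C'\,H\,\log\big(T\,\mathcal N(\mathcal F,\sqrt\delta/T^2)/\delta\big)\,\dim_E(\mathcal F,1/T)\,\log^2T .$$ -/

import Mathlib

/-! Steps of an episode are numbered `0, …, H - 1`; objects indexed by `ℕ` are only ever used at
steps `h < H` (states at `h ≤ H`). -/

universe u v

noncomputable section

namespace LSVI

/-! ### Episodic Markov decision processes -/

/-- An episodic MDP `(S, A, P, r, H, s₁)`: discrete transition probabilities `P_h(· | s, a)` on an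
arbitrary state space, deterministic rewards in `[0, 1]`, a fixed initial state. -/
structure EpisodicMDP (S : Type u) (A : Type v) (H : ℕ) where
  /-- `P_h(· | s, a)` -/
  P : ℕ → S → A → PMF S
  /-- `r_h(s, a)` -/
  r : ℕ → S → A → ℝ
  r_mem : ∀ h < H, ∀ s a, r h s a ∈ Set.Icc (0 : ℝ) 1
  /-- the initial state of every episode -/
  s₁ : S

/-- A deterministic policy `π = (π_h : S → A)_h`. -/
abbrev Policy (S : Type u) (A : Type v) := ℕ → S → A

/-- Expectation of a real function under a discrete law. -/
def expect {Ω : Type*} (p : PMF Ω) (g : Ω → ℝ) : ℝ := ∑' ω, (p ω).toReal * g ω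

section MDP

variable {S : Type u} {A : Type v} {H : ℕ}

/-- `rollout M π n h σ`: the law of the state sequence obtained from `σ` by playing `n` steps of
the policy `π` from the state `σ h` at step `h`, writing the states visited at the entries
`h + 1, …, h + n`. -/
def rollout (M : EpisodicMDP S A H) (π : Policy S A) : ℕ → ℕ → (ℕ → S) → PMF (ℕ → S)
  | 0, _, σ => PMF.pure σ
  | n + 1, h, σ => (M.P h (σ h) (π h (σ h))).bind fun s' =>
      rollout M π n (h + 1) (Function.update σ (h + 1) s')

/-- `V_h^π(s) = E[∑_{h' ≥ h} r_{h'}(s_{h'}, a_{h'}) | s_h = s, π]`. -/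
def valueV (M : EpisodicMDP S A H) (π : Policy S A) (h : ℕ) (s : S) : ℝ :=
  expect (rollout M π (H - h) h (fun _ => s)) fun σ =>
    ∑ i ∈ Finset.Ico h H, M.r i (σ i) (π i (σ i))

/-- `Q_h^π(s, a) = E[∑_{h' ≥ h} r_{h'}(s_{h'}, a_{h'}) | s_h = s, a_h = a, π]`: the action `a` is
played at step `h`, and `π` afterwards. -/
def valueQ (M : EpisodicMDP S A H) (π : Policy S A) (h : ℕ) (s : S) (a : A) : ℝ :=
  valueV M (Function.update π h fun _ => a) h s

/-- The optimal value function `V_h^*`. -/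
def optV (M : EpisodicMDP S A H) (h : ℕ) (s : S) : ℝ := ⨆ π : Policy S A, valueV M π h s

/-- The optimal action-value function `Q_h^*`. -/
def optQ (M : EpisodicMDP S A H) (h : ℕ) (s : S) (a : A) : ℝ := ⨆ π : Policy S A, valueQ M π h s a

/-- The sub-optimality gap `gap_h(s, a) = V_h^*(s) - Q_h^*(s, a)`. -/
def gap (M : EpisodicMDP S A H) (h : ℕ) (s : S) (a : A) : ℝ := optV M h s - optQ M h s a

/-- The minimum sub-optimality gap: the smallest nonzero gap. -/
def gapMin (M : EpisodicMDP S A H) : ℝ :=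
  sInf {x : ℝ | ∃ h < H, ∃ s a, gap M h s a ≠ 0 ∧ x = gap M h s a}

/-- `F` contains the one-step Bellman backup of every `V : S → [0, H]` at every step. -/
def BellmanClosed (M : EpisodicMDP S A H) (F : Set (S × A → ℝ)) : Prop :=
  ∀ h < H, ∀ V : S → ℝ, (∀ s, V s ∈ Set.Icc (0 : ℝ) H) →
    ∃ f ∈ F, ∀ s a, f (s, a) = M.r h s a + expect (M.P h s a) V

end MDP

/-! ### Complexity of a function class -/

section Complexity

variable {X : Type*}

/-- `‖f‖²_Z = ∑_{x ∈ Z} f(x)²`, with multiplicities. -/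
def sqNorm (Z : Multiset X) (f : X → ℝ) : ℝ := (Z.map fun x => f x ^ 2).sum

/-- `‖f‖²_D = ∑_{(x, q) ∈ D} (f(x) - q)²`, with multiplicities. -/
def sqLoss (D : Multiset (X × ℝ)) (f : X → ℝ) : ℝ := (D.map fun d => (f d.1 - d.2) ^ 2).sum

/-- `x` is `ε`-dependent on `Z` with respect to `F`. -/
def EpsDependent (F : Set (X → ℝ)) (ε : ℝ) (Z : Multiset X) (x : X) : Prop :=
  ∀ f ∈ F, ∀ g ∈ F, Real.sqrt (sqNorm Z (f - g)) ≤ ε → |f x - g x| ≤ ε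

/-- The `ε`-eluder dimension: the supremum of the lengths of the sequences each of whose elements
is, for one common `ε' ≥ ε`, `ε'`-independent of its predecessors. -/
def eluderDim (F : Set (X → ℝ)) (ε : ℝ) : ℕ∞ :=
  sSup {n : ℕ∞ | ∃ l : List X, n = l.length ∧ ∃ ε' ≥ ε, ∀ (i : ℕ) (hi : i < l.length),
    ¬ EpsDependent F ε' (l.take i : Multiset X) l[i]}

/-- `N ε` bounds the sup-norm `ε`-covering number of `F` (by covers inside `F`) for all `ε > 0`;
as usual for such bounds, it does not increase with `ε`. -/
def FunctionCoverBound (F : Set (X → ℝ)) (N : ℝ → ℝ) : Prop :=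
  AntitoneOn N (Set.Ioi 0) ∧ ∀ ε > 0, ∃ C : Finset (X → ℝ), (C : Set (X → ℝ)) ⊆ F ∧
    (C.card : ℝ) ≤ N ε ∧ ∀ f ∈ F, ∃ g ∈ C, ∀ x, |f x - g x| ≤ ε

/-- `N ε` bounds the `ε`-covering number of the domain with respect to
`(x, y) ↦ sup_{f ∈ F} |f x - f y|` for all `ε > 0`, and does not increase with `ε`. -/
def PointCoverBound (F : Set (X → ℝ)) (N : ℝ → ℝ) : Prop :=
  AntitoneOn N (Set.Ioi 0) ∧ ∀ ε > 0, ∃ C : Finset X,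
    (C.card : ℝ) ≤ N ε ∧ ∀ x, ∃ y ∈ C, ∀ f ∈ F, |f x - f y| ≤ ε

/-- `rnd` maps every point to an `ε`-close point of a fixed finite `ε`-cover of size at
most `n`. -/
def IsRounding (F : Set (X → ℝ)) (ε n : ℝ) (rnd : X → X) : Prop :=
  ∃ C : Finset X, (C.card : ℝ) ≤ n ∧ ∀ x, rnd x ∈ C ∧ ∀ f ∈ F, |f x - f (rnd x)| ≤ ε

/-- `lsq D` is an element of `argmin_{f ∈ F} ‖f‖²_D`, for every finite dataset `D`. -/
def IsLeastSquares (F : Set (X → ℝ)) (lsq : Multiset (X × ℝ) → X → ℝ) : Prop :=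
  ∀ D, lsq D ∈ F ∧ ∀ f ∈ F, sqLoss D (lsq D) ≤ sqLoss D f

/-- `sensitivity_{Z, F}(z)`. -/
def sensitivity (F : Set (X → ℝ)) (H : ℕ) (T β : ℝ) (Z : Multiset X) (z : X) : ℝ :=
  min (sSup {x : ℝ | ∃ f ∈ F, ∃ g ∈ F,
    x = (f z - g z) ^ 2 / (min (sqNorm Z (f - g)) (T * (H + 1) ^ 2) + β)}) 1

/-- The exploration bonus `b(z) = sup |f₁(z) - f₂(z)|`, over the pairs `f₁, f₂ ∈ F` with
`min{‖f₁ - f₂‖²_Z, T (H + 1)²} ≤ β`. -/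
def bonus (F : Set (X → ℝ)) (H : ℕ) (T β : ℝ) (Z : Multiset X) (z : X) : ℝ :=
  sSup {x : ℝ | ∃ f ∈ F, ∃ g ∈ F,
    min (sqNorm Z (f - g)) (T * (H + 1) ^ 2) ≤ β ∧ x = |f z - g z|}

/-- The optimistic estimate `min{f + b, H}`. -/
def optimistic (F : Set (X → ℝ)) (H : ℕ) (T β : ℝ) (Z : Multiset X) (f : X → ℝ) (z : X) : ℝ :=
  min (f z + bonus F H T β Z z) H

end Complexity

/-! ### The algorithm -/

/-- What the algorithm is run with. -/
structure Config (S : Type u) (A : Type v) where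
  /-- the function class -/
  F : Set (S × A → ℝ)
  /-- the bound on the covering numbers of `F` -/
  NF : ℝ → ℝ
  /-- the failure probability -/
  δ : ℝ
  /-- the number of interaction steps `K H` -/
  T : ℝ
  /-- the bonus parameter -/
  β : ℝ
  /-- the absolute constant of the sampling routine -/
  c : ℝ
  /-- the choice of a least-squares minimizer in `F` -/
  lsq : Multiset ((S × A) × ℝ) → S × A → ℝ
  /-- the choice of a maximizing action for a function on `S × A`, in every state -/
  greedy : (S × A → ℝ) → S → A
  /-- the choice of a nearby point in the cover of `S × A` -/
  rnd : S × A → S × A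

/-- A played episode: the policy used and the states visited (`states h` for `h ≤ H`). -/
structure Episode (S : Type u) (A : Type v) where
  policy : Policy S A
  states : ℕ → S

/-- The state-action pair at step `h` of an episode. -/
def Episode.pair {S : Type u} {A : Type v} (e : Episode S A) (h : ℕ) : S × A :=
  (e.states h, e.policy h (e.states h))

/-- The state of the algorithm between two episodes. -/
structure LearnerState (S : Type u) (A : Type v) where
  /-- the episodes played so far, the most recent one first -/
  past : List (Episode S A)
  /-- the sub-sampled datasets, one for every step -/
  sub : ℕ → Multiset (S × A)
  /-- the sub-sampled datasets at the last time at which the policy was computed -/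
  ref : ℕ → Multiset (S × A)

section Algorithm

variable {S : Type u} {A : Type v} {H : ℕ}

/-- The number `1 / p_z` of copies that may be added for `z`: the largest `m` with
`1 / m ≥ min{1, c · sensitivity(z) · log (T N(F, √(δ / (64 T³))) / δ)}`, so that `p_z = 1 / m` is
the smallest inverse of an integer which is at least this number. -/
def copies (H : ℕ) (cfg : Config S A) (Z : Multiset (S × A)) (z : S × A) : ℕ :=
  ⌊1 / min 1 (cfg.c * sensitivity cfg.F H cfg.T cfg.β Z z *
    Real.log (cfg.T * cfg.NF (Real.sqrt (cfg.δ / (64 * cfg.T ^ 3))) / cfg.δ))⌋₊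

set_option linter.deprecated false in
/-- The online sampling routine: with probability `p_z`, add `1 / p_z` copies of the rounded new
element to the dataset. -/
def onlineSample (H : ℕ) (cfg : Config S A) (Z : Multiset (S × A)) (z : S × A) :
    PMF (Multiset (S × A)) :=
  (PMF.bernoulli ((copies H cfg Z z : NNReal)⁻¹) (Nat.cast_inv_le_one _)).map fun hit =>
    if hit then Multiset.replicate (copies H cfg Z z) (cfg.rnd z) + Z else Z

/-- Run the sampling routine at the steps `n - 1, …, 0`, with fresh randomness at every step. -/
def sampleAll (H : ℕ) (cfg : Config S A) (e : Episode S A) :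
    ℕ → (ℕ → Multiset (S × A)) → PMF (ℕ → Multiset (S × A))
  | 0, Z => PMF.pure Z
  | n + 1, Z => (onlineSample H cfg (Z n) (e.pair n)).bind fun W =>
      sampleAll H cfg e n (Function.update Z n W)

/-- `estQ M cfg past sub n` is the estimate `Q_h` for `h = H - n`, with `Q_H = 0`; the regression
targets are `r_h + V_{h+1}(s_{h+1})` with `V_{h+1} = max_a Q_{h+1}(·, a)`. -/
def estQ (M : EpisodicMDP S A H) (cfg : Config S A) (past : List (Episode S A))
    (sub : ℕ → Multiset (S × A)) : ℕ → S × A → ℝ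
  | 0 => fun _ => 0
  | n + 1 =>
    let h := H - (n + 1)
    let V : S → ℝ := fun s => ⨆ a, estQ M cfg past sub n (s, a)
    let D : Multiset ((S × A) × ℝ) := (past : Multiset (Episode S A)).map fun e =>
      (e.pair h, M.r h (e.pair h).1 (e.pair h).2 + V (e.states (h + 1)))
    optimistic cfg.F H cfg.T cfg.β (sub h) (cfg.lsq D)

/-- The greedy policy of the estimates. -/
def plan (M : EpisodicMDP S A H) (cfg : Config S A) (past : List (Episode S A))
    (sub : ℕ → Multiset (S × A)) : Policy S A :=
  fun h => cfg.greedy (estQ M cfg past sub (H - h))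

/-- Play one episode with the policy `π` and record it. -/
def play (M : EpisodicMDP S A H) (π : Policy S A) (past : List (Episode S A))
    (sub ref : ℕ → Multiset (S × A)) : PMF (LearnerState S A) :=
  (rollout M π H 0 fun _ => M.s₁).map fun σ => ⟨⟨π, σ⟩ :: past, sub, ref⟩

open Classical in
/-- One pass of the main loop: from the second episode on, sub-sample the last episode; compute a
new policy in the first episode and whenever a sub-sampled dataset differs from the one at the last
computation, and keep the policy otherwise; play the episode. -/
def episodeStep (M : EpisodicMDP S A H) (cfg : Config S A) (st : LearnerState S A) :
    PMF (LearnerState S A) :=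
  match st.past with
  | [] => play M (plan M cfg [] st.sub) [] st.sub st.sub
  | e :: rest => (sampleAll H cfg e H st.sub).bind fun sub' =>
      if ∃ h < H, sub' h ≠ st.ref h then
        play M (plan M cfg (e :: rest) sub') (e :: rest) sub' sub'
      else
        play M e.policy (e :: rest) sub' st.ref

/-- The law of the state of the algorithm after `k` episodes. -/
def runLaw (M : EpisodicMDP S A H) (cfg : Config S A) : ℕ → PMF (LearnerState S A)
  | 0 => PMF.pure ⟨[], fun _ => 0, fun _ => 0⟩
  | k + 1 => (runLaw M cfg k).bind (episodeStep M cfg)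

/-- `∑_k (V_1^*(s₁) - V_1^{π^k}(s₁))` over the recorded episodes. -/
def regret (M : EpisodicMDP S A H) (l : List (Episode S A)) : ℝ :=
  (l.map fun e => optV M 0 M.s₁ - valueV M e.policy 0 M.s₁).sum

open Classical in
/-- The number of consecutive episodes with different policies. -/
def switches (H : ℕ) : List (Episode S A) → ℕ
  | [] => 0
  | [_] => 0
  | e :: e' :: l =>
      (if ∃ h < H, e.policy h ≠ e'.policy h then 1 else 0) + switches H (e' :: l)

/-- Every `max_a` and `argmax_a` in the algorithm is attained, and `greedy` chooses a maximizer. -/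
def IsGreedy (F : Set (S × A → ℝ)) (H : ℕ) (T β : ℝ) (greedy : (S × A → ℝ) → S → A) : Prop :=
  ∀ f ∈ F, ∀ (Z : Multiset (S × A)) (s : S) (a : A),
    optimistic F H T β Z f (s, a) ≤
      optimistic F H T β Z f (s, greedy (optimistic F H T β Z f) s)

end Algorithm

end LSVI

end

open LSVI

/-! The regret is paid for by exploration bonuses, and the gap removes the usual $\sqrt T$. If the
estimates are optimistic and exceed their Bellman backups by at most twice the bonus, surpluses
below $\mathrm{gap}_{\min}/(2H)$ may be dropped: in one episode they add up to at most
$\mathrm{gap}_{\min}/2$, while at a suboptimal action the loss is at least $\mathrm{gap}_{\min}$. So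
the regret of an episode is at most twice its expected clipped bonus (`optV_sub_valueV_le`). A bonus
above $x$ occurs at most about $\dim_E\beta/x^2$ times (`card_le_eluderDim`), and dyadic summation
down to the clipping level $x_0$ costs only $\dim_E\beta/x_0$ (`sum_clipped_le`). A multiplicative
Chernoff bound passes from expected to realized clipped bonuses (`prob_meanClipped_ge`).

The bonuses use sub-sampled data, so these must represent the full data. For a fixed pair of
functions the ratio of the two squared norms, truncated below by a constant and raised to a power
$m$ of the order of the logarithmic factor, grows in expectation by at most a constant to the power
$m$ per episode (`upper_ratio_drift`, `lower_ratio_drift`). Markov's inequality and a union bound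
over a cover of $\mathcal F$ give `SubAccurate` (`prob_ratio_ge`, `Regime.subAccurate_of_cover`).

A dataset changes with probability proportional to a sensitivity. Sensitivities sum to
$O(\dim_E\log^2T)$ along any sequence (`sum_fullSens_le`), so changes are few
(`Regime.prob_changes_ge`). This bounds the switches, and also the number of datasets that can arise
(`card_reachable_le`).

The regression target $V_{h+1}$ depends on the past only through a fit in $\mathcal F$ and one such
dataset. Hence a finite deterministic family approximates all targets; each member has an
exponential supermartingale (`Regime.prob_regTerm_ge`), and the logarithm of the size of the family
fits into $\beta$. The bound on the changes does not grow with $\beta$, so this is not circular. It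
follows that the fits are within the bonus of the backups (`Regime.sqNorm_lsq_sub_backup_le`), which
is the optimism used at the start. Bounded $T$ is treated by trivial bounds. -/

namespace LSVI

open scoped ENNReal NNReal

/-! ### Expectations under discrete laws, Markov's inequality, exponential moments -/

section Expectation

variable {Ω Ω' : Type*}

/-- Expectation of an extended nonnegative function under a discrete law. -/
noncomputable def lexp (p : PMF Ω) (Φ : Ω → ℝ≥0∞) : ℝ≥0∞ := ∑' ω, p ω * Φ ω

theorem lexp_pure (a : Ω) (Φ : Ω → ℝ≥0∞) : lexp (PMF.pure a) Φ = Φ a := by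
  unfold lexp
  rw [tsum_eq_single a]
  · simp
  · intro b hb; simp [hb]

theorem lexp_bind (p : PMF Ω) (f : Ω → PMF Ω') (Φ : Ω' → ℝ≥0∞) :
    lexp (p.bind f) Φ = lexp p fun a => lexp (f a) Φ := by
  simp only [lexp, PMF.bind_apply, ← ENNReal.tsum_mul_right, ← ENNReal.tsum_mul_left]
  rw [ENNReal.tsum_comm]
  simp only [mul_assoc]

theorem lexp_map (p : PMF Ω) (f : Ω → Ω') (Φ : Ω' → ℝ≥0∞) :
    lexp (p.map f) Φ = lexp p fun a => Φ (f a) := by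
  rw [PMF.map, lexp_bind]
  simp [lexp_pure]

theorem lexp_mono_support {p : PMF Ω} {Φ Ψ : Ω → ℝ≥0∞} (h : ∀ ω ∈ p.support, Φ ω ≤ Ψ ω) :
    lexp p Φ ≤ lexp p Ψ := by
  refine ENNReal.tsum_le_tsum fun ω => ?_
  by_cases hω : p ω = 0
  · simp [hω]
  · exact mul_le_mul_right (h ω hω) _

theorem lexp_mono {p : PMF Ω} {Φ Ψ : Ω → ℝ≥0∞} (h : ∀ ω, Φ ω ≤ Ψ ω) : lexp p Φ ≤ lexp p Ψ :=
  lexp_mono_support fun ω _ => h ω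

theorem lexp_const (p : PMF Ω) (c : ℝ≥0∞) : lexp p (fun _ => c) = c := by
  simp [lexp, ENNReal.tsum_mul_right]

theorem lexp_add (p : PMF Ω) (Φ Ψ : Ω → ℝ≥0∞) :
    lexp p (fun ω => Φ ω + Ψ ω) = lexp p Φ + lexp p Ψ := by
  simp [lexp, mul_add, ENNReal.tsum_add]

theorem lexp_const_mul (p : PMF Ω) (c : ℝ≥0∞) (Φ : Ω → ℝ≥0∞) :
    lexp p (fun ω => c * Φ ω) = c * lexp p Φ := by
  simp [lexp, mul_left_comm, ENNReal.tsum_mul_left]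

theorem lexp_le_of_support {p : PMF Ω} {Φ : Ω → ℝ≥0∞} {c : ℝ≥0∞}
    (h : ∀ ω ∈ p.support, Φ ω ≤ c) : lexp p Φ ≤ c :=
  (lexp_mono_support h).trans (lexp_const p c).le

theorem toOuterMeasure_mul_le_lexp (p : PMF Ω) (Φ : Ω → ℝ≥0∞) (a : ℝ≥0∞) (s : Set Ω)
    (hs : ∀ ω ∈ p.support, ω ∈ s → a ≤ Φ ω) : p.toOuterMeasure s * a ≤ lexp p Φ := by
  rw [PMF.toOuterMeasure_apply, ← ENNReal.tsum_mul_right]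
  refine ENNReal.tsum_le_tsum fun ω => ?_
  by_cases hω : p ω = 0
  · simp [Set.indicator, hω]
  · by_cases h : ω ∈ s
    · simpa [h] using mul_le_mul_right (hs ω hω h) (p ω)
    · simp [h]

/-- Markov's inequality; every probability bound below comes from it, applied to a suitable
potential. -/
theorem toOuterMeasure_le_div {p : PMF Ω} {Φ : Ω → ℝ≥0∞} {a b : ℝ} {s : Set Ω} (ha : 0 < a)
    (hb : lexp p Φ ≤ ENNReal.ofReal b)
    (hs : ∀ ω ∈ p.support, ω ∈ s → ENNReal.ofReal a ≤ Φ ω) :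
    p.toOuterMeasure s ≤ ENNReal.ofReal (b / a) := by
  rw [ENNReal.ofReal_div_of_pos ha]
  rw [ENNReal.le_div_iff_mul_le (Or.inl (by simpa using ha)) (Or.inl (by simp))]
  exact (toOuterMeasure_mul_le_lexp p Φ _ s hs).trans hb

theorem summable_expect (p : PMF Ω) {g : Ω → ℝ} {B : ℝ} (h : ∀ ω, |g ω| ≤ B) :
    Summable fun ω => (p ω).toReal * g ω := by
  have h1 : Summable fun ω => (p ω).toReal * B :=
    (ENNReal.summable_toReal p.tsum_coe_ne_top).mul_right B
  refine Summable.of_norm_bounded h1 fun ω => ?_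
  rw [Real.norm_eq_abs, abs_mul, abs_of_nonneg ENNReal.toReal_nonneg]
  exact mul_le_mul_of_nonneg_left (h ω) ENNReal.toReal_nonneg

theorem expect_const (p : PMF Ω) (c : ℝ) : expect p (fun _ => c) = c := by
  unfold expect
  rw [tsum_mul_right, ← ENNReal.tsum_toReal_eq (fun a => p.apply_ne_top a)]
  simp

theorem expect_add (p : PMF Ω) {f g : Ω → ℝ} {B B' : ℝ} (hf : ∀ ω, |f ω| ≤ B)
    (hg : ∀ ω, |g ω| ≤ B') : expect p (fun ω => f ω + g ω) = expect p f + expect p g := by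
  unfold expect
  rw [← (summable_expect p hf).tsum_add (summable_expect p hg)]
  simp [mul_add]

theorem expect_const_mul (p : PMF Ω) (c : ℝ) (f : Ω → ℝ) :
    expect p (fun ω => c * f ω) = c * expect p f := by
  unfold expect
  rw [← tsum_mul_left]
  exact tsum_congr fun ω => by ring

theorem expect_sub (p : PMF Ω) {f g : Ω → ℝ} {B B' : ℝ} (hf : ∀ ω, |f ω| ≤ B)
    (hg : ∀ ω, |g ω| ≤ B') : expect p (fun ω => f ω - g ω) = expect p f - expect p g := by
  unfold expect
  rw [← (summable_expect p hf).tsum_sub (summable_expect p hg)]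
  simp [mul_sub]

theorem expect_mono (p : PMF Ω) {f g : Ω → ℝ} {B B' : ℝ} (hf : ∀ ω, |f ω| ≤ B)
    (hg : ∀ ω, |g ω| ≤ B') (h : ∀ ω, f ω ≤ g ω) : expect p f ≤ expect p g :=
  (summable_expect p hf).tsum_le_tsum
    (fun ω => mul_le_mul_of_nonneg_left (h ω) ENNReal.toReal_nonneg) (summable_expect p hg)

theorem expect_nonneg (p : PMF Ω) {f : Ω → ℝ} (h : ∀ ω, 0 ≤ f ω) : 0 ≤ expect p f :=
  tsum_nonneg fun ω => mul_nonneg ENNReal.toReal_nonneg (h ω)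

theorem abs_le_of_mem_Icc {x B : ℝ} (h : x ∈ Set.Icc (0 : ℝ) B) : |x| ≤ B := by
  rw [abs_of_nonneg h.1]; exact h.2

theorem expect_mem_Icc (p : PMF Ω) {f : Ω → ℝ} {B : ℝ} (h : ∀ ω, f ω ∈ Set.Icc (0 : ℝ) B) :
    expect p f ∈ Set.Icc (0 : ℝ) B := by
  refine ⟨expect_nonneg p fun ω => (h ω).1, ?_⟩
  have := expect_mono p (fun ω => abs_le_of_mem_Icc (h ω)) (g := fun _ => B) (B' := |B|)
    (fun _ => le_rfl) fun ω => (h ω).2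
  rwa [expect_const] at this

theorem abs_expect_sub_le (p : PMF Ω) {f g : Ω → ℝ} {B η : ℝ}
    (hf : ∀ ω, f ω ∈ Set.Icc (0 : ℝ) B) (hg : ∀ ω, g ω ∈ Set.Icc (0 : ℝ) B)
    (h : ∀ ω, |f ω - g ω| ≤ η) : |expect p f - expect p g| ≤ η := by
  have h1 := fun ω => abs_le_of_mem_Icc (hf ω)
  have h2 := fun ω => abs_le_of_mem_Icc (hg ω)
  rw [← expect_sub p h1 h2, abs_le]
  constructor
  · have := expect_mono p (f := fun _ => -η) (B := |η|) (fun _ => by simp) h fun ω =>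
      (abs_le.1 (h ω)).1
    rwa [expect_const] at this
  · have := expect_mono p (g := fun _ => η) (B' := |η|) h (fun _ => le_rfl) fun ω =>
      (abs_le.1 (h ω)).2
    rwa [expect_const] at this

theorem ofReal_expect (p : PMF Ω) {g : Ω → ℝ} {B : ℝ} (h : ∀ ω, g ω ∈ Set.Icc (0 : ℝ) B) :
    ENNReal.ofReal (expect p g) = lexp p fun ω => ENNReal.ofReal (g ω) := by
  unfold expect lexp
  rw [ENNReal.ofReal_tsum_of_nonneg (fun ω => mul_nonneg ENNReal.toReal_nonneg (h ω).1)
    (summable_expect p fun ω => abs_le_of_mem_Icc (h ω))]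
  refine tsum_congr fun ω => ?_
  rw [ENNReal.ofReal_mul ENNReal.toReal_nonneg, ENNReal.ofReal_toReal (p.apply_ne_top ω)]

/-- Nonnegativity and boundedness allow the passage to `lexp`, where the interchange of sums needs
no summability. -/
theorem expect_bind (p : PMF Ω) (f : Ω → PMF Ω') {g : Ω' → ℝ} {B : ℝ}
    (h : ∀ ω, g ω ∈ Set.Icc (0 : ℝ) B) :
    expect (p.bind f) g = expect p fun a => expect (f a) g := by
  have h1 : ∀ a, expect (f a) g ∈ Set.Icc (0 : ℝ) B := fun a => expect_mem_Icc (f a) h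
  rw [← ENNReal.ofReal_eq_ofReal_iff (expect_mem_Icc _ h).1 (expect_mem_Icc _ h1).1,
    ofReal_expect _ h, ofReal_expect _ h1, lexp_bind]
  simp only [ofReal_expect _ h]

theorem expect_congr_support (p : PMF Ω) {f g : Ω → ℝ} (h : ∀ ω ∈ p.support, f ω = g ω) :
    expect p f = expect p g := by
  refine tsum_congr fun ω => ?_
  by_cases hω : p ω = 0
  · simp [hω]
  · rw [h ω hω]

/-- A moment generating function bound for a centred bounded variable. -/
theorem lexp_exp_centred_le (p : PMF Ω) {V : Ω → ℝ} {B t : ℝ}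
    (hV : ∀ ω, V ω ∈ Set.Icc (0 : ℝ) B) (ht : |t| * B ≤ 1) :
    lexp p (fun ω => ENNReal.ofReal (Real.exp (t * (V ω - expect p V) - t ^ 2 * B ^ 2))) ≤ 1 := by
  have hE := expect_mem_Icc p hV
  have hd : ∀ ω, |V ω - expect p V| ≤ B := fun ω => by
    have := hV ω
    rw [abs_le]; constructor <;> linarith [this.1, this.2, hE.1, hE.2]
  have hB : 0 ≤ B := hE.1.trans hE.2
  -- $e^u\le1+u+u^2$ for $|u|\le1$; the linear term has mean zero.
  have h1 : ∀ ω, Real.exp (t * (V ω - expect p V))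
      ≤ 1 + t * (V ω - expect p V) + t ^ 2 * B ^ 2 := fun ω => by
    have ha : |t * (V ω - expect p V)| ≤ |t| * B := by
      rw [abs_mul]; exact mul_le_mul_of_nonneg_left (hd ω) (abs_nonneg t)
    have := (abs_le.1 (Real.abs_exp_sub_one_sub_id_le (ha.trans ht))).2
    have h2 : (t * (V ω - expect p V)) ^ 2 ≤ t ^ 2 * B ^ 2 := by
      rw [← mul_pow, sq_le_sq, abs_mul t B, abs_of_nonneg hB]; exact ha
    linarith
  have h0 : ∀ ω, (1 + t * (V ω - expect p V) + t ^ 2 * B ^ 2)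
      ∈ Set.Icc (0 : ℝ) (2 + t ^ 2 * B ^ 2) := fun ω => by
    have ha : |t * (V ω - expect p V)| ≤ 1 := by
      rw [abs_mul]; exact (mul_le_mul_of_nonneg_left (hd ω) (abs_nonneg t)).trans ht
    have := abs_le.1 ha
    constructor <;> nlinarith [sq_nonneg (t * B)]
  have h3 : expect p (fun ω => 1 + t * (V ω - expect p V) + t ^ 2 * B ^ 2)
      = 1 + t ^ 2 * B ^ 2 := by
    have e1 : (fun ω => 1 + t * (V ω - expect p V) + t ^ 2 * B ^ 2)
        = fun ω => (1 + t ^ 2 * B ^ 2 - t * expect p V) + t * V ω := by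
      funext ω; ring
    rw [e1, expect_add p (B := |1 + t ^ 2 * B ^ 2 - t * expect p V|) (B' := |t| * B)
      (fun _ => le_rfl) (fun ω => by
        rw [abs_mul]
        exact mul_le_mul_of_nonneg_left (abs_le_of_mem_Icc (hV ω)) (abs_nonneg t)),
      expect_const, expect_const_mul]
    ring
  calc lexp p (fun ω => ENNReal.ofReal (Real.exp (t * (V ω - expect p V) - t ^ 2 * B ^ 2)))
      ≤ lexp p (fun ω => ENNReal.ofReal (Real.exp (-(t ^ 2 * B ^ 2))) *
          ENNReal.ofReal (1 + t * (V ω - expect p V) + t ^ 2 * B ^ 2)) := by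
        refine lexp_mono fun ω => ?_
        rw [← ENNReal.ofReal_mul (Real.exp_pos _).le, sub_eq_neg_add, Real.exp_add]
        exact ENNReal.ofReal_le_ofReal (mul_le_mul_of_nonneg_left (h1 ω) (Real.exp_pos _).le)
    _ = ENNReal.ofReal (Real.exp (-(t ^ 2 * B ^ 2)) * (1 + t ^ 2 * B ^ 2)) := by
        rw [lexp_const_mul, ← ofReal_expect p h0, h3, ENNReal.ofReal_mul (Real.exp_pos _).le]
    _ ≤ 1 := by
        rw [ENNReal.ofReal_le_one, Real.exp_neg, inv_mul_le_iff₀ (Real.exp_pos _), mul_one,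
          add_comm]
        exact Real.add_one_le_exp _

/-- Half of the mean of a nonnegative bounded variable is exponentially unlikely to exceed it. -/
theorem lexp_exp_half_mean_le (p : PMF Ω) {X : Ω → ℝ} {B : ℝ} (hB : 0 < B)
    (hX : ∀ ω ∈ p.support, X ω ∈ Set.Icc (0 : ℝ) B) :
    lexp p (fun ω => ENNReal.ofReal (Real.exp ((expect p X / 2 - X ω) / B))) ≤ 1 := by
  classical
  -- Replacing `X` by zero off the support changes neither expectation.
  wlog hX' : ∀ ω, X ω ∈ Set.Icc (0 : ℝ) B generalizing X
  · have h := this (X := fun ω => if ω ∈ p.support then X ω else 0)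
      (fun ω hω => by simpa only [if_pos hω] using hX ω hω)
      (fun ω => by
        by_cases hω : ω ∈ p.support
        · simpa only [if_pos hω] using hX ω hω
        · simp only [if_neg hω]; exact ⟨le_rfl, hB.le⟩)
    have e : expect p (fun ω => if ω ∈ p.support then X ω else 0) = expect p X :=
      expect_congr_support p fun ω hω => if_pos hω
    rw [e] at h
    refine (lexp_mono_support fun ω hω => ?_).trans h
    rw [if_pos hω]
  have hE := expect_mem_Icc p hX'
  -- On $[0,1]$, $e^{-x}\le1/(1+x)\le1-x/2$. The factor $1/2$ here is the half of the mean in the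
  -- statement.
  have h1 : ∀ ω, Real.exp (-(X ω / B)) ≤ 1 - X ω / B / 2 := fun ω => by
    have hx0 : 0 ≤ X ω / B := div_nonneg (hX' ω).1 hB.le
    have hx1 : X ω / B ≤ 1 := (div_le_one hB).2 (hX' ω).2
    set x := X ω / B
    have h2 := Real.add_one_le_exp x
    rw [Real.exp_neg]
    refine (inv_anti₀ (by linarith) h2).trans ?_
    rw [inv_le_iff_one_le_mul₀ (by linarith)]
    nlinarith
  have h0 : ∀ ω, 1 - X ω / B / 2 ∈ Set.Icc (0 : ℝ) 1 := fun ω => by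
    have hx0 : 0 ≤ X ω / B := div_nonneg (hX' ω).1 hB.le
    have hx1 : X ω / B ≤ 1 := (div_le_one hB).2 (hX' ω).2
    constructor <;> linarith
  have h3 : expect p (fun ω => 1 - X ω / B / 2) = 1 - expect p X / B / 2 := by
    have e1 : (fun ω => 1 - X ω / B / 2) = fun ω => 1 + (-(1 / B / 2)) * X ω := by
      funext ω; ring
    rw [e1, expect_add p (B := |1|) (B' := |-(1 / B / 2)| * B) (fun _ => le_rfl) (fun ω => by
        rw [abs_mul]
        exact mul_le_mul_of_nonneg_left (abs_le_of_mem_Icc (hX' ω)) (abs_nonneg _)),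
      expect_const, expect_const_mul]
    ring
  calc lexp p (fun ω => ENNReal.ofReal (Real.exp ((expect p X / 2 - X ω) / B)))
      ≤ lexp p (fun ω => ENNReal.ofReal (Real.exp (expect p X / B / 2)) *
          ENNReal.ofReal (1 - X ω / B / 2)) := by
        refine lexp_mono fun ω => ?_
        rw [← ENNReal.ofReal_mul (Real.exp_pos _).le]
        have : (expect p X / 2 - X ω) / B = expect p X / B / 2 + -(X ω / B) := by ring
        rw [this, Real.exp_add]
        exact ENNReal.ofReal_le_ofReal (mul_le_mul_of_nonneg_left (h1 ω) (Real.exp_pos _).le)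
    _ = ENNReal.ofReal (Real.exp (expect p X / B / 2) * (1 - expect p X / B / 2)) := by
        rw [lexp_const_mul, ← ofReal_expect p h0, h3, ENNReal.ofReal_mul (Real.exp_pos _).le]
    _ ≤ 1 := by
        rw [ENNReal.ofReal_le_one]
        have h4 := Real.one_sub_le_exp_neg (expect p X / B / 2)
        calc _ ≤ Real.exp (expect p X / B / 2) * Real.exp (-(expect p X / B / 2)) :=
              mul_le_mul_of_nonneg_left h4 (Real.exp_pos _).le
          _ = 1 := by rw [← Real.exp_add]; simp

end Expectation

/-! ### Value functions, optimism and the clipped regret decomposition -/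

section Values

variable {S : Type u} {A : Type v} {H : ℕ}

/-- A rollout from step `h` only writes later entries. This lets the term of step `h` be treated as
a constant under the law of the remaining steps. -/
theorem rollout_support_apply (M : EpisodicMDP S A H) (π : Policy S A) (n : ℕ) :
    ∀ (h : ℕ) (σ ρ : ℕ → S), ρ ∈ (rollout M π n h σ).support → ∀ j ≤ h, ρ j = σ j := by
  induction n with
  | zero =>
    intro h σ ρ hρ j _
    rw [rollout, PMF.mem_support_pure_iff] at hρ
    rw [hρ]
  | succ n ih =>
    intro h σ ρ hρ j hj
    rw [rollout, PMF.mem_support_bind_iff] at hρ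
    obtain ⟨s', -, hs'⟩ := hρ
    rw [ih _ _ _ hs' j (by omega), Function.update_of_ne (by omega)]

/-- Expected sum of `g` over the next `n` states, when `π` is played from `s` at step `h`. -/
noncomputable def polVal (M : EpisodicMDP S A H) (π : Policy S A) (g : ℕ → S → ℝ) :
    ℕ → ℕ → S → ℝ
  | 0, _, _ => 0
  | n + 1, h, s => g h s + expect (M.P h s (π h s)) (polVal M π g n (h + 1))

theorem polVal_mem_Icc (M : EpisodicMDP S A H) (π : Policy S A) {g : ℕ → S → ℝ} {B : ℝ}
    (hg : ∀ i s, g i s ∈ Set.Icc (0 : ℝ) B) (n : ℕ) :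
    ∀ h s, polVal M π g n h s ∈ Set.Icc (0 : ℝ) (n * B) := by
  induction n with
  | zero => intro h s; simp [polVal]
  | succ n ih =>
    intro h s
    have h1 := expect_mem_Icc (M.P h s (π h s)) (ih (h + 1))
    have h2 := hg h s
    rw [polVal]
    push_cast
    constructor <;> linarith [h1.1, h1.2, h2.1, h2.2]

theorem sum_mem_Icc {ι : Type*} (s : Finset ι) {f : ι → ℝ} {B : ℝ}
    (hf : ∀ i ∈ s, f i ∈ Set.Icc (0 : ℝ) B) : ∑ i ∈ s, f i ∈ Set.Icc (0 : ℝ) (s.card * B) := by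
  refine ⟨Finset.sum_nonneg fun i hi => (hf i hi).1, ?_⟩
  have := Finset.sum_le_card_nsmul s f B fun i hi => (hf i hi).2
  simpa using this

theorem expect_rollout_sum (M : EpisodicMDP S A H) (π : Policy S A) {g : ℕ → S → ℝ} {B : ℝ}
    (hg : ∀ i s, g i s ∈ Set.Icc (0 : ℝ) B) (n : ℕ) :
    ∀ h σ, expect (rollout M π n h σ) (fun ρ => ∑ i ∈ Finset.Ico h (h + n), g i (ρ i))
      = polVal M π g n h (σ h) := by
  induction n with
  | zero => intro h σ; simp [polVal, expect_const]
  | succ n ih =>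
    intro h σ
    rw [rollout, expect_bind _ _ (B := (Finset.Ico h (h + (n + 1))).card * B)
      (fun ρ => sum_mem_Icc _ fun i _ => hg i (ρ i)), polVal]
    have key : ∀ s', expect (rollout M π n (h + 1) (Function.update σ (h + 1) s'))
        (fun ρ => ∑ i ∈ Finset.Ico h (h + (n + 1)), g i (ρ i))
        = g h (σ h) + polVal M π g n (h + 1) s' := by
      intro s'
      have e1 : expect (rollout M π n (h + 1) (Function.update σ (h + 1) s'))
          (fun ρ => ∑ i ∈ Finset.Ico h (h + (n + 1)), g i (ρ i))
          = expect (rollout M π n (h + 1) (Function.update σ (h + 1) s'))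
          (fun ρ => g h (σ h) + ∑ i ∈ Finset.Ico (h + 1) (h + 1 + n), g i (ρ i)) := by
        refine expect_congr_support _ fun ρ hρ => ?_
        rw [Finset.sum_eq_sum_Ico_succ_bot (by omega),
          rollout_support_apply M π n _ _ ρ hρ h (by omega),
          Function.update_of_ne (by omega)]
        congr 3; omega
      rw [e1, expect_add _ (B := |g h (σ h)|) (fun _ => le_rfl)
        (fun ρ => abs_le_of_mem_Icc (sum_mem_Icc _ fun i _ => hg i (ρ i))), expect_const, ih,
        Function.update_self]
    simp only [key]
    rw [expect_add _ (B := |g h (σ h)|) (fun _ => le_rfl)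
      (fun s' => abs_le_of_mem_Icc (polVal_mem_Icc M π hg n (h + 1) s')), expect_const]

/-- Condition on the state at step `i`: a bound on the transition out of it that is uniform in that
state survives averaging over the earlier steps. It lifts one-step moment bounds to whole episodes.
-/
theorem lexp_rollout_transition_le (M : EpisodicMDP S A H) (π : Policy S A) (i : ℕ)
    {G : S → S → ℝ≥0∞} {c : ℝ≥0∞} (hG : ∀ s, lexp (M.P i s (π i s)) (G s) ≤ c) (n : ℕ) :
    ∀ h σ, h ≤ i → i < h + n →
      lexp (rollout M π n h σ) (fun ρ => G (ρ i) (ρ (i + 1))) ≤ c := by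
  induction n with
  | zero => intro h σ h1 h2; omega
  | succ n ih =>
    intro h σ h1 h2
    rw [rollout, lexp_bind]
    rcases Nat.eq_or_lt_of_le h1 with rfl | h3
    · refine (lexp_mono fun s' => ?_).trans (hG (σ h))
      refine lexp_le_of_support fun ρ hρ => ?_
      rw [rollout_support_apply M π n _ _ ρ hρ h (by omega),
        rollout_support_apply M π n _ _ ρ hρ (h + 1) le_rfl,
        Function.update_of_ne (by omega), Function.update_self]
    · exact lexp_le_of_support fun s' _ => ih _ _ h3 (by omega)

/-- The rewards collected by `π`, extended by zero after the horizon. -/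
noncomputable def polReward (M : EpisodicMDP S A H) (π : Policy S A) (h : ℕ) (s : S) : ℝ :=
  if h < H then M.r h s (π h s) else 0

theorem polReward_mem_Icc (M : EpisodicMDP S A H) (π : Policy S A) (h : ℕ) (s : S) :
    polReward M π h s ∈ Set.Icc (0 : ℝ) 1 := by
  unfold polReward
  split_ifs with hh
  · exact M.r_mem h hh s _
  · simp

theorem valueV_eq_polVal (M : EpisodicMDP S A H) (π : Policy S A) {h : ℕ} (hh : h ≤ H) (s : S) :
    valueV M π h s = polVal M π (polReward M π) (H - h) h s := by
  have := expect_rollout_sum M π (polReward_mem_Icc M π) (H - h) h (fun _ => s)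
  rw [← this, valueV, Nat.add_sub_cancel' hh]
  congr 1
  funext σ
  refine Finset.sum_congr rfl fun i hi => ?_
  rw [polReward, if_pos (Finset.mem_Ico.1 hi).2]

theorem valueV_mem_Icc (M : EpisodicMDP S A H) (π : Policy S A) {h : ℕ} (hh : h ≤ H) (s : S) :
    valueV M π h s ∈ Set.Icc (0 : ℝ) H := by
  rw [valueV_eq_polVal M π hh]
  have := polVal_mem_Icc M π (polReward_mem_Icc M π) (H - h) h s
  refine ⟨this.1, this.2.trans ?_⟩
  rw [mul_one]
  exact_mod_cast Nat.sub_le H h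

theorem valueV_horizon (M : EpisodicMDP S A H) (π : Policy S A) (s : S) :
    valueV M π H s = 0 := by
  rw [valueV_eq_polVal M π le_rfl, Nat.sub_self, polVal]

theorem valueV_eq (M : EpisodicMDP S A H) (π : Policy S A) {h : ℕ} (hh : h < H) (s : S) :
    valueV M π h s = M.r h s (π h s) + expect (M.P h s (π h s)) (valueV M π (h + 1)) := by
  rw [valueV_eq_polVal M π hh.le, show H - h = (H - (h + 1)) + 1 by omega, polVal, polReward,
    if_pos hh]
  congr 2
  funext s'
  rw [valueV_eq_polVal M π hh]

theorem polVal_congr (M : EpisodicMDP S A H) {π π' : Policy S A} {g g' : ℕ → S → ℝ} (n : ℕ) :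
    ∀ h, (∀ i ≥ h, π i = π' i ∧ g i = g' i) → polVal M π g n h = polVal M π' g' n h := by
  induction n with
  | zero => intro h _; rfl
  | succ n ih =>
    intro h hi
    funext s
    rw [polVal, polVal, ih (h + 1) fun i hi' => hi i (by omega), (hi h le_rfl).1, (hi h le_rfl).2]

theorem valueQ_eq (M : EpisodicMDP S A H) (π : Policy S A) {h : ℕ} (hh : h < H) (s : S) (a : A) :
    valueQ M π h s a = M.r h s a + expect (M.P h s a) (valueV M π (h + 1)) := by
  rw [valueQ, valueV_eq M _ hh, Function.update_self]
  congr 2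
  funext s'
  rw [valueV_eq_polVal M _ hh, valueV_eq_polVal M _ hh]
  refine congrFun (polVal_congr M _ _ fun i hi => ?_) s'
  have : Function.update π h (fun _ => a) i = π i := Function.update_of_ne (by omega) _ _
  refine ⟨this, ?_⟩
  funext s
  simp [polReward, this]

theorem bddAbove_valueV (M : EpisodicMDP S A H) {h : ℕ} (hh : h ≤ H) (s : S) :
    BddAbove (Set.range fun π : Policy S A => valueV M π h s) :=
  ⟨H, by rintro _ ⟨π, rfl⟩; exact (valueV_mem_Icc M π hh s).2⟩

theorem valueV_le_optV (M : EpisodicMDP S A H) (π : Policy S A) {h : ℕ} (hh : h ≤ H) (s : S) :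
    valueV M π h s ≤ optV M h s := le_ciSup (bddAbove_valueV M hh s) π

theorem optV_mem_Icc (M : EpisodicMDP S A H) (π : Policy S A) {h : ℕ} (hh : h ≤ H) (s : S) :
    optV M h s ∈ Set.Icc (0 : ℝ) H := by
  have : Nonempty (Policy S A) := ⟨π⟩
  exact ⟨(valueV_mem_Icc M π hh s).1.trans (valueV_le_optV M π hh s),
    ciSup_le fun π => (valueV_mem_Icc M π hh s).2⟩

theorem optQ_le (M : EpisodicMDP S A H) (π : Policy S A) {h : ℕ} (hh : h < H) (s : S) (a : A) :
    optQ M h s a ≤ M.r h s a + expect (M.P h s a) (optV M (h + 1)) := by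
  have : Nonempty (Policy S A) := ⟨π⟩
  refine ciSup_le fun π' => ?_
  rw [valueQ_eq M π' hh]
  have := expect_mono (M.P h s a) (fun s' => abs_le_of_mem_Icc (valueV_mem_Icc M π' hh s'))
    (fun s' => abs_le_of_mem_Icc (optV_mem_Icc M π hh s')) (valueV_le_optV M π' hh)
  linarith

theorem optQ_le_optV (M : EpisodicMDP S A H) (π : Policy S A) {h : ℕ} (hh : h < H) (s : S)
    (a : A) : optQ M h s a ≤ optV M h s := by
  have : Nonempty (Policy S A) := ⟨π⟩
  exact ciSup_le fun π' => valueV_le_optV M _ hh.le s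

theorem valueV_le_optQ (M : EpisodicMDP S A H) (π : Policy S A) {h : ℕ} (hh : h < H) (s : S) :
    valueV M π h s ≤ optQ M h s (π h s) := by
  have h1 : valueV M π h s = valueQ M π h s (π h s) := by
    rw [valueQ_eq M π hh, valueV_eq M π hh]
  rw [h1]
  exact le_ciSup (f := fun π' : Policy S A => valueQ M π' h s (π h s))
    ⟨H, by rintro _ ⟨π', rfl⟩; exact (valueV_mem_Icc M _ hh.le s).2⟩ π

theorem gapMin_le_gap (M : EpisodicMDP S A H) (π : Policy S A) {h : ℕ} (hh : h < H) (s : S)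
    (a : A) (hg : gap M h s a ≠ 0) : gapMin M ≤ gap M h s a := by
  refine csInf_le ⟨0, ?_⟩ ⟨h, hh, s, a, hg, rfl⟩
  rintro _ ⟨h', hh', s', a', -, rfl⟩
  exact sub_nonneg.2 (optQ_le_optV M π hh' s' a')

theorem gapMin_le (M : EpisodicMDP S A H) (π : Policy S A) (hpos : 0 < gapMin M) :
    gapMin M ≤ H := by
  -- Without a nonzero gap `gapMin` would be `sInf ∅ = 0`, contrary to `hpos`.
  have hne : {x : ℝ | ∃ h < H, ∃ s a, gap M h s a ≠ 0 ∧ x = gap M h s a}.Nonempty := by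
    by_contra h
    rw [Set.not_nonempty_iff_eq_empty] at h
    rw [gapMin, h, Real.sInf_empty] at hpos
    exact lt_irrefl _ hpos
  obtain ⟨_, h, hh, s, a, hg, rfl⟩ := hne
  refine (gapMin_le_gap M π hh s a hg).trans ?_
  have h1 : (0 : ℝ) ≤ optQ M h s a := by
    refine le_trans ?_ (valueV_le_optQ M (Function.update π h fun _ => a) hh s |>.trans_eq ?_)
    · exact (valueV_mem_Icc M _ hh.le s).1
    · rw [Function.update_self]
  unfold gap
  linarith [(optV_mem_Icc M π hh.le s).2]

/-- Estimates that dominate their (truncated) Bellman backups are optimistic. -/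
theorem optV_le_of_optimistic (M : EpisodicMDP S A H) (π : Policy S A) {W : ℕ → S → ℝ}
    (hW : ∀ h ≤ H, ∀ s, W h s ∈ Set.Icc (0 : ℝ) H)
    (hopt : ∀ h < H, ∀ s a, min (M.r h s a + expect (M.P h s a) (W (h + 1))) H ≤ W h s) :
    ∀ h ≤ H, ∀ s, optV M h s ≤ W h s := by
  have : Nonempty (Policy S A) := ⟨π⟩
  intro h hh s
  refine ciSup_le fun π' => ?_
  clear π
  induction hh using Nat.decreasingInduction generalizing s with
  | self => rw [valueV_horizon]; exact (hW H le_rfl s).1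
  | of_succ h hh ih =>
    refine le_trans (le_min ?_ (valueV_mem_Icc M π' hh.le s).2) (hopt h hh s (π' h s))
    rw [valueV_eq M π' hh]
    have := expect_mono (M.P h s (π' h s))
      (fun s' => abs_le_of_mem_Icc (valueV_mem_Icc M π' hh s'))
      (fun s' => abs_le_of_mem_Icc (hW (h + 1) hh s')) ih
    linarith

/-- The regret of a policy that is greedy for optimistic estimates is at most twice its expected
clipped surplus. -/
theorem optV_sub_valueV_le (M : EpisodicMDP S A H) (π : Policy S A) (hpos : 0 < gapMin M)
    {W Y E : ℕ → S → ℝ} {B : ℝ}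
    (hW : ∀ h ≤ H, ∀ s, W h s ∈ Set.Icc (0 : ℝ) H) (hWH : ∀ s, W H s = 0)
    (hY : ∀ h s, Y h s ∈ Set.Icc (0 : ℝ) B)
    (hopt : ∀ h ≤ H, ∀ s, optV M h s ≤ W h s)
    (hsur : ∀ h < H, ∀ s,
      W h s ≤ M.r h s (π h s) + expect (M.P h s (π h s)) (W (h + 1)) + E h s)
    (hclip : ∀ h < H, ∀ s, E h s ≤ Y h s + gapMin M / (2 * H)) :
    ∀ h ≤ H, ∀ s, optV M h s - valueV M π h s ≤ 2 * polVal M π Y (H - h) h s := by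
  have hYv := polVal_mem_Icc M π hY
  -- Unrolling the surpluses along the policy; clipping costs at most $\mathrm{gap}_{\min}/(2H)$ in
  -- each remaining step.
  have h1 : ∀ h ≤ H, ∀ s, W h s - valueV M π h s
      ≤ polVal M π Y (H - h) h s + (H - h : ℕ) * (gapMin M / (2 * H)) := by
    intro h hh s
    induction hh using Nat.decreasingInduction generalizing s with
    | self => simp [hWH, valueV_horizon, polVal]
    | of_succ h hh ih =>
      rw [valueV_eq M π hh, show H - h = (H - (h + 1)) + 1 by omega, polVal]
      have e1 : expect (M.P h s (π h s)) (fun s' => W (h + 1) s' - valueV M π (h + 1) s')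
          ≤ expect (M.P h s (π h s)) (fun s' => polVal M π Y (H - (h + 1)) (h + 1) s' +
            (H - (h + 1) : ℕ) * (gapMin M / (2 * H))) := by
        refine expect_mono _ (B := H) (B' := ((H - (h + 1) : ℕ) * B) +
          |(H - (h + 1) : ℕ) * (gapMin M / (2 * H))|) (fun s' => ?_) (fun s' => ?_) ih
        · have a1 := hW (h + 1) hh s'
          have a2 := valueV_mem_Icc M π (h := h + 1) hh s'
          rw [abs_le]; constructor <;> linarith [a1.1, a1.2, a2.1, a2.2]
        · refine (abs_add_le _ _).trans ?_
          gcongr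
          exact abs_le_of_mem_Icc (hYv (H - (h + 1)) (h + 1) s')
      rw [expect_sub _ (fun s' => abs_le_of_mem_Icc (hW (h + 1) hh s'))
        (fun s' => abs_le_of_mem_Icc (valueV_mem_Icc M π hh s')),
        expect_add _ (fun s' => abs_le_of_mem_Icc (hYv (H - (h + 1)) (h + 1) s'))
          (fun _ => le_rfl), expect_const] at e1
      have e2 := hsur h hh s
      have e3 := hclip h hh s
      push_cast
      linarith
  intro h hh s
  induction hh using Nat.decreasingInduction generalizing s with
  | self =>
    have := h1 H le_rfl s
    have := hopt H le_rfl s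
    simp [hWH, valueV_horizon, polVal] at *
    linarith
  | of_succ h hh ih =>
    have hHpos : (0 : ℝ) < H := by exact_mod_cast (by omega : 0 < H)
    -- An optimal action loses nothing at this step, so the loss is inherited from the next one.
    -- Otherwise the loss is at least $\mathrm{gap}_{\min}$, and the clipping error, at most
    -- $\mathrm{gap}_{\min}/2$, is absorbed by half of the loss; this produces the factor two.
    by_cases hg : gap M h s (π h s) = 0
    · have a1 := optQ_le M π hh s (π h s)
      have a2 : optV M h s = optQ M h s (π h s) := by unfold gap at hg; linarith
      rw [a2, valueV_eq M π hh, show H - h = (H - (h + 1)) + 1 by omega, polVal]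
      have e1 : expect (M.P h s (π h s)) (fun s' => optV M (h + 1) s' - valueV M π (h + 1) s')
          ≤ expect (M.P h s (π h s)) (fun s' => 2 * polVal M π Y (H - (h + 1)) (h + 1) s') := by
        refine expect_mono _ (B := H) (B' := 2 * ((H - (h + 1) : ℕ) * B))
          (fun s' => ?_) (fun s' => ?_) ih
        · have a1 := optV_mem_Icc M π (h := h + 1) hh s'
          have a2 := valueV_mem_Icc M π (h := h + 1) hh s'
          rw [abs_le]; constructor <;> linarith [a1.1, a1.2, a2.1, a2.2]
        · rw [abs_mul, abs_two]
          gcongr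
          exact abs_le_of_mem_Icc (hYv (H - (h + 1)) (h + 1) s')
      rw [expect_sub _ (fun s' => abs_le_of_mem_Icc (optV_mem_Icc M π hh s'))
        (fun s' => abs_le_of_mem_Icc (valueV_mem_Icc M π hh s')), expect_const_mul] at e1
      linarith [(hY h s).1]
    · have a1 := gapMin_le_gap M π hh s _ hg
      have a2 := valueV_le_optQ M π hh s
      have a3 := h1 h hh.le s
      have a4 := hopt h hh.le s
      have a5 : ((H - h : ℕ) : ℝ) * (gapMin M / (2 * H)) ≤ gapMin M / 2 := by
        have : ((H - h : ℕ) : ℝ) ≤ H := by exact_mod_cast Nat.sub_le H h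
        calc _ ≤ (H : ℝ) * (gapMin M / (2 * H)) := by gcongr
          _ = _ := by field_simp
      unfold gap at a1
      linarith

end Values

/-! ### Eluder dimension: counting large deviations, summing sensitivities and clipped bonuses -/

section Eluder

variable {X : Type*}

theorem sqNorm_nonneg (Z : Multiset X) (f : X → ℝ) : 0 ≤ sqNorm Z f := by
  refine Multiset.sum_nonneg fun x hx => ?_
  obtain ⟨y, -, rfl⟩ := Multiset.mem_map.1 hx
  positivity

theorem sqNorm_zero (f : X → ℝ) : sqNorm 0 f = 0 := by simp [sqNorm]

theorem sqNorm_add (Z Z' : Multiset X) (f : X → ℝ) :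
    sqNorm (Z + Z') f = sqNorm Z f + sqNorm Z' f := by simp [sqNorm]

theorem sqNorm_mono {Z Z' : Multiset X} (h : Z ≤ Z') (f : X → ℝ) : sqNorm Z f ≤ sqNorm Z' f := by
  obtain ⟨W, rfl⟩ := Multiset.le_iff_exists_add.1 h
  rw [sqNorm_add]
  linarith [sqNorm_nonneg W f]

theorem sqNorm_finset_sum {ι : Type*} (s : Finset ι) (b : ι → Multiset X) (f : X → ℝ) :
    sqNorm (∑ i ∈ s, b i) f = ∑ i ∈ s, sqNorm (b i) f := by
  classical
  induction s using Finset.induction_on with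
  | empty => simp [sqNorm]
  | insert i s hi ih => rw [Finset.sum_insert hi, Finset.sum_insert hi, sqNorm_add, ih]

/-- Every element of the list is `ε`-independent of the elements after it. -/
def IndepSeq (F : Set (X → ℝ)) (ε : ℝ) : List X → Prop
  | [] => True
  | x :: l => ¬ EpsDependent F ε (l : Multiset X) x ∧ IndepSeq F ε l

theorem IndepSeq.getElem {F : Set (X → ℝ)} {ε : ℝ} :
    ∀ {l : List X}, IndepSeq F ε l → ∀ (j : ℕ) (hj : j < l.length),
      ¬ EpsDependent F ε (l.drop (j + 1) : Multiset X) l[j]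
  | [], _, j, hj => by simp at hj
  | _ :: _, h, 0, _ => h.1
  | _ :: l, h, j + 1, hj => by
    simpa using IndepSeq.getElem (l := l) h.2 j (by simpa using hj)

/-- `IndepSeq` puts the newest element first, whereas the sequences in `eluderDim` start with the
oldest; hence the reversal. -/
theorem IndepSeq.length_le {F : Set (X → ℝ)} {ε ε₀ : ℝ} {l : List X} (h : IndepSeq F ε l)
    (hε : ε₀ ≤ ε) : (l.length : ℕ∞) ≤ eluderDim F ε₀ := by
  refine le_sSup ⟨l.reverse, by simp, ε, hε, fun i hi => ?_⟩
  have hi' : i < l.length := by simpa using hi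
  have := h.getElem (l.length - 1 - i) (by omega)
  rw [List.getElem_reverse, List.take_reverse, Multiset.coe_reverse]
  convert this using 3
  congr 1
  omega

/-- Greedy distribution of the indices in `J` over `m` buckets. Together the buckets are a
sub-multiset of the past, on which the witness has squared norm at most
$R\varepsilon^2<m\varepsilon^2$. So some bucket has squared norm at most $\varepsilon^2$, and the
new point is independent of that bucket. -/
theorem exists_indep_buckets {F : Set (X → ℝ)} {ε R : ℝ} (hε : 0 < ε) {m : ℕ} (hR : R < m)
    (z : ℕ → X) (J : Finset ℕ)
    (hJ : ∀ j ∈ J, ∃ f ∈ F, ∃ g ∈ F, ε < |f (z j) - g (z j)| ∧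
      sqNorm ((Multiset.range j).map z) (f - g) ≤ R * ε ^ 2) (n : ℕ) :
    ∃ b : Fin m → List X, (∀ i, IndepSeq F ε (b i)) ∧
      ∑ i, (b i).length = (J ∩ Finset.range n).card ∧
      ∑ i, (b i : Multiset X) ≤ (Multiset.range n).map z := by
  induction n with
  | zero => exact ⟨fun _ => [], fun _ => trivial, by simp, by simp⟩
  | succ n ih =>
    obtain ⟨b, hb, hlen, hle⟩ := ih
    by_cases hn : n ∈ J
    · obtain ⟨f, hf, g, hg, hfg, hnorm⟩ := hJ n hn
      have hex : ∃ i, sqNorm (b i : Multiset X) (f - g) ≤ ε ^ 2 := by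
        by_contra! hcon
        have h1 := sqNorm_mono hle (f - g)
        rw [sqNorm_finset_sum] at h1
        have h2 : ∑ _i : Fin m, ε ^ 2 ≤ ∑ i, sqNorm (b i : Multiset X) (f - g) :=
          Finset.sum_le_sum fun i _ => (hcon i).le
        rw [Finset.sum_const, Finset.card_univ, Fintype.card_fin, nsmul_eq_mul] at h2
        have h3 : R * ε ^ 2 < m * ε ^ 2 := mul_lt_mul_of_pos_right hR (by positivity)
        linarith
      obtain ⟨i, hi⟩ := hex
      refine ⟨Function.update b i (z n :: b i), fun j => ?_, ?_, ?_⟩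
      · rcases eq_or_ne j i with rfl | hj
        · rw [Function.update_self]
          refine ⟨fun hdep => ?_, hb j⟩
          have := hdep f hf g hg ((Real.sqrt_le_left hε.le).2 hi)
          linarith
        · rw [Function.update_of_ne hj]; exact hb j
      · rw [Finset.range_add_one, Finset.inter_insert_of_mem hn, Finset.card_insert_of_notMem
          (by simp), ← hlen, ← Finset.add_sum_erase _ _ (Finset.mem_univ i),
          ← Finset.add_sum_erase _ (fun i => (b i).length) (Finset.mem_univ i),
          Function.update_self, Finset.sum_congr rfl fun j hj => by
            rw [Function.update_of_ne (Finset.ne_of_mem_erase hj)]]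
        simp only [List.length_cons]
        omega
      · have : ∑ j, ((Function.update b i (z n :: b i) j : List X) : Multiset X)
            = z n ::ₘ ∑ j, (b j : Multiset X) := by
          rw [← Finset.add_sum_erase _ _ (Finset.mem_univ i),
            ← Finset.add_sum_erase _ (fun i => (b i : Multiset X)) (Finset.mem_univ i),
            Function.update_self, Finset.sum_congr rfl fun j hj => by
            rw [Function.update_of_ne (Finset.ne_of_mem_erase hj)]]
          rw [← Multiset.cons_coe, Multiset.cons_add]
        rw [this, Multiset.range_succ, Multiset.map_cons]
        exact (Multiset.cons_le_cons_iff _).2 hle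
    · refine ⟨b, hb, ?_, ?_⟩
      · rw [Finset.range_add_one, Finset.inter_insert_of_notMem hn, hlen]
      · rw [Multiset.range_succ, Multiset.map_cons]
        exact hle.trans (Multiset.le_cons_self _ _)

/-- The number of times at which a sequence admits a large deviation that is not much larger than
allowed by its past is bounded by the eluder dimension. -/
theorem card_le_eluderDim {F : Set (X → ℝ)} {ε₀ ε R : ℝ} (hε : 0 < ε) (hε₀ : ε₀ ≤ ε)
    (hR : 0 ≤ R) (hfin : eluderDim F ε₀ ≠ ⊤) (z : ℕ → X) (J : Finset ℕ)
    (hJ : ∀ j ∈ J, ∃ f ∈ F, ∃ g ∈ F, ε < |f (z j) - g (z j)| ∧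
      sqNorm ((Multiset.range j).map z) (f - g) ≤ R * ε ^ 2) :
    (J.card : ℝ) ≤ (eluderDim F ε₀).toNat * (R + 1) := by
  obtain ⟨n, hn⟩ : ∃ n, J ⊆ Finset.range n :=
    ⟨J.sup id + 1, fun j hj => Finset.mem_range.2 (Nat.lt_succ_of_le (Finset.le_sup (f := id) hj))⟩
  -- $\lfloor R\rfloor+1$ is the least number of buckets exceeding `R`, and each bucket has length
  -- at most the eluder dimension.
  obtain ⟨b, hb, hlen, -⟩ := exists_indep_buckets (m := ⌊R⌋₊ + 1) hε
    (by push_cast; exact Nat.lt_floor_add_one R) z J hJ n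
  rw [Finset.inter_eq_left.2 hn] at hlen
  have h1 : ∀ i, (b i).length ≤ (eluderDim F ε₀).toNat := fun i => by
    have := (hb i).length_le hε₀
    rw [← ENat.natCast_toNat hfin] at this
    exact_mod_cast this
  have h2 : J.card ≤ (⌊R⌋₊ + 1) * (eluderDim F ε₀).toNat := by
    rw [← hlen]
    refine (Finset.sum_le_card_nsmul _ _ _ fun i _ => h1 i).trans ?_
    simp
  calc (J.card : ℝ) ≤ ((⌊R⌋₊ + 1) * (eluderDim F ε₀).toNat : ℕ) := by exact_mod_cast h2
    _ = (eluderDim F ε₀).toNat * (⌊R⌋₊ + 1 : ℝ) := by push_cast; ring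
    _ ≤ _ := by gcongr; exact Nat.floor_le hR

/-- The sensitivity of `z` with respect to the full dataset `Z`. -/
noncomputable def fullSens (F : Set (X → ℝ)) (β : ℝ) (Z : Multiset X) (z : X) : ℝ :=
  sSup {x : ℝ | ∃ f ∈ F, ∃ g ∈ F, x = (f z - g z) ^ 2 / (sqNorm Z (f - g) + β)}

theorem sq_sub_le {F : Set (X → ℝ)} {b : ℝ} (hF : ∀ f ∈ F, ∀ x, f x ∈ Set.Icc (0 : ℝ) b)
    {f g : X → ℝ} (hf : f ∈ F) (hg : g ∈ F) (x : X) : (f x - g x) ^ 2 ≤ b ^ 2 := by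
  have h1 := hF f hf x
  have h2 := hF g hg x
  rw [sq_le_sq, abs_of_nonneg (h1.1.trans h1.2), abs_le]
  constructor <;> linarith [h1.1, h1.2, h2.1, h2.2]

/-- The condition $b^2\le\beta$ bounds every quotient by one, so the supremum is a genuine one. -/
theorem fullSens_bounds {F : Set (X → ℝ)} {b β : ℝ} (hF : ∀ f ∈ F, ∀ x, f x ∈ Set.Icc (0 : ℝ) b)
    (hne : F.Nonempty) (hβ0 : 0 < β) (hβ : b ^ 2 ≤ β) (Z : Multiset X) (z : X) :
    (∀ f ∈ F, ∀ g ∈ F, (f z - g z) ^ 2 / (sqNorm Z (f - g) + β) ≤ fullSens F β Z z) ∧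
      0 ≤ fullSens F β Z z ∧ fullSens F β Z z ≤ 1 := by
  have hb : ∀ x ∈ {x : ℝ | ∃ f ∈ F, ∃ g ∈ F, x = (f z - g z) ^ 2 / (sqNorm Z (f - g) + β)},
      x ≤ 1 := by
    rintro _ ⟨f, hf, g, hg, rfl⟩
    have := sqNorm_nonneg Z (f - g)
    rw [div_le_one (by linarith)]
    linarith [sq_sub_le hF hf hg z]
  obtain ⟨f, hf⟩ := hne
  have h1 : ∀ f ∈ F, ∀ g ∈ F, (f z - g z) ^ 2 / (sqNorm Z (f - g) + β) ≤ fullSens F β Z z :=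
    fun f hf g hg => le_csSup ⟨1, hb⟩ ⟨f, hf, g, hg, rfl⟩
  refine ⟨h1, ?_, csSup_le ⟨_, f, hf, f, hf, rfl⟩ hb⟩
  refine le_trans ?_ (h1 f hf f hf)
  simp

theorem exists_two_pow {T : ℝ} (hT : 3 ≤ T) :
    ∃ q : ℕ, T ≤ 2 ^ q ∧ (q : ℝ) + 2 ≤ 5 * Real.log T := by
  have hlog1 : 1 ≤ Real.log T := by
    rw [Real.le_log_iff_exp_le (by linarith)]
    exact Real.exp_one_lt_d9.le.trans (by linarith)
  have hl2 := Real.log_two_gt_d9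
  refine ⟨⌈Real.logb 2 T⌉₊, ?_, ?_⟩
  · rw [← Real.rpow_natCast, ← Real.logb_le_iff_le_rpow (by norm_num) (by linarith)]
    exact Nat.le_ceil _
  · have h1 := Nat.ceil_lt_add_one (a := Real.logb 2 T)
      (Real.logb_nonneg (by norm_num) (by linarith))
    have h2 : Real.logb 2 T ≤ 2 * Real.log T := by
      rw [Real.logb, div_le_iff₀ (by linarith)]
      nlinarith
    linarith

/-- Sort the times by the dyadic size of a near-optimal quotient $t_k$ and of its numerator $w_k$.
In the class $t\approx2^a$, $w\approx2^c$ the past norm is at most about $2^c/2^a$, so the eluder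
count allows about $\dim_E/2^a$ times, each contributing about $2^a$. Every class thus contributes
at most $20\dim_E$, and there are at most $75\log^2T$ classes. Sensitivities up to $1/T$ contribute
at most one altogether. -/
theorem sum_fullSens_le {F : Set (X → ℝ)} {b β T : ℝ}
    (hF : ∀ f ∈ F, ∀ x, f x ∈ Set.Icc (0 : ℝ) b)
    (hne : F.Nonempty) (hβ4 : 4 ≤ β) (hβ : b ^ 2 ≤ β) (hT : 3 ≤ T) (hbT : b ≤ 2 * T)
    (hb0 : 0 ≤ b) (hfin : eluderDim F (1 / T) ≠ ⊤) (z : ℕ → X) (n : ℕ) (hn : (n : ℝ) ≤ T) :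
    ∑ k ∈ Finset.range n, fullSens F β ((Multiset.range k).map z) (z k)
      ≤ 1 + 1500 * (eluderDim F (1 / T)).toNat * Real.log T ^ 2 := by
  classical
  set s : ℕ → ℝ := fun k => fullSens F β ((Multiset.range k).map z) (z k) with hs
  set d : ℝ := (((eluderDim F (1 / T)).toNat : ℕ) : ℝ) with hd
  have hd0 : 0 ≤ d := Nat.cast_nonneg _
  have hbd := fun k => fullSens_bounds hF hne (by linarith) hβ ((Multiset.range k).map z) (z k)
  obtain ⟨q, hq, hq2⟩ := exists_two_pow hT
  -- The supremum need not be attained; a pair reaching more than half of it suffices.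
  have hwit : ∀ k, 1 / T < s k → ∃ f ∈ F, ∃ g ∈ F,
      s k / 2 < (f (z k) - g (z k)) ^ 2 / (sqNorm ((Multiset.range k).map z) (f - g) + β) := by
    intro k hk
    have hpos : 0 < s k := lt_trans (by positivity) hk
    by_contra! hcon
    have : s k ≤ s k / 2 := by
      obtain ⟨f, hf⟩ := hne
      refine csSup_le ⟨_, f, hf, f, hf, rfl⟩ ?_
      rintro _ ⟨f, hf, g, hg, rfl⟩
      exact hcon f hf g hg
    linarith
  choose! f hf g hg hfg using hwit
  set w : ℕ → ℝ := fun k => (f k (z k) - g k (z k)) ^ 2 with hw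
  set t : ℕ → ℝ := fun k => w k / (sqNorm ((Multiset.range k).map z) (f k - g k) + β) with ht
  set J := (Finset.range n).filter fun k => 1 / T < s k with hJ
  have hden : ∀ k, 0 < sqNorm ((Multiset.range k).map z) (f k - g k) + β := fun k => by
    linarith [sqNorm_nonneg ((Multiset.range k).map z) (f k - g k)]
  have htT : ∀ k ∈ J, 1 / (2 * T) < t k := fun k hk => by
    have h1 := (Finset.mem_filter.1 hk).2
    have h2 := hfg k h1
    have : 1 / (2 * T) = 1 / T / 2 := by field_simp
    rw [this]
    simp only [ht, hw]
    linarith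
  have ht1 : ∀ k ∈ J, t k ≤ 1 := fun k hk => by
    have h1 := (Finset.mem_filter.1 hk).2
    exact ((hbd k).1 _ (hf k h1) _ (hg k h1)).trans (hbd k).2.2
  have hT0 : 0 < T := by linarith
  have htpos : ∀ k ∈ J, 0 < t k := fun k hk => lt_trans (by positivity) (htT k hk)
  have hwt : ∀ k, w k = t k * (sqNorm ((Multiset.range k).map z) (f k - g k) + β) := fun k => by
    simp only [ht]; rw [div_mul_cancel₀ _ (hden k).ne']
  have hwT : ∀ k ∈ J, 2 / T ≤ w k := fun k hk => by
    have h1 := htT k hk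
    have h2 := sqNorm_nonneg ((Multiset.range k).map z) (f k - g k)
    rw [hwt k]
    calc 2 / T = 1 / (2 * T) * 4 := by field_simp; norm_num
      _ ≤ _ := by gcongr; linarith
  have hwb : ∀ k ∈ J, w k ≤ b ^ 2 := fun k hk => by
    have h1 := (Finset.mem_filter.1 hk).2
    exact sq_sub_le hF (hf k h1) (hg k h1) _
  have hwpos : ∀ k ∈ J, 0 < w k := fun k hk => lt_of_lt_of_le (by positivity) (hwT k hk)
  have hsplit : ∑ k ∈ Finset.range n, s k ≤ 1 + ∑ k ∈ J, 2 * t k := by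
    rw [← Finset.sum_filter_add_sum_filter_not _ (fun k => 1 / T < s k), add_comm]
    refine add_le_add ?_ ?_
    · have h1 : ∑ k ∈ (Finset.range n).filter (fun k => ¬ 1 / T < s k), s k
          ≤ ((Finset.range n).filter (fun k => ¬ 1 / T < s k)).card • (1 / T) :=
        Finset.sum_le_card_nsmul _ _ _ fun k hk => not_lt.1 (Finset.mem_filter.1 hk).2
      refine h1.trans ?_
      rw [nsmul_eq_mul]
      have h2 : (((Finset.range n).filter (fun k => ¬ 1 / T < s k)).card : ℝ) ≤ T := by
        refine le_trans ?_ hn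
        exact_mod_cast (Finset.card_filter_le _ _).trans (by simp)
      calc _ ≤ T * (1 / T) := by gcongr
        _ = 1 := by field_simp
    · refine Finset.sum_le_sum fun k hk => ?_
      have h1 := (Finset.mem_filter.1 hk).2
      have := hfg k h1
      simp only [ht, hw]
      linarith
  have htwo : ∀ a : ℤ, (0 : ℝ) < (2 : ℝ) ^ a := fun a => by positivity
  set I₁ : Finset ℤ := Finset.Icc (-(q + 1 : ℕ) : ℤ) 0 with hI₁
  set I₂ : Finset ℤ := Finset.Icc (-(q + 1 : ℕ) : ℤ) ((2 * q + 2 : ℕ) : ℤ) with hI₂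
  have hlow : ∀ x : ℝ, 1 / (2 * T) ≤ x → 0 < x → (-(q + 1 : ℕ) : ℤ) ≤ Int.log 2 x := by
    intro x hx hx0
    rw [← Int.zpow_le_iff_le_log (by norm_num) hx0]
    refine le_trans ?_ hx
    rw [zpow_neg, zpow_natCast, one_div]
    push_cast
    refine inv_anti₀ (by positivity) ?_
    rw [pow_succ]; linarith
  -- The ranges are $1/(2T)<t\le1$ and, as $\beta\ge4$ and $b\le2T$, $2/T\le w\le4T^2$.
  have hmaps : ∀ k ∈ J, (Int.log 2 (t k), Int.log 2 (w k)) ∈ I₁ ×ˢ I₂ := by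
    intro k hk
    rw [Finset.mem_product, Finset.mem_Icc, Finset.mem_Icc]
    refine ⟨⟨hlow _ (htT k hk).le (htpos k hk), ?_⟩, hlow _ ?_ (hwpos k hk), ?_⟩
    · calc Int.log 2 (t k) ≤ Int.log 2 (1 : ℝ) := Int.log_mono_right (htpos k hk) (ht1 k hk)
        _ = 0 := Int.log_one_right 2
    · refine le_trans ?_ (hwT k hk)
      rw [div_le_div_iff₀ (by positivity) hT0]; linarith
    · refine (Int.log_mono_right (hwpos k hk) (r₂ := ((2 : ℕ) : ℝ) ^ ((2 * q + 2 : ℕ) : ℤ))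
        ?_).trans (Int.log_zpow (R := ℝ) (b := 2) (by norm_num) _).le
      refine (hwb k hk).trans ?_
      rw [zpow_natCast]
      calc b ^ 2 ≤ (2 * 2 ^ q) ^ 2 := by
            gcongr; linarith
        _ = _ := by push_cast; ring
  have hclass : ∀ p ∈ I₁ ×ˢ I₂,
      ∑ k ∈ J with (Int.log 2 (t k), Int.log 2 (w k)) = p, 2 * t k ≤ 20 * d := by
    rintro ⟨a, c⟩ hp
    rw [Finset.mem_product, Finset.mem_Icc, Finset.mem_Icc] at hp
    simp only at hp
    set J' := J.filter fun k => (Int.log 2 (t k), Int.log 2 (w k)) = (a, c) with hJ'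
    have hmem : ∀ k ∈ J', k ∈ J ∧ (2 : ℝ) ^ a ≤ t k ∧ t k < 2 ^ (a + 1) ∧ (2 : ℝ) ^ c ≤ w k ∧
        w k < 2 ^ (c + 1) := by
      intro k hk
      obtain ⟨hk, he⟩ := Finset.mem_filter.1 hk
      rw [Prod.mk.injEq] at he
      have e1 := Int.zpow_log_le_self (R := ℝ) (b := 2) (by norm_num) (htpos k hk)
      have e2 := Int.lt_zpow_succ_log_self (R := ℝ) (b := 2) (by norm_num) (t k)
      have e3 := Int.zpow_log_le_self (R := ℝ) (b := 2) (by norm_num) (hwpos k hk)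
      have e4 := Int.lt_zpow_succ_log_self (R := ℝ) (b := 2) (by norm_num) (w k)
      rw [he.1] at e1 e2
      rw [he.2] at e3 e4
      exact ⟨hk, by exact_mod_cast e1, by exact_mod_cast e2, by exact_mod_cast e3,
        by exact_mod_cast e4⟩
    have ha1 : (2 : ℝ) ^ a ≤ 1 := zpow_le_one_of_nonpos₀ (by norm_num) hp.1.2
    rcases J'.eq_empty_or_nonempty with hemp | ⟨k₀, hk₀⟩
    · rw [hemp, Finset.sum_empty]; positivity
    have hε0 : 0 < Real.sqrt ((2 : ℝ) ^ c / 2) := Real.sqrt_pos.2 (by have := htwo c; positivity)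
    have hεsq : Real.sqrt ((2 : ℝ) ^ c / 2) ^ 2 = 2 ^ c / 2 :=
      Real.sq_sqrt (by have := htwo c; positivity)
    -- With $\varepsilon^2=2^c/2$ the deviation exceeds $\varepsilon$, and the past norm is at most
    -- $2^{c+1}/2^a=(4/2^a)\varepsilon^2$.
    have hcard : (J'.card : ℝ) ≤ d * (4 / 2 ^ a + 1) := by
      refine card_le_eluderDim (ε := Real.sqrt ((2 : ℝ) ^ c / 2)) hε0 ?_
        (by have := htwo a; positivity) hfin z J' ?_
      · refine Real.le_sqrt_of_sq_le ?_
        obtain ⟨hk, -, -, -, h4⟩ := hmem k₀ hk₀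
        have h5 := hwT k₀ hk
        rw [zpow_add_one₀ (by norm_num)] at h4
        have h6 : (1 / T) ^ 2 ≤ 1 / T / 2 := by
          rw [sq, div_eq_mul_inv _ (2 : ℝ)]
          gcongr
          rw [one_div]; exact inv_anti₀ (by norm_num) (by linarith)
        have h7 : 2 / T = 4 * (1 / T / 2) := by field_simp; norm_num
        linarith
      · intro k hk
        obtain ⟨hk, h1, h2, h3, h4⟩ := hmem k hk
        have hsk := (Finset.mem_filter.1 hk).2
        refine ⟨f k, hf k hsk, g k, hg k hsk, ?_, ?_⟩
        · rw [← Real.sqrt_sq_eq_abs]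
          refine Real.sqrt_lt_sqrt (by have := htwo c; positivity) ?_
          have := htwo c
          simp only [hw] at h3
          linarith
        · rw [hεsq]
          have e1 := hwt k
          have e2 := hden k
          have e3 : (2 : ℝ) ^ a * sqNorm ((Multiset.range k).map z) (f k - g k) ≤ 2 ^ (c + 1) := by
            calc _ ≤ t k * (sqNorm ((Multiset.range k).map z) (f k - g k) + β) := by
                  have := sqNorm_nonneg ((Multiset.range k).map z) (f k - g k)
                  have := htwo a
                  gcongr
                  linarith
              _ ≤ _ := by rw [← e1]; exact h4.le
          rw [zpow_add_one₀ (by norm_num)] at e3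
          rw [show 4 / (2 : ℝ) ^ a * (2 ^ c / 2) = 2 ^ c * 2 / 2 ^ a by ring,
            le_div_iff₀ (htwo a)]
          linarith
    calc ∑ k ∈ J', 2 * t k ≤ J'.card • (2 * 2 ^ (a + 1)) := by
          refine Finset.sum_le_card_nsmul _ _ _ fun k hk => ?_
          have := (hmem k hk).2.2.1
          linarith
      _ = J'.card * (4 * 2 ^ a) := by
          rw [nsmul_eq_mul, zpow_add_one₀ (by norm_num)]; ring
      _ ≤ d * (4 / 2 ^ a + 1) * (4 * 2 ^ a) := by have := htwo a; gcongr
      _ = d * (16 + 4 * 2 ^ a) := by have := (htwo a).ne'; field_simp; ring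
      _ ≤ d * 20 := by gcongr; linarith
      _ = _ := by ring
  have hsum : ∑ k ∈ J, 2 * t k ≤ ((I₁ ×ˢ I₂).card : ℝ) * (20 * d) := by
    rw [← Finset.sum_fiberwise_of_maps_to hmaps]
    refine (Finset.sum_le_card_nsmul _ _ _ hclass).trans ?_
    rw [nsmul_eq_mul]
  have hcards : ((I₁ ×ˢ I₂).card : ℝ) ≤ 75 * Real.log T ^ 2 := by
    rw [Finset.card_product, hI₁, hI₂, Int.card_Icc, Int.card_Icc]
    have e1 : (0 + 1 - (-(q + 1 : ℕ) : ℤ)).toNat = q + 2 := by omega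
    have e2 : (((2 * q + 2 : ℕ) : ℤ) + 1 - (-(q + 1 : ℕ) : ℤ)).toNat = 3 * q + 4 := by omega
    rw [e1, e2]
    push_cast
    have hq0 : (0 : ℝ) ≤ q := Nat.cast_nonneg q
    have hl : 0 ≤ Real.log T := Real.log_nonneg (by linarith)
    calc ((q : ℝ) + 2) * (3 * q + 4) ≤ (5 * Real.log T) * (15 * Real.log T) := by
          gcongr; linarith
      _ = _ := by ring
  calc ∑ k ∈ Finset.range n, s k ≤ 1 + ∑ k ∈ J, 2 * t k := hsplit
    _ ≤ 1 + 75 * Real.log T ^ 2 * (20 * d) := by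
        gcongr; exact hsum.trans (by gcongr)
    _ = _ := by ring

/-- Dyadic summation of a clipped sequence from the counts of its large values. -/
theorem sum_clipped_le {Y : ℕ → ℝ} {n : ℕ} {x₀ d b Hr : ℝ} (hx₀ : 0 < x₀) (hd : 0 ≤ d)
    (hb : 0 ≤ b) (hHr : 0 ≤ Hr) (hY : ∀ k < n, Y k ≤ Hr) (hclip : ∀ k < n, Y k = 0 ∨ x₀ < Y k)
    (hcnt : ∀ x ≥ x₀, (((Finset.range n).filter fun k => x < Y k).card : ℝ)
      ≤ d * (b / x ^ 2 + 1)) :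
    ∑ k ∈ Finset.range n, Y k ≤ 4 * d * b / x₀ + 4 * d * Hr := by
  classical
  have hex : ∃ N : ℕ, Hr ≤ 2 ^ N * x₀ := by
    obtain ⟨N, hN⟩ := pow_unbounded_of_one_lt (Hr / x₀) (by norm_num : (1 : ℝ) < 2)
    exact ⟨N, by rw [div_lt_iff₀ hx₀] at hN; exact hN.le⟩
  -- Taking the smallest number of levels keeps the increasing geometric sum below $2H_r/x_0$.
  obtain ⟨N, hN, hmin⟩ : ∃ N : ℕ, Hr ≤ 2 ^ N * x₀ ∧ ((2 : ℝ) ^ N * x₀ ≤ 2 * Hr ∨ N = 0) := by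
    refine ⟨Nat.find hex, Nat.find_spec hex, ?_⟩
    rcases Nat.eq_zero_or_pos (Nat.find hex) with h0 | h0
    · exact Or.inr h0
    · left
      have := Nat.find_min hex (m := Nat.find hex - 1) (by omega)
      rw [not_le] at this
      have e : (2 : ℝ) ^ Nat.find hex = 2 * 2 ^ (Nat.find hex - 1) := by
        rw [← pow_succ']; congr 1; omega
      rw [e]; linarith
  -- A nonzero value is at most twice the highest level $2^ix_0$ below it, hence at most the sum of
  -- all doubled levels that it exceeds.
  have hpt : ∀ y : ℝ, (y = 0 ∨ x₀ < y) → ∀ m : ℕ, y ≤ 2 ^ m * x₀ →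
      y ≤ ∑ i ∈ Finset.range m, if 2 ^ i * x₀ < y then 2 ^ (i + 1) * x₀ else 0 := by
    intro y hy m
    induction m with
    | zero =>
      intro h
      rcases hy with rfl | hy
      · simp
      · simp at h; linarith
    | succ m ih =>
      intro h
      rw [Finset.sum_range_succ]
      by_cases hm : 2 ^ m * x₀ < y
      · rw [if_pos hm]
        have : 0 ≤ ∑ i ∈ Finset.range m, if 2 ^ i * x₀ < y then 2 ^ (i + 1) * x₀ else 0 :=
          Finset.sum_nonneg fun i _ => by split_ifs <;> positivity
        linarith
      · rw [if_neg hm, add_zero]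
        exact ih (not_lt.1 hm)
  calc ∑ k ∈ Finset.range n, Y k
      ≤ ∑ k ∈ Finset.range n, ∑ i ∈ Finset.range N,
          (if 2 ^ i * x₀ < Y k then 2 ^ (i + 1) * x₀ else 0) :=
        Finset.sum_le_sum fun k hk => hpt _ (hclip k (Finset.mem_range.1 hk)) N
          ((hY k (Finset.mem_range.1 hk)).trans hN)
    _ = ∑ i ∈ Finset.range N,
          ((Finset.range n).filter fun k => 2 ^ i * x₀ < Y k).card * (2 ^ (i + 1) * x₀) := by
        rw [Finset.sum_comm]
        refine Finset.sum_congr rfl fun i _ => ?_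
        rw [← Finset.sum_filter, Finset.sum_const, nsmul_eq_mul]
    _ ≤ ∑ i ∈ Finset.range N, (2 * d * b / x₀ * (1 / 2) ^ i + 2 * d * x₀ * 2 ^ i) := by
        refine Finset.sum_le_sum fun i _ => ?_
        have h1 := hcnt (2 ^ i * x₀) (by
          have : (1 : ℝ) ≤ 2 ^ i := one_le_pow₀ (by norm_num)
          show x₀ ≤ _
          nlinarith)
        calc _ ≤ d * (b / (2 ^ i * x₀) ^ 2 + 1) * (2 ^ (i + 1) * x₀) := by gcongr
          _ = _ := by rw [one_div, inv_pow]; field_simp; ring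
    _ = 2 * d * b / x₀ * ∑ i ∈ Finset.range N, (1 / 2 : ℝ) ^ i
          + 2 * d * x₀ * ∑ i ∈ Finset.range N, (2 : ℝ) ^ i := by
        rw [Finset.sum_add_distrib, Finset.mul_sum, Finset.mul_sum]
    _ ≤ 2 * d * b / x₀ * 2 + 2 * d * (2 * Hr) := by
        have h1 : ∑ i ∈ Finset.range N, (1 / 2 : ℝ) ^ i ≤ 2 := by
          simpa using sum_geometric_two_le N
        have h2 : x₀ * ∑ i ∈ Finset.range N, (2 : ℝ) ^ i ≤ 2 * Hr := by
          rw [geom_sum_eq (by norm_num)]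
          rcases hmin with h | rfl
          · nlinarith
          · simpa using hHr
        have h3 : 0 ≤ 2 * d * b / x₀ := by positivity
        have h4 : 0 ≤ 2 * d := by positivity
        nlinarith [mul_le_mul_of_nonneg_left h1 h3, mul_le_mul_of_nonneg_left h2 h4]
    _ = _ := by ring

end Eluder

/-! ### The algorithm as a random path of learner states -/

section SampledRun

variable {S : Type u} {A : Type v} {H : ℕ}

/-- The law of the sub-sampled datasets after the sampling phase of an episode. -/
noncomputable def subLaw (H : ℕ) (cfg : Config S A) (st : LearnerState S A) :
    PMF (ℕ → Multiset (S × A)) :=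
  match st.past with
  | [] => PMF.pure st.sub
  | e :: _ => sampleAll H cfg e H st.sub

open Classical in
/-- The policy of the next episode, when the sub-sampled datasets have become `sub'`. -/
noncomputable def nextPolicy (M : EpisodicMDP S A H) (cfg : Config S A) (st : LearnerState S A)
    (sub' : ℕ → Multiset (S × A)) : Policy S A :=
  match st.past with
  | [] => plan M cfg [] sub'
  | e :: rest => if ∃ h < H, sub' h ≠ st.ref h then plan M cfg (e :: rest) sub' else e.policy

open Classical in
/-- The reference datasets of the next episode. -/
noncomputable def nextRef (H : ℕ) (st : LearnerState S A) (sub' : ℕ → Multiset (S × A)) :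
    ℕ → Multiset (S × A) :=
  match st.past with
  | [] => sub'
  | _ :: _ => if ∃ h < H, sub' h ≠ st.ref h then sub' else st.ref

/-- The state after an episode in which the states `σ` have been visited. -/
noncomputable def nextState (M : EpisodicMDP S A H) (cfg : Config S A) (st : LearnerState S A)
    (sub' : ℕ → Multiset (S × A)) (σ : ℕ → S) : LearnerState S A :=
  ⟨⟨nextPolicy M cfg st sub', σ⟩ :: st.past, sub', nextRef H st sub'⟩

/-- All branches of the main loop take the same form: sampling first, then a rollout with a policy
determined by the sample. This separates the two sources of randomness. -/
theorem episodeStep_eq (M : EpisodicMDP S A H) (cfg : Config S A) (st : LearnerState S A) :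
    episodeStep M cfg st = (subLaw H cfg st).bind fun sub' =>
      (rollout M (nextPolicy M cfg st sub') H 0 fun _ => M.s₁).map (nextState M cfg st sub') := by
  obtain ⟨past, sub, ref⟩ := st
  cases past with
  | nil =>
    simp only [episodeStep, subLaw, PMF.pure_bind, nextPolicy, play]
    rfl
  | cons e rest =>
    simp only [episodeStep, subLaw, nextPolicy, play]
    congr 1
    funext sub'
    by_cases hc : ∃ h < H, sub' h ≠ ref h
    · simp only [if_pos hc]
      congr 1
      funext σ
      simp only [nextState, nextPolicy, nextRef, if_pos hc]
    · simp only [if_neg hc]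
      congr 1
      funext σ
      simp only [nextState, nextPolicy, nextRef, if_neg hc]

theorem lexp_episodeStep (M : EpisodicMDP S A H) (cfg : Config S A) (st : LearnerState S A)
    (Φ : LearnerState S A → ℝ≥0∞) :
    lexp (episodeStep M cfg st) Φ = lexp (subLaw H cfg st) fun sub' =>
      lexp (rollout M (nextPolicy M cfg st sub') H 0 fun _ => M.s₁) fun σ =>
        Φ (nextState M cfg st sub' σ) := by
  rw [episodeStep_eq, lexp_bind]
  simp only [lexp_map]

/-- The sampling at step `n` reads and writes only coordinate `n`, so the marginal at `h` is a
single call of `onlineSample`. -/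
theorem lexp_sampleAll (cfg : Config S A) (e : Episode S A) (h : ℕ) (G : Multiset (S × A) → ℝ≥0∞)
    (n : ℕ) : ∀ Z : ℕ → Multiset (S × A), lexp (sampleAll H cfg e n Z) (fun W => G (W h)) =
      if h < n then lexp (onlineSample H cfg (Z h) (e.pair h)) G else G (Z h) := by
  induction n with
  | zero => intro Z; simp [sampleAll, lexp_pure]
  | succ n ih =>
    intro Z
    rw [sampleAll, lexp_bind]
    simp only [ih]
    rcases lt_trichotomy h n with hlt | rfl | hgt
    · simp only [if_pos hlt, if_pos (Nat.lt_succ_of_lt hlt), Function.update_of_ne hlt.ne,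
        lexp_const]
    · simp
    · rw [if_neg (by omega)]
      simp only [if_neg (show ¬ h < n by omega), Function.update_of_ne hgt.ne', lexp_const]

theorem sampleAll_support (cfg : Config S A) (e : Episode S A) (h : ℕ) (n : ℕ) :
    ∀ Z W : ℕ → Multiset (S × A), W ∈ (sampleAll H cfg e n Z).support →
      W h ∈ (onlineSample H cfg (Z h) (e.pair h)).support ∨ W h = Z h := by
  induction n with
  | zero =>
    intro Z W hW
    rw [sampleAll, PMF.mem_support_pure_iff] at hW
    exact Or.inr (by rw [hW])
  | succ n ih =>
    intro Z W hW
    rw [sampleAll, PMF.mem_support_bind_iff] at hW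
    obtain ⟨U, hU, hW⟩ := hW
    rcases eq_or_ne h n with rfl | hne
    · left
      have h1 : ∀ m ≤ h, ∀ Z W : ℕ → Multiset (S × A),
          W ∈ (sampleAll H cfg e m Z).support → W h = Z h := by
        intro m
        induction m with
        | zero =>
          intro _ Z W hW
          rw [sampleAll, PMF.mem_support_pure_iff] at hW
          rw [hW]
        | succ m ihm =>
          intro hm Z W hW
          rw [sampleAll, PMF.mem_support_bind_iff] at hW
          obtain ⟨U, -, hW⟩ := hW
          rw [ihm (by omega) _ _ hW, Function.update_of_ne (by omega)]
      rw [h1 h le_rfl _ _ hW, Function.update_self]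
      exact hU
    · have := ih _ _ hW
      rwa [Function.update_of_ne hne] at this

/-- Every new sub-sampled dataset arises by adding some copies of the rounded new point. -/
theorem onlineSample_support (cfg : Config S A) {Z W : Multiset (S × A)} {z : S × A}
    (hW : W ∈ (onlineSample H cfg Z z).support) :
    W = Multiset.replicate (copies H cfg Z z) (cfg.rnd z) + Z ∨ W = Z := by
  rw [onlineSample, PMF.mem_support_map_iff] at hW
  obtain ⟨b, -, rfl⟩ := hW
  cases b
  · right; simp
  · left; simp

/-- With zero copies the inverse is zero, and the formula says correctly that the dataset stays
unchanged. -/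
theorem lexp_onlineSample (cfg : Config S A) (Z : Multiset (S × A)) (z : S × A)
    (G : Multiset (S × A) → ℝ≥0∞) :
    lexp (onlineSample H cfg Z z) G =
      ENNReal.ofReal (copies H cfg Z z : ℝ)⁻¹ *
          G (Multiset.replicate (copies H cfg Z z) (cfg.rnd z) + Z) +
        ENNReal.ofReal (1 - (copies H cfg Z z : ℝ)⁻¹) * G Z := by
  set_option linter.deprecated false in
  rw [onlineSample, lexp_map, lexp, tsum_fintype, Fintype.sum_bool, PMF.bernoulli_apply,
    PMF.bernoulli_apply]
  have h1 : (((copies H cfg Z z : ℝ≥0)⁻¹ : ℝ≥0) : ℝ≥0∞) = ENNReal.ofReal (copies H cfg Z z : ℝ)⁻¹ := by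
    rw [← ENNReal.ofReal_coe_nnreal]; simp
  have h2 : ((1 - (copies H cfg Z z : ℝ≥0)⁻¹ : ℝ≥0) : ℝ≥0∞)
      = ENNReal.ofReal (1 - (copies H cfg Z z : ℝ)⁻¹) := by
    rw [← ENNReal.ofReal_coe_nnreal, NNReal.coe_sub (Nat.cast_inv_le_one _)]; simp
  simp [h1, h2, -ENNReal.coe_sub]

/-- The initial state of the algorithm. -/
def initState (S : Type u) (A : Type v) : LearnerState S A := ⟨[], fun _ => 0, fun _ => 0⟩

/-- The law of the sequence of the states of the algorithm after `0, …, k` episodes. -/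
noncomputable def hist (M : EpisodicMDP S A H) (cfg : Config S A) :
    ℕ → PMF (ℕ → LearnerState S A)
  | 0 => PMF.pure fun _ => initState S A
  | k + 1 => (hist M cfg k).bind fun ω =>
      (episodeStep M cfg (ω k)).map fun st => Function.update ω (k + 1) st

/-- The theorem concerns the last state only, but the potentials and the good event involve all
earlier states. -/
theorem hist_map (M : EpisodicMDP S A H) (cfg : Config S A) (k : ℕ) :
    (hist M cfg k).map (fun ω => ω k) = runLaw M cfg k := by
  induction k with
  | zero => rw [hist, PMF.pure_map]; rfl
  | succ k ih =>
    rw [hist, PMF.map_bind, runLaw, ← ih, PMF.bind_map]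
    congr 1
    funext ω
    rw [PMF.map_comp]
    have : ((fun ω : ℕ → LearnerState S A => ω (k + 1)) ∘ fun st =>
        Function.update ω (k + 1) st) = id := by
      funext st; simp
    rw [this, PMF.map_id]
    rfl

/-- The possible sequences of states of the algorithm. -/
def IsPath (M : EpisodicMDP S A H) (cfg : Config S A) (k : ℕ) (ω : ℕ → LearnerState S A) : Prop :=
  ω 0 = initState S A ∧ ∀ j < k, ω (j + 1) ∈ (episodeStep M cfg (ω j)).support

theorem isPath_of_mem_support (M : EpisodicMDP S A H) (cfg : Config S A) (k : ℕ) :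
    ∀ ω ∈ (hist M cfg k).support, IsPath M cfg k ω := by
  induction k with
  | zero =>
    intro ω hω
    rw [hist, PMF.mem_support_pure_iff] at hω
    exact ⟨by rw [hω], fun j hj => by omega⟩
  | succ k ih =>
    intro ω hω
    rw [hist, PMF.mem_support_bind_iff] at hω
    obtain ⟨ω', hω', h1⟩ := hω
    rw [PMF.mem_support_map_iff] at h1
    obtain ⟨st, hst, rfl⟩ := h1
    obtain ⟨h0, hs⟩ := ih ω' hω'
    refine ⟨by rw [Function.update_of_ne (by omega), h0], fun j hj => ?_⟩
    rcases Nat.lt_succ_iff_lt_or_eq.1 hj with hlt | rfl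
    · rw [Function.update_of_ne (by omega), Function.update_of_ne (by omega)]
      exact hs j hlt
    · rw [Function.update_self, Function.update_of_ne (by omega)]
      exact hst

/-- Additive drift bound for a potential of the history. -/
theorem lexp_hist_le (M : EpisodicMDP S A H) (cfg : Config S A)
    {Φ : ℕ → (ℕ → LearnerState S A) → ℝ≥0∞} {a c : ℝ≥0∞} {n : ℕ}
    (h0 : Φ 0 (fun _ => initState S A) ≤ a)
    (hstep : ∀ k < n, ∀ ω, lexp (episodeStep M cfg (ω k))
      (fun st => Φ (k + 1) (Function.update ω (k + 1) st)) ≤ Φ k ω + c) :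
    ∀ k ≤ n, lexp (hist M cfg k) (Φ k) ≤ a + k * c := by
  intro k
  induction k with
  | zero => intro _; rw [hist, lexp_pure]; simpa using h0
  | succ k ih =>
    intro hk
    rw [hist, lexp_bind]
    simp only [lexp_map]
    calc _ ≤ lexp (hist M cfg k) fun ω => Φ k ω + c :=
          lexp_mono fun ω => hstep k (by omega) ω
      _ = lexp (hist M cfg k) (Φ k) + c := by rw [lexp_add, lexp_const]
      _ ≤ a + k * c + c := by gcongr; exact ih (by omega)
      _ = _ := by push_cast; ring

theorem lexp_hist_state (M : EpisodicMDP S A H) (cfg : Config S A) (Φ : LearnerState S A → ℝ≥0∞)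
    {j k : ℕ} (hjk : j ≤ k) :
    lexp (hist M cfg k) (fun ω => Φ (ω j)) = lexp (hist M cfg j) (fun ω => Φ (ω j)) := by
  induction k, hjk using Nat.le_induction with
  | base => rfl
  | succ k hjk ih =>
    rw [hist, lexp_bind, ← ih]
    simp only [lexp_map, Function.update_of_ne (show j ≠ k + 1 by omega), lexp_const]

/-- Additive drift bound for a potential of the state of the algorithm. -/
theorem lexp_hist_state_le (M : EpisodicMDP S A H) (cfg : Config S A)
    {Φ : LearnerState S A → ℝ≥0∞} {a c : ℝ≥0∞} (h0 : Φ (initState S A) ≤ a)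
    (hstep : ∀ st, lexp (episodeStep M cfg st) Φ ≤ Φ st + c) {j k : ℕ} (hjk : j ≤ k) :
    lexp (hist M cfg k) (fun ω => Φ (ω j)) ≤ a + j * c := by
  rw [lexp_hist_state M cfg Φ hjk]
  refine lexp_hist_le M cfg (Φ := fun i ω => Φ (ω i)) (n := j) h0 (fun i _ ω => ?_) j le_rfl
  simpa using hstep (ω i)

/-- The episode number `j` of a sequence of states of the algorithm. -/
noncomputable def ep (M : EpisodicMDP S A H) (cfg : Config S A) (ω : ℕ → LearnerState S A)
    (j : ℕ) : Episode S A :=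
  -- On a path of length greater than `j` this list is nonempty and the default is not used.
  (ω (j + 1)).past.headD ⟨plan M cfg [] fun _ => 0, fun _ => M.s₁⟩

variable {M : EpisodicMDP S A H} {cfg : Config S A} {ω : ℕ → LearnerState S A} {k : ℕ}

theorem IsPath.step (hω : IsPath M cfg k ω) {j : ℕ} (hj : j < k) :
    ∃ sub' ∈ (subLaw H cfg (ω j)).support, ∃ σ,
      ω (j + 1) = nextState M cfg (ω j) sub' σ := by
  have := hω.2 j hj
  rw [episodeStep_eq, PMF.mem_support_bind_iff] at this
  obtain ⟨sub', hs, h1⟩ := this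
  rw [PMF.mem_support_map_iff] at h1
  obtain ⟨σ, -, h2⟩ := h1
  exact ⟨sub', hs, σ, h2.symm⟩

theorem IsPath.past_succ (hω : IsPath M cfg k ω) {j : ℕ} (hj : j < k) :
    (ω (j + 1)).past = ep M cfg ω j :: (ω j).past := by
  obtain ⟨sub', -, σ, h⟩ := hω.step hj
  rw [ep, h]
  rfl

theorem IsPath.past_zero (hω : IsPath M cfg k ω) : (ω 0).past = [] := by rw [hω.1]; rfl

theorem IsPath.past_coe (hω : IsPath M cfg k ω) {j : ℕ} (hj : j ≤ k) :
    ((ω j).past : Multiset (Episode S A)) = (Multiset.range j).map (ep M cfg ω) := by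
  induction j with
  | zero => rw [hω.past_zero]; simp
  | succ j ih =>
    rw [hω.past_succ (by omega), Multiset.range_succ, Multiset.map_cons, ← ih (by omega),
      Multiset.cons_coe]

theorem IsPath.sub_one (hω : IsPath M cfg k ω) (hk : 0 < k) (h : ℕ) : (ω 1).sub h = 0 := by
  obtain ⟨sub', hs, σ, h1⟩ := hω.step hk
  rw [subLaw, hω.past_zero, PMF.mem_support_pure_iff] at hs
  rw [h1, nextState, hs, hω.1]
  rfl

theorem IsPath.sub_succ (hω : IsPath M cfg k ω) {j : ℕ} (hj : j + 1 < k) (h : ℕ) :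
    (ω (j + 2)).sub h = Multiset.replicate
        (copies H cfg ((ω (j + 1)).sub h) ((ep M cfg ω j).pair h))
        (cfg.rnd ((ep M cfg ω j).pair h)) + (ω (j + 1)).sub h ∨
      (ω (j + 2)).sub h = (ω (j + 1)).sub h := by
  obtain ⟨sub', hs, σ, h1⟩ := hω.step hj
  rw [subLaw, hω.past_succ (by omega)] at hs
  rw [h1, nextState]
  rcases sampleAll_support cfg _ h H _ _ hs with h2 | h2
  · exact onlineSample_support cfg h2
  · exact Or.inr h2

theorem IsPath.sub_mono_succ (hω : IsPath M cfg k ω) {j : ℕ} (hj : j < k) (h : ℕ) :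
    (ω j).sub h ≤ (ω (j + 1)).sub h := by
  cases j with
  | zero => rw [hω.1]; exact Multiset.zero_le _
  | succ j =>
    rcases hω.sub_succ hj h with h1 | h1
    · rw [h1]; exact Multiset.le_add_left _ _
    · exact h1.ge

theorem IsPath.sub_mono (hω : IsPath M cfg k ω) {i j : ℕ} (hij : i ≤ j) (hj : j ≤ k) (h : ℕ) :
    (ω i).sub h ≤ (ω j).sub h := by
  induction j, hij using Nat.le_induction with
  | base => exact le_rfl
  | succ j hij ih => exact (ih (by omega)).trans (hω.sub_mono_succ (by omega) h)

/-- The reference is reset whenever it disagrees with the current datasets below the horizon. So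
comparing with the last computation is the same as comparing with the previous episode. -/
theorem IsPath.ref_eq (hω : IsPath M cfg k ω) {j : ℕ} (hj : j ≤ k) {h : ℕ} (hh : h < H) :
    (ω j).ref h = (ω j).sub h := by
  cases j with
  | zero => rw [hω.1]; rfl
  | succ j =>
    obtain ⟨sub', hs, σ, h1⟩ := hω.step hj
    rw [h1, nextState]
    rcases hp : (ω j).past with _ | ⟨e, rest⟩
    · simp only [nextRef, hp]
    · by_cases hc : ∃ h < H, sub' h ≠ (ω j).ref h
      · simp only [nextRef, hp, if_pos hc]
      · simp only [nextRef, hp, if_neg hc]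
        push Not at hc
        exact (hc h hh).symm

/-- Every policy is the plan of an earlier episode with the same sub-sampled datasets. -/
theorem IsPath.policy_eq (hω : IsPath M cfg k ω) {j : ℕ} (hj : j < k) :
    ∃ i ≤ j, (ep M cfg ω j).policy = plan M cfg (ω i).past (ω (i + 1)).sub ∧
      ∀ h < H, (ω (j + 1)).sub h = (ω (i + 1)).sub h := by
  induction j with
  | zero =>
    refine ⟨0, le_rfl, ?_, fun _ _ => rfl⟩
    obtain ⟨sub', hs, σ, h1⟩ := hω.step hj
    rw [ep, h1, nextState]
    simp [nextPolicy, hω.past_zero]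
  | succ j ih =>
    obtain ⟨sub', hs, σ, h1⟩ := hω.step hj
    have hp : (ep M cfg ω (j + 1)).policy = nextPolicy M cfg (ω (j + 1)) sub' := by
      rw [ep, h1]; rfl
    have hsub : (ω (j + 1 + 1)).sub = sub' := by rw [h1]; rfl
    by_cases hc : ∃ h < H, sub' h ≠ (ω (j + 1)).ref h
    · refine ⟨j + 1, le_rfl, ?_, fun _ _ => rfl⟩
      rw [hp, hsub, nextPolicy, hω.past_succ (by omega)]
      simp only [if_pos hc]
    · obtain ⟨i, hij, h2, h3⟩ := ih (by omega)
      refine ⟨i, by omega, ?_, fun h hh => ?_⟩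
      · rw [hp, nextPolicy, hω.past_succ (by omega)]
        simp only [if_neg hc]
        exact h2
      · rw [hsub, ← h3 h hh]
        push Not at hc
        rw [hc h hh, hω.ref_eq (by omega) hh]

/-- The policy is only changed when a sub-sampled dataset changes. -/
theorem IsPath.policy_succ_eq (hω : IsPath M cfg k ω) {j : ℕ} (hj : j + 1 < k)
    (h : ∀ h < H, (ω (j + 2)).sub h = (ω (j + 1)).sub h) :
    (ep M cfg ω (j + 1)).policy = (ep M cfg ω j).policy := by
  obtain ⟨sub', hs, σ, h1⟩ := hω.step hj
  have hp : (ep M cfg ω (j + 1)).policy = nextPolicy M cfg (ω (j + 1)) sub' := by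
    rw [ep, h1]; rfl
  have hsub : (ω (j + 1 + 1)).sub = sub' := by rw [h1]; rfl
  rw [hp, nextPolicy, hω.past_succ (by omega)]
  have hc : ¬ ∃ h < H, sub' h ≠ (ω (j + 1)).ref h := by
    push Not
    intro h' hh'
    rw [hω.ref_eq (by omega) hh', ← hsub]
    exact h h' hh'
  simp only [if_neg hc]

theorem IsPath.regret_eq (hω : IsPath M cfg k ω) {j : ℕ} (hj : j ≤ k) :
    regret M (ω j).past = ∑ i ∈ Finset.range j,
      (optV M 0 M.s₁ - valueV M (ep M cfg ω i).policy 0 M.s₁) := by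
  induction j with
  | zero => rw [hω.past_zero]; rfl
  | succ j ih =>
    rw [hω.past_succ (by omega), Finset.sum_range_succ, ← ih (by omega), regret, List.map_cons,
      List.sum_cons, add_comm]
    rfl

open Classical in
theorem IsPath.switches_le (hω : IsPath M cfg k ω) {j : ℕ} (hj : j ≤ k) :
    switches H (ω j).past ≤ ∑ h ∈ Finset.range H,
      ((Finset.range j).filter fun i => (ω (i + 1)).sub h ≠ (ω i).sub h).card := by
  induction j with
  | zero => rw [hω.past_zero]; simp [switches]
  | succ j ih =>
    have h1 : ∑ h ∈ Finset.range H,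
        ((Finset.range (j + 1)).filter fun i => (ω (i + 1)).sub h ≠ (ω i).sub h).card
        = ∑ h ∈ Finset.range H,
          ((Finset.range j).filter fun i => (ω (i + 1)).sub h ≠ (ω i).sub h).card
          + ∑ h ∈ Finset.range H, if (ω (j + 1)).sub h ≠ (ω j).sub h then 1 else 0 := by
      rw [← Finset.sum_add_distrib]
      refine Finset.sum_congr rfl fun h _ => ?_
      simp only [Finset.card_filter, Finset.sum_range_succ]
    rw [h1]
    cases j with
    | zero => rw [hω.past_succ (by omega), hω.past_zero]; simp [switches]
    | succ j =>
      have h2 := ih (by omega)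
      rw [hω.past_succ (show j < k by omega)] at h2
      rw [hω.past_succ (show j + 1 < k by omega), hω.past_succ (show j < k by omega), switches,
        add_comm]
      refine add_le_add h2 ?_
      split_ifs with hc
      · by_contra hcon
        have h0 : ∑ h ∈ Finset.range H,
            (if (ω (j + 1 + 1)).sub h ≠ (ω (j + 1)).sub h then 1 else 0) = 0 := by omega
        rw [Finset.sum_eq_zero_iff] at h0
        have h3 := hω.policy_succ_eq (j := j) (by omega) fun h hh => by
          have := h0 h (Finset.mem_range.2 hh)
          by_contra hne
          rw [if_pos hne] at this
          exact one_ne_zero this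
        obtain ⟨h, hh, hne⟩ := hc
        rw [h3] at hne
        exact hne rfl
      · exact Nat.zero_le _

end SampledRun

/-! ### One-step drift of powers of the norm ratio -/

section RatioDrift

theorem one_add_pow_le_one_add_two_mul {w : ℝ} {m : ℕ} (hw : 0 ≤ w) (hmw : m * w ≤ 1) :
    (1 + w) ^ m ≤ 1 + 2 * (m * w) := by
  have h0 : 0 ≤ m * w := by positivity
  have h1 : (1 + w) ^ m ≤ Real.exp (m * w) := by
    rw [Real.exp_nat_mul, add_comm]
    exact pow_le_pow_left₀ (by linarith) (Real.add_one_le_exp w) m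
  have h2 := (abs_le.1 (Real.abs_exp_sub_one_sub_id_le (x := m * w)
    (by rwa [abs_of_nonneg h0]))).2
  nlinarith

theorem max_pow_le_add {t c : ℝ} (ht : 0 ≤ t) (hc : 0 ≤ c) (m : ℕ) :
    max t c ^ m ≤ t ^ m + c ^ m := by
  rcases le_total t c with h | h
  · rw [max_eq_right h]; linarith [pow_nonneg ht m]
  · rw [max_eq_left h]; linarith [pow_nonneg hc m]

/-- Here `x` is the sampled norm and `y` the full one. The sampled increment has mean `a`, and by
`hna` it is small enough to linearize the power. Where $x\ge2y$, the relative growth of `x`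
contributes at most $2ma/x\le ma/y$, which the growth of `y` compensates. Where $x<2y$, all new
ratios are at most $3$, whence the additive term. -/
theorem upper_ratio_drift {x y a : ℝ} {n m : ℕ} (hx : 0 < x) (hy : 0 < y) (ha : 0 ≤ a)
    (hn : n = 0 → a = 0) (hm : 2 ≤ m) (hna : n * a * m ≤ x) :
    (n : ℝ)⁻¹ * max ((x + n * a) / (y + a)) 2 ^ m + (1 - (n : ℝ)⁻¹) * max (x / (y + a)) 2 ^ m
      ≤ max (x / y) 2 ^ m + 3 ^ m := by
  -- If no copy can be added, the full increment is zero as well and nothing moves.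
  rcases Nat.eq_zero_or_pos n with rfl | hnpos
  · rw [hn rfl]
    simp only [Nat.cast_zero, inv_zero, zero_mul, sub_zero, one_mul, add_zero, zero_add]
    linarith [pow_nonneg (by norm_num : (0 : ℝ) ≤ 3) m]
  have hn1 : (1 : ℝ) ≤ n := by exact_mod_cast hnpos
  set p : ℝ := (n : ℝ)⁻¹ with hp
  have hp0 : 0 ≤ p := by positivity
  have hp1 : p ≤ 1 := inv_le_one_of_one_le₀ hn1
  have hpn : p * n = 1 := inv_mul_cancel₀ (by positivity)
  have hm2 : (2 : ℝ) ≤ m := by exact_mod_cast hm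
  have hw0 : 0 ≤ n * a / x := by positivity
  have hmw : m * (n * a / x) ≤ 1 := by
    rw [← mul_div_assoc, div_le_one hx]; linarith
  have hw2 : n * a / x ≤ 1 / 2 := by nlinarith
  rcases le_or_gt (2 * y) x with hc | hc
  · have hb : (x + n * a) / (y + a) = x / (y + a) * (1 + n * a / x) := by field_simp
    have h1 := max_pow_le_add (t := (x + n * a) / (y + a)) (c := 2) (by positivity)
      (by norm_num) m
    have h2 := max_pow_le_add (t := x / (y + a)) (c := 2) (by positivity) (by norm_num) m
    have h3 := one_add_pow_le_one_add_two_mul hw0 hmw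
    have h4 : 1 + m * (a / y) ≤ (1 + a / y) ^ m :=
      one_add_mul_le_pow (by have : 0 ≤ a / y := by positivity
                             linarith) m
    have h5 : 2 * (a / x) ≤ a / y := by
      rw [← mul_div_assoc, div_le_div_iff₀ hx hy]; nlinarith
    have h6 : x / y = x / (y + a) * (1 + a / y) := by field_simp
    have hq : 0 ≤ (x / (y + a)) ^ m := by positivity
    calc p * max ((x + n * a) / (y + a)) 2 ^ m + (1 - p) * max (x / (y + a)) 2 ^ m
        ≤ p * (((x + n * a) / (y + a)) ^ m + 2 ^ m) + (1 - p) * ((x / (y + a)) ^ m + 2 ^ m) := by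
          gcongr
      _ = (x / (y + a)) ^ m * (p * (1 + n * a / x) ^ m + (1 - p)) + 2 ^ m := by
          rw [hb, mul_pow]; ring
      _ ≤ (x / (y + a)) ^ m * (1 + a / y) ^ m + 3 ^ m := by
          have e1 : p * (1 + n * a / x) ^ m + (1 - p) ≤ (1 + a / y) ^ m := by
            calc _ ≤ p * (1 + 2 * (m * (n * a / x))) + (1 - p) := by gcongr
              _ = 1 + (p * n) * (2 * (a / x)) * m := by ring
              _ = 1 + m * (2 * (a / x)) := by rw [hpn]; ring
              _ ≤ 1 + m * (a / y) := by gcongr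
              _ ≤ _ := h4
          have e2 : (2 : ℝ) ^ m ≤ 3 ^ m := pow_le_pow_left₀ (by norm_num) (by norm_num) m
          linarith [mul_le_mul_of_nonneg_left e1 hq]
      _ = (x / y) ^ m + 3 ^ m := by rw [h6, mul_pow]
      _ ≤ _ := by
          gcongr
          exact le_max_left _ _
  · have h1 : max ((x + n * a) / (y + a)) 2 ≤ 3 := by
      refine max_le ?_ (by norm_num)
      rw [div_le_iff₀ (by positivity)]
      have : n * a ≤ x / 2 := by
        have := (div_le_iff₀ hx).1 hw2; linarith
      nlinarith
    have h2 : max (x / (y + a)) 2 ≤ 3 := by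
      refine max_le ?_ (by norm_num)
      rw [div_le_iff₀ (by positivity)]
      nlinarith
    have h3 : max ((x + n * a) / (y + a)) 2 ^ m ≤ 3 ^ m :=
      pow_le_pow_left₀ (by positivity) h1 m
    have h4 : max (x / (y + a)) 2 ^ m ≤ 3 ^ m := pow_le_pow_left₀ (by positivity) h2 m
    have h5 : (0 : ℝ) ≤ max (x / y) 2 ^ m := by positivity
    nlinarith [mul_le_mul_of_nonneg_left h3 hp0, mul_le_mul_of_nonneg_left h4 (sub_nonneg.2 hp1)]

/-- The mirror image for $y/x$. Now `y` grows surely, by a relative amount that `hay` keeps below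
$1/m$, and `x` must catch up on average. Linearizing the inverse power loses a factor two, so the
truncation level is $4$ instead of $2$. -/
theorem lower_ratio_drift {x y a : ℝ} {n m : ℕ} (hx : 0 < x) (hy : 0 < y) (ha : 0 ≤ a)
    (hn : n = 0 → a = 0) (hm : 2 ≤ m) (hna : n * a * m ≤ x) (hay : m * a ≤ y) :
    (n : ℝ)⁻¹ * max ((y + a) / (x + n * a)) 4 ^ m + (1 - (n : ℝ)⁻¹) * max ((y + a) / x) 4 ^ m
      ≤ max (y / x) 4 ^ m + 6 ^ m := by
  rcases Nat.eq_zero_or_pos n with rfl | hnpos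
  · rw [hn rfl]
    simp only [Nat.cast_zero, inv_zero, zero_mul, sub_zero, one_mul, add_zero, zero_add]
    linarith [pow_nonneg (by norm_num : (0 : ℝ) ≤ 6) m]
  have hn1 : (1 : ℝ) ≤ n := by exact_mod_cast hnpos
  set p : ℝ := (n : ℝ)⁻¹ with hp
  have hp0 : 0 ≤ p := by positivity
  have hp1 : p ≤ 1 := inv_le_one_of_one_le₀ hn1
  have hpn : p * n = 1 := inv_mul_cancel₀ (by positivity)
  have hm2 : (2 : ℝ) ≤ m := by exact_mod_cast hm
  have hw0 : 0 ≤ n * a / x := by positivity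
  have hmw : m * (n * a / x) ≤ 1 := by
    rw [← mul_div_assoc, div_le_one hx]; linarith
  rcases le_or_gt (4 * x) y with hc | hc
  · have hb : (y + a) / (x + n * a) = (y + a) / x * (1 + n * a / x)⁻¹ := by field_simp
    have h1 := max_pow_le_add (t := (y + a) / (x + n * a)) (c := 4) (by positivity)
      (by norm_num) m
    have h2 := max_pow_le_add (t := (y + a) / x) (c := 4) (by positivity) (by norm_num) m
    have h3 : ((1 + n * a / x)⁻¹) ^ m ≤ 1 - m * (n * a / x) / 2 := by
      have h4 : 1 + m * (n * a / x) ≤ (1 + n * a / x) ^ m :=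
        one_add_mul_le_pow (by linarith) m
      set v := m * (n * a / x) with hv
      have hv0 : 0 ≤ v := by positivity
      rw [inv_pow]
      refine (inv_anti₀ (by linarith) h4).trans ?_
      rw [inv_le_iff_one_le_mul₀ (by linarith)]
      nlinarith
    have h4 : (1 + a / y) ^ m ≤ 1 + 2 * (m * (a / y)) :=
      one_add_pow_le_one_add_two_mul (by positivity) (by
        rw [← mul_div_assoc, div_le_one hy]; exact hay)
    have h5 : 4 * (a / y) ≤ a / x := by
      rw [← mul_div_assoc, div_le_div_iff₀ hy hx]; nlinarith
    have h6 : (y + a) / x = y / x * (1 + a / y) := by field_simp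
    have hq : 0 ≤ (y / x) ^ m := by positivity
    have hv0 : 0 ≤ m * (a / x) := by positivity
    calc p * max ((y + a) / (x + n * a)) 4 ^ m + (1 - p) * max ((y + a) / x) 4 ^ m
        ≤ p * (((y + a) / (x + n * a)) ^ m + 4 ^ m) + (1 - p) * (((y + a) / x) ^ m + 4 ^ m) := by
          gcongr
      _ = (y / x) ^ m * ((1 + a / y) ^ m * (p * ((1 + n * a / x)⁻¹) ^ m + (1 - p))) + 4 ^ m := by
          rw [hb, mul_pow, h6, mul_pow]; ring
      _ ≤ (y / x) ^ m * 1 + 6 ^ m := by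
          have e1 : p * ((1 + n * a / x)⁻¹) ^ m + (1 - p) ≤ 1 - m * (a / x) / 2 := by
            calc _ ≤ p * (1 - m * (n * a / x) / 2) + (1 - p) := by gcongr
              _ = 1 - (p * n) * (m * (a / x)) / 2 := by ring
              _ = _ := by rw [hpn]; ring
          have e0 : 0 ≤ p * ((1 + n * a / x)⁻¹) ^ m + (1 - p) := by
            have : 0 ≤ p * ((1 + n * a / x)⁻¹) ^ m := by positivity
            linarith
          have e3 : (1 + a / y) ^ m ≤ 1 + m * (a / x) / 2 := by nlinarith
          -- With $u=ma/(2x)$ this is $(1+u)(1-u)\le1$.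
          have e4 : (1 + a / y) ^ m * (p * ((1 + n * a / x)⁻¹) ^ m + (1 - p)) ≤ 1 := by
            calc _ ≤ (1 + m * (a / x) / 2) * (1 - m * (a / x) / 2) := by
                  gcongr
              _ ≤ 1 := by nlinarith
          have e2 : (4 : ℝ) ^ m ≤ 6 ^ m := pow_le_pow_left₀ (by norm_num) (by norm_num) m
          linarith [mul_le_mul_of_nonneg_left e4 hq]
      _ = (y / x) ^ m + 6 ^ m := by ring
      _ ≤ _ := by
          gcongr
          exact le_max_left _ _
  · have ha2 : a ≤ y / 2 := by nlinarith
    have h2 : max ((y + a) / x) 4 ≤ 6 := by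
      refine max_le ?_ (by norm_num)
      rw [div_le_iff₀ (by positivity)]
      nlinarith
    have h1 : max ((y + a) / (x + n * a)) 4 ≤ 6 := by
      refine max_le ?_ (by norm_num)
      rw [div_le_iff₀ (by positivity)]
      have : 0 ≤ n * a := by positivity
      nlinarith
    have h3 : max ((y + a) / (x + n * a)) 4 ^ m ≤ 6 ^ m :=
      pow_le_pow_left₀ (by positivity) h1 m
    have h4 : max ((y + a) / x) 4 ^ m ≤ 6 ^ m := pow_le_pow_left₀ (by positivity) h2 m
    have h5 : (0 : ℝ) ≤ max (y / x) 4 ^ m := by positivity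
    nlinarith [mul_le_mul_of_nonneg_left h3 hp0, mul_le_mul_of_nonneg_left h4 (sub_nonneg.2 hp1)]

end RatioDrift

/-! ### The sub-sampled datasets represent the full data -/

section Sampling

variable {S : Type u} {A : Type v} {H : ℕ}

/-- The logarithmic factor of the sampling probabilities. -/
noncomputable def Config.logFactor (cfg : Config S A) : ℝ :=
  Real.log (cfg.T * cfg.NF (Real.sqrt (cfg.δ / (64 * cfg.T ^ 3))) / cfg.δ)

/-- The accuracy of the rounding. -/
noncomputable def Config.roundAcc (cfg : Config S A) : ℝ :=
  1 / (16 * Real.sqrt (64 * cfg.T ^ 3 / cfg.δ))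

/-- The assumptions on the parameters that the analysis of the algorithm uses. -/
structure Regime (M : EpisodicMDP S A H) (cfg : Config S A) : Prop where
  one_le_H : 1 ≤ H
  le_T : 16384 ≤ cfg.T
  δ_pos : 0 < cfg.δ
  δ_lt : cfg.δ < 1
  F_mem : ∀ f ∈ cfg.F, ∀ z, f z ∈ Set.Icc (0 : ℝ) (H + 1)
  bellman : BellmanClosed M cfg.F
  c_eq : cfg.c = 448
  one_le_logFactor : 1 ≤ cfg.logFactor
  le_β : 448 * cfg.logFactor * (H + 1) ^ 2 ≤ cfg.β
  rnd_close : ∀ f ∈ cfg.F, ∀ x, |f x - f (cfg.rnd x)| ≤ cfg.roundAcc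
  lsq : IsLeastSquares cfg.F cfg.lsq
  greedy : IsGreedy cfg.F H cfg.T cfg.β cfg.greedy

namespace Regime

variable {M : EpisodicMDP S A H} {cfg : Config S A}

theorem T_pos (R : Regime M cfg) : 0 < cfg.T := by linarith [R.le_T]

theorem H_pos (R : Regime M cfg) : (1 : ℝ) ≤ H := by exact_mod_cast R.one_le_H

theorem sq_le_β (R : Regime M cfg) : 448 * ((H : ℝ) + 1) ^ 2 ≤ cfg.β := by
  refine le_trans ?_ R.le_β
  have := R.one_le_logFactor
  gcongr
  linarith

theorem β_ge (R : Regime M cfg) : 1792 ≤ cfg.β := by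
  have := R.sq_le_β
  nlinarith [R.H_pos]

theorem F_nonempty (R : Regime M cfg) : cfg.F.Nonempty := by
  obtain ⟨f, hf, -⟩ := R.bellman 0 R.one_le_H (fun _ => 0) fun s => ⟨le_rfl, by positivity⟩
  exact ⟨f, hf⟩

theorem roundAcc_sq (R : Regime M cfg) : cfg.roundAcc ^ 2 = cfg.δ / (16384 * cfg.T ^ 3) := by
  have h1 := R.T_pos
  have h2 := R.δ_pos
  rw [Config.roundAcc, div_pow, mul_pow, Real.sq_sqrt (by positivity)]
  field_simp
  norm_num

theorem roundAcc_sq_mul_le (R : Regime M cfg) {x : ℝ} (hx : x ≤ cfg.T ^ 3 / cfg.δ) :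
    cfg.roundAcc ^ 2 * x ≤ 1 / 16384 := by
  have h1 := R.T_pos
  have h2 := R.δ_pos
  rw [R.roundAcc_sq]
  calc _ ≤ cfg.δ / (16384 * cfg.T ^ 3) * (cfg.T ^ 3 / cfg.δ) := by gcongr
    _ = _ := by field_simp

theorem T_le_cube_div (R : Regime M cfg) : cfg.T ≤ cfg.T ^ 3 / cfg.δ := by
  have h1 := R.T_pos
  have h2 := R.δ_pos
  have h3 := R.le_T
  rw [le_div_iff₀ h2]
  calc cfg.T * cfg.δ ≤ cfg.T * 1 := by gcongr; exact R.δ_lt.le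
    _ ≤ cfg.T * cfg.T ^ 2 := by gcongr; nlinarith
    _ = _ := by ring

/-- As the denominator is at least $\beta\ge448L(H+1)^2$, where $L$ is the logarithmic factor, every
quotient is at most $1/(448L)$. So neither the cap of the sensitivity nor the cap of the sampling
probability is active. -/
theorem sensitivity_spec (R : Regime M cfg) (Z : Multiset (S × A)) (z : S × A) :
    0 ≤ sensitivity cfg.F H cfg.T cfg.β Z z ∧
    448 * cfg.logFactor * sensitivity cfg.F H cfg.T cfg.β Z z ≤ 1 ∧
    (∀ f ∈ cfg.F, ∀ g ∈ cfg.F, (f z - g z) ^ 2 ≤ sensitivity cfg.F H cfg.T cfg.β Z z *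
      (min (sqNorm Z (f - g)) (cfg.T * (H + 1) ^ 2) + cfg.β)) ∧
    (∀ c, (∀ f ∈ cfg.F, ∀ g ∈ cfg.F, (f z - g z) ^ 2 /
      (min (sqNorm Z (f - g)) (cfg.T * (H + 1) ^ 2) + cfg.β) ≤ c) →
        sensitivity cfg.F H cfg.T cfg.β Z z ≤ c) := by
  have hβ := R.β_ge
  have hT := R.T_pos
  have hden : ∀ f g : S × A → ℝ,
      cfg.β ≤ min (sqNorm Z (f - g)) (cfg.T * (H + 1) ^ 2) + cfg.β := fun f g => by
    have := le_min (sqNorm_nonneg Z (f - g)) (show 0 ≤ cfg.T * ((H : ℝ) + 1) ^ 2 by positivity)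
    linarith
  have hle : ∀ f ∈ cfg.F, ∀ g ∈ cfg.F, (f z - g z) ^ 2 /
      (min (sqNorm Z (f - g)) (cfg.T * (H + 1) ^ 2) + cfg.β) ≤ ((H : ℝ) + 1) ^ 2 / cfg.β := by
    intro f hf g hg
    have := sq_sub_le R.F_mem hf hg z
    have := hden f g
    gcongr
  have hβpos : 0 < cfg.β := by linarith
  have hL := R.one_le_logFactor
  have h448 : 448 * cfg.logFactor * (((H : ℝ) + 1) ^ 2 / cfg.β) ≤ 1 := by
    rw [← mul_div_assoc, div_le_one hβpos]; exact R.le_β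
  have hone : ((H : ℝ) + 1) ^ 2 / cfg.β ≤ 1 := by
    have : 0 ≤ ((H : ℝ) + 1) ^ 2 / cfg.β := by positivity
    nlinarith
  set X := {x : ℝ | ∃ f ∈ cfg.F, ∃ g ∈ cfg.F,
    x = (f z - g z) ^ 2 / (min (sqNorm Z (f - g)) (cfg.T * (H + 1) ^ 2) + cfg.β)} with hX
  have hbdd : ∀ x ∈ X, x ≤ ((H : ℝ) + 1) ^ 2 / cfg.β := by
    rintro _ ⟨f, hf, g, hg, rfl⟩; exact hle f hf g hg
  obtain ⟨f₀, hf₀⟩ := R.F_nonempty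
  have hXne : X.Nonempty := ⟨_, f₀, hf₀, f₀, hf₀, rfl⟩
  have hs : sensitivity cfg.F H cfg.T cfg.β Z z = sSup X :=
    min_eq_left ((csSup_le hXne hbdd).trans hone)
  rw [hs]
  refine ⟨?_, ?_, ?_, ?_⟩
  · refine le_trans ?_ (le_csSup ⟨_, hbdd⟩ ⟨f₀, hf₀, f₀, hf₀, rfl⟩)
    simp
  · exact (mul_le_mul_of_nonneg_left (csSup_le hXne hbdd) (by positivity)).trans h448
  · intro f hf g hg
    rw [← div_le_iff₀ (hβpos.trans_le (hden f g))]
    exact le_csSup ⟨_, hbdd⟩ ⟨f, hf, g, hg, rfl⟩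
  · intro c hc
    refine csSup_le hXne ?_
    rintro _ ⟨f, hf, g, hg, rfl⟩
    exact hc f hf g hg

/-- The number of copies is $\lfloor1/x\rfloor$ with $0\le x\le1$. For $x>0$ the floor loses at most
a factor two; for $x=0$ the convention $1/0=0$ yields no copies. -/
theorem copies_spec (R : Regime M cfg) (Z : Multiset (S × A)) (z : S × A) :
    (copies H cfg Z z : ℝ) * (448 * cfg.logFactor * sensitivity cfg.F H cfg.T cfg.β Z z) ≤ 1 ∧
    (copies H cfg Z z : ℝ)⁻¹ ≤
      2 * (448 * cfg.logFactor * sensitivity cfg.F H cfg.T cfg.β Z z) ∧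
    (copies H cfg Z z = 0 → sensitivity cfg.F H cfg.T cfg.β Z z = 0) := by
  obtain ⟨h0, h1, -, -⟩ := R.sensitivity_spec Z z
  have hL := R.one_le_logFactor
  set s := sensitivity cfg.F H cfg.T cfg.β Z z with hs
  have hcop : copies H cfg Z z = ⌊1 / (448 * cfg.logFactor * s)⌋₊ := by
    unfold copies
    rw [R.c_eq, ← hs]
    change ⌊1 / min 1 (448 * s * cfg.logFactor)⌋₊ = _
    rw [show 448 * s * cfg.logFactor = 448 * cfg.logFactor * s by ring, min_eq_right h1]
  rw [hcop]
  rcases h0.eq_or_lt with h | h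
  · rw [← h]; simp
  · set x := 448 * cfg.logFactor * s with hx
    have hx0 : 0 < x := by positivity
    have hy1 : 1 ≤ 1 / x := by rw [le_div_iff₀ hx0]; linarith
    have hfl : 1 ≤ ⌊1 / x⌋₊ := Nat.le_floor (by simpa using hy1)
    have hflr : (1 : ℝ) ≤ ⌊1 / x⌋₊ := by exact_mod_cast hfl
    refine ⟨?_, ?_, fun h => by omega⟩
    · have := Nat.floor_le (show 0 ≤ 1 / x by positivity)
      rwa [le_div_iff₀ hx0] at this
    · have := Nat.lt_floor_add_one (1 / x)
      rw [inv_le_iff_one_le_mul₀ (by linarith)]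
      rw [div_lt_iff₀ hx0] at this
      nlinarith

/-- The squared difference of two functions, reduced by the rounding error. -/
noncomputable def _root_.LSVI.reducedSq (cfg : Config S A) (f g : S × A → ℝ) (x : S × A) : ℝ :=
  max ((f x - g x) ^ 2 - 8 * cfg.roundAcc ^ 2) 0

/-- The sum of the reduced squared differences over a dataset. -/
noncomputable def _root_.LSVI.reducedSum (cfg : Config S A) (f g : S × A → ℝ)
    (Z : Multiset (S × A)) : ℝ := (Z.map (reducedSq cfg f g)).sum

theorem _root_.LSVI.reducedSq_nonneg (cfg : Config S A) (f g : S × A → ℝ) (x : S × A) :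
    0 ≤ reducedSq cfg f g x := le_max_right _ _

theorem _root_.LSVI.reducedSum_nonneg (cfg : Config S A) (f g : S × A → ℝ)
    (Z : Multiset (S × A)) : 0 ≤ reducedSum cfg f g Z := by
  refine Multiset.sum_nonneg fun x hx => ?_
  obtain ⟨y, -, rfl⟩ := Multiset.mem_map.1 hx
  exact reducedSq_nonneg _ _ _ _

theorem _root_.LSVI.reducedSum_replicate_add (cfg : Config S A) (f g : S × A → ℝ) (n : ℕ)
    (x : S × A) (Z : Multiset (S × A)) : reducedSum cfg f g (Multiset.replicate n x + Z)
      = reducedSum cfg f g Z + n * reducedSq cfg f g x := by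
  simp [reducedSum, add_comm]

theorem _root_.LSVI.multiset_sum_map_le {X : Type*} (Z : Multiset X) {f g : X → ℝ}
    (h : ∀ x, f x ≤ g x) : (Z.map f).sum ≤ (Z.map g).sum :=
  Multiset.sum_map_le_sum_map _ _ fun x _ => h x

theorem _root_.LSVI.multiset_sum_map_le_affine {X : Type*} (Z : Multiset X) {f g : X → ℝ}
    {a b : ℝ} (h : ∀ x, f x ≤ a * g x + b) :
    (Z.map f).sum ≤ a * (Z.map g).sum + b * Multiset.card Z := by
  refine (multiset_sum_map_le Z h).trans_eq ?_
  rw [Multiset.sum_map_add, Multiset.sum_map_mul_left]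
  simp [mul_comm]

theorem _root_.LSVI.reducedSum_le_sqNorm (cfg : Config S A) (f g : S × A → ℝ)
    (Z : Multiset (S × A)) : reducedSum cfg f g Z ≤ sqNorm Z (f - g) := by
  refine multiset_sum_map_le Z fun x => ?_
  refine max_le ?_ (sq_nonneg _)
  have := sq_nonneg cfg.roundAcc
  simp only [Pi.sub_apply]
  linarith

/-- The reduction is at most $8\epsilon_0^2$ per element, and the cardinality bound keeps its total
below one. -/
theorem sqNorm_le_reducedSum (R : Regime M cfg) (f g : S × A → ℝ) {Z : Multiset (S × A)}
    (hZ : (Multiset.card Z : ℝ) ≤ cfg.T ^ 3 / cfg.δ) :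
    sqNorm Z (f - g) ≤ reducedSum cfg f g Z + 1 := by
  have h1 := multiset_sum_map_le_affine Z (f := fun x => (f - g) x ^ 2)
    (g := reducedSq cfg f g) (a := 1) (b := 8 * cfg.roundAcc ^ 2) fun x => by
      have := le_max_left ((f x - g x) ^ 2 - 8 * cfg.roundAcc ^ 2) 0
      simp only [Pi.sub_apply, reducedSq]
      linarith
  have h2 := R.roundAcc_sq_mul_le hZ
  simp only [sqNorm, reducedSum]
  linarith

theorem abs_sub_rnd (R : Regime M cfg) {f g : S × A → ℝ} (hf : f ∈ cfg.F) (hg : g ∈ cfg.F)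
    (z : S × A) : |(f z - g z) - (f (cfg.rnd z) - g (cfg.rnd z))| ≤ 2 * cfg.roundAcc := by
  have h1 := abs_le.1 (R.rnd_close f hf z)
  have h2 := abs_le.1 (R.rnd_close g hg z)
  rw [abs_le]; constructor <;> linarith [h1.1, h1.2, h2.1, h2.2]

theorem _root_.LSVI.sq_le_two_mul_sq_add {x y e : ℝ} (h : |x - y| ≤ 2 * e) :
    x ^ 2 ≤ 2 * y ^ 2 + 8 * e ^ 2 := by
  have h1 : (x - y) ^ 2 ≤ (2 * e) ^ 2 := sq_le_sq' (by linarith [(abs_le.1 h).1]) (abs_le.1 h).2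
  nlinarith [sq_nonneg (2 * y - x)]

/-- The purpose of the reduction: subtracting $8\epsilon_0^2$ removes the additive rounding error,
so a point of sensitivity zero has increment exactly zero. -/
theorem reducedSq_rnd_le (R : Regime M cfg) {f g : S × A → ℝ} (hf : f ∈ cfg.F) (hg : g ∈ cfg.F)
    (z : S × A) : reducedSq cfg f g (cfg.rnd z) ≤ 2 * (f z - g z) ^ 2 := by
  refine max_le ?_ (by positivity)
  have := sq_le_two_mul_sq_add (by rw [abs_sub_comm]; exact R.abs_sub_rnd hf hg z)
  linarith

theorem sq_le_reducedSq_rnd (R : Regime M cfg) {f g : S × A → ℝ} (hf : f ∈ cfg.F)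
    (hg : g ∈ cfg.F) (z : S × A) :
    (f z - g z) ^ 2 ≤ 2 * reducedSq cfg f g (cfg.rnd z) + 24 * cfg.roundAcc ^ 2 := by
  have h1 := sq_le_two_mul_sq_add (R.abs_sub_rnd hf hg z)
  have h2 := le_max_left ((f (cfg.rnd z) - g (cfg.rnd z)) ^ 2 - 8 * cfg.roundAcc ^ 2) 0
  unfold reducedSq
  linarith

/-- The step-size hypothesis of the drift lemmas. The constant is $448=2\cdot7\cdot32$: two from
rounding, seven from the exponent $m=\lfloor7L\rfloor$, and $32$ because $(\beta+1)/32\le\beta/16$.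
-/
theorem copies_mul_reducedSq_le (R : Regime M cfg) {f g : S × A → ℝ} (hf : f ∈ cfg.F)
    (hg : g ∈ cfg.F) {Z : Multiset (S × A)} (hZ : (Multiset.card Z : ℝ) ≤ cfg.T ^ 3 / cfg.δ)
    (z : S × A) :
    (copies H cfg Z z : ℝ) * reducedSq cfg f g (cfg.rnd z) * (⌊7 * cfg.logFactor⌋₊ : ℝ)
        ≤ reducedSum cfg f g Z + cfg.β / 16 ∧
      (copies H cfg Z z = 0 → reducedSq cfg f g (cfg.rnd z) = 0) := by
  obtain ⟨h0, -, h2, -⟩ := R.sensitivity_spec Z z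
  obtain ⟨h3, -, h4⟩ := R.copies_spec Z z
  have h5 := h2 f hf g hg
  have h6 := R.reducedSq_rnd_le hf hg z
  have h7 := R.sqNorm_le_reducedSum f g hZ
  have hL := R.one_le_logFactor
  have hβ := R.β_ge
  set s := sensitivity cfg.F H cfg.T cfg.β Z z
  set n : ℝ := (copies H cfg Z z : ℝ)
  have hn : 0 ≤ n := Nat.cast_nonneg _
  have hmin := min_le_left (sqNorm Z (f - g)) (cfg.T * ((H : ℝ) + 1) ^ 2)
  have hm0 := reducedSum_nonneg cfg f g Z
  constructor
  · have hfl : (⌊7 * cfg.logFactor⌋₊ : ℝ) ≤ 7 * cfg.logFactor := Nat.floor_le (by positivity)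
    have h8 : reducedSq cfg f g (cfg.rnd z) ≤ 2 * (s * (reducedSum cfg f g Z + 1 + cfg.β)) := by
      refine h6.trans ?_
      have : s * (min (sqNorm Z (f - g)) (cfg.T * ((H : ℝ) + 1) ^ 2) + cfg.β)
          ≤ s * (reducedSum cfg f g Z + 1 + cfg.β) := by gcongr; linarith
      linarith
    calc n * reducedSq cfg f g (cfg.rnd z) * (⌊7 * cfg.logFactor⌋₊ : ℝ)
        ≤ n * (2 * (s * (reducedSum cfg f g Z + 1 + cfg.β))) * (7 * cfg.logFactor) := by
          have := reducedSq_nonneg cfg f g (cfg.rnd z)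
          gcongr
      _ = n * (448 * cfg.logFactor * s) * ((reducedSum cfg f g Z + 1 + cfg.β) / 32) := by ring
      _ ≤ 1 * ((reducedSum cfg f g Z + 1 + cfg.β) / 32) := by gcongr
      _ ≤ _ := by linarith
  · intro h
    have := h4 h
    rw [this, zero_mul] at h5
    exact le_antisymm (by linarith) (reducedSq_nonneg _ _ _ _)

theorem reducedSq_mul_le (R : Regime M cfg) {f g : S × A → ℝ} (hf : f ∈ cfg.F)
    (hg : g ∈ cfg.F) (x : S × A) :
    (⌊7 * cfg.logFactor⌋₊ : ℝ) * reducedSq cfg f g x ≤ cfg.β / 16 := by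
  have hL := R.one_le_logFactor
  have h1 : reducedSq cfg f g x ≤ ((H : ℝ) + 1) ^ 2 := by
    refine max_le ?_ (by positivity)
    have := sq_sub_le R.F_mem hf hg x
    have := sq_nonneg cfg.roundAcc
    linarith
  have hfl : (⌊7 * cfg.logFactor⌋₊ : ℝ) ≤ 7 * cfg.logFactor := Nat.floor_le (by positivity)
  have := R.le_β
  have h2 : (⌊7 * cfg.logFactor⌋₊ : ℝ) * reducedSq cfg f g x
      ≤ 7 * cfg.logFactor * ((H : ℝ) + 1) ^ 2 := by
    have := reducedSq_nonneg cfg f g x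
    gcongr
  have h3 : 0 ≤ cfg.logFactor * ((H : ℝ) + 1) ^ 2 := by positivity
  linarith

end Regime

/-- The state-action pairs at step `h` of a list of episodes. -/
def pairs (l : List (Episode S A)) (h : ℕ) : Multiset (S × A) :=
  (l : Multiset (Episode S A)).map fun e => e.pair h

/-- The number of the pairs that the sub-sampled datasets are compared to, rounded. -/
noncomputable def roundedSum (cfg : Config S A) (f g : S × A → ℝ) (h : ℕ)
    (st : LearnerState S A) : ℝ :=
  ((pairs st.past.tail h).map fun z => reducedSq cfg f g (cfg.rnd z)).sum

theorem roundedSum_nonneg (cfg : Config S A) (f g : S × A → ℝ) (h : ℕ) (st : LearnerState S A) :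
    0 ≤ roundedSum cfg f g h st := by
  refine Multiset.sum_nonneg fun x hx => ?_
  obtain ⟨y, -, rfl⟩ := Multiset.mem_map.1 hx
  exact reducedSq_nonneg _ _ _ _

/-- The value `x` if `p` holds, and zero otherwise. -/
noncomputable def guarded (p : Prop) (x : ℝ≥0∞) : ℝ≥0∞ := ⨆ _ : p, x

theorem guarded_pos {p : Prop} (hp : p) (x : ℝ≥0∞) : guarded p x = x := iSup_pos hp

theorem guarded_neg {p : Prop} (hp : ¬ p) (x : ℝ≥0∞) : guarded p x = 0 := iSup_neg hp

theorem guarded_le (p : Prop) (x : ℝ≥0∞) : guarded p x ≤ x := iSup_le fun _ => le_rfl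

/-- A drift bound for a truncated potential of one sub-sampled dataset. -/
theorem Regime.lexp_episodeStep_ratio_le {M : EpisodicMDP S A H} {cfg : Config S A}
    {h : ℕ} (hh : h < H) {f g : S × A → ℝ} {ψ : ℝ → ℝ → ℝ} {c : ℝ}
    (hψ0 : ∀ x y, 0 ≤ ψ x y) (hc : 0 ≤ c) {N : ℝ}
    (hdrift : ∀ (Z : Multiset (S × A)) (z : S × A) (y : ℝ), (Multiset.card Z : ℝ) ≤ N → 0 ≤ y →
      (copies H cfg Z z : ℝ)⁻¹ * ψ (reducedSum cfg f g Z + copies H cfg Z z *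
          reducedSq cfg f g (cfg.rnd z)) (y + reducedSq cfg f g (cfg.rnd z)) +
        (1 - (copies H cfg Z z : ℝ)⁻¹) *
          ψ (reducedSum cfg f g Z) (y + reducedSq cfg f g (cfg.rnd z))
        ≤ ψ (reducedSum cfg f g Z) y + c) (st : LearnerState S A) :
    lexp (episodeStep M cfg st) (fun st => guarded ((Multiset.card (st.sub h) : ℝ) ≤ N)
        (ENNReal.ofReal (ψ (reducedSum cfg f g (st.sub h)) (roundedSum cfg f g h st))))
      ≤ guarded ((Multiset.card (st.sub h) : ℝ) ≤ N)
        (ENNReal.ofReal (ψ (reducedSum cfg f g (st.sub h)) (roundedSum cfg f g h st)))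
        + ENNReal.ofReal c := by
  rw [lexp_episodeStep]
  obtain ⟨past, sub, ref⟩ := st
  cases past with
  | nil =>
    -- Nothing is sampled before the first episode, and the compared list `past.tail` stays empty:
    -- it always omits the newest episode, which is sampled only one step later.
    simp only [subLaw, lexp_pure]
    refine (lexp_le_of_support fun σ _ => ?_).trans le_self_add
    simp only [nextState, roundedSum, List.tail_cons, List.tail_nil]
    exact le_rfl
  | cons e rest =>
    simp only [nextState, roundedSum, List.tail_cons, lexp_const, subLaw]
    set y := ((pairs rest h).map fun z => reducedSq cfg f g (cfg.rnd z)).sum with hy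
    have hy0 : 0 ≤ y := roundedSum_nonneg cfg f g h ⟨e :: rest, sub, ref⟩
    have hy' : ((pairs (e :: rest) h).map fun z => reducedSq cfg f g (cfg.rnd z)).sum
        = y + reducedSq cfg f g (cfg.rnd (e.pair h)) := by
      rw [hy, pairs, pairs, ← Multiset.cons_coe, Multiset.map_cons, Multiset.map_cons,
        Multiset.sum_cons, add_comm]
    rw [hy', lexp_sampleAll cfg e h (fun W => guarded ((Multiset.card W : ℝ) ≤ N)
      (ENNReal.ofReal (ψ (reducedSum cfg f g W) (y + reducedSq cfg f g (cfg.rnd (e.pair h)))))), if_pos hh, lexp_onlineSample]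
    set n := copies H cfg (sub h) (e.pair h) with hn
    set a := reducedSq cfg f g (cfg.rnd (e.pair h)) with ha
    have hinv0 : (0 : ℝ) ≤ (n : ℝ)⁻¹ := by positivity
    have hinv1 : 0 ≤ 1 - (n : ℝ)⁻¹ := sub_nonneg.2 (Nat.cast_inv_le_one _)
    by_cases hcard : (Multiset.card (sub h) : ℝ) ≤ N
    · rw [guarded_pos hcard, guarded_pos hcard, reducedSum_replicate_add, ← ha]
      have h1 := hdrift (sub h) (e.pair h) y hcard hy0
      rw [← hn, ← ha] at h1
      rw [← ENNReal.ofReal_add (hψ0 _ _) hc]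
      refine le_trans ?_ (ENNReal.ofReal_le_ofReal h1)
      rw [ENNReal.ofReal_add (mul_nonneg hinv0 (hψ0 _ _)) (mul_nonneg hinv1 (hψ0 _ _)),
        ENNReal.ofReal_mul hinv0, ENNReal.ofReal_mul hinv1]
      gcongr
      exact guarded_le _ _
    -- Datasets only grow, so once the cardinality guard has failed the potential stays zero.
    · have hcard' : ¬ (Multiset.card (Multiset.replicate n (cfg.rnd (e.pair h)) + sub h) : ℝ)
          ≤ N := by
        intro h1
        refine hcard (le_trans ?_ h1)
        rw [Multiset.card_add]
        push_cast
        have : (0 : ℝ) ≤ Multiset.card (Multiset.replicate n (cfg.rnd (e.pair h))) :=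
          Nat.cast_nonneg _
        linarith
      rw [guarded_neg hcard, guarded_neg hcard']
      simp

/-- The expected potential after `j` episodes is at most $(j+1)3^m$, respectively $(j+1)6^m$.
Markov's inequality at twice the base, $6$ and $12$, leaves $(j+1)/2^m$. The offset $\beta/16$ keeps
the ratios meaningful for small norms. -/
theorem Regime.prob_ratio_ge {M : EpisodicMDP S A H} {cfg : Config S A} (R : Regime M cfg)
    {h : ℕ} (hh : h < H) {f g : S × A → ℝ} (hf : f ∈ cfg.F) (hg : g ∈ cfg.F) {j k : ℕ}
    (hjk : j ≤ k) :
    (hist M cfg k).toOuterMeasure {ω | (Multiset.card ((ω j).sub h) : ℝ) ≤ cfg.T ^ 3 / cfg.δ ∧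
        6 * (roundedSum cfg f g h (ω j) + cfg.β / 16)
          ≤ reducedSum cfg f g ((ω j).sub h) + cfg.β / 16}
      ≤ ENNReal.ofReal ((j + 1) / 2 ^ ⌊7 * cfg.logFactor⌋₊) ∧
    (hist M cfg k).toOuterMeasure {ω | (Multiset.card ((ω j).sub h) : ℝ) ≤ cfg.T ^ 3 / cfg.δ ∧
        12 * (reducedSum cfg f g ((ω j).sub h) + cfg.β / 16)
          ≤ roundedSum cfg f g h (ω j) + cfg.β / 16}
      ≤ ENNReal.ofReal ((j + 1) / 2 ^ ⌊7 * cfg.logFactor⌋₊) := by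
  set m := ⌊7 * cfg.logFactor⌋₊ with hm
  have hL := R.one_le_logFactor
  have hm2 : 2 ≤ m := Nat.le_floor (by push_cast; linarith)
  set β₀ := cfg.β / 16 with hβ₀
  have hβ₀pos : 0 < β₀ := by have := R.β_ge; positivity
  have hT := R.T_pos
  have hδ := R.δ_pos
  constructor
  · have hstep := fun st => Regime.lexp_episodeStep_ratio_le (M := M) (cfg := cfg) hh
      (f := f) (g := g) (ψ := fun x y => max ((x + β₀) / (y + β₀)) 2 ^ m) (c := 3 ^ m)
      (fun x y => by positivity) (by positivity) (N := cfg.T ^ 3 / cfg.δ)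
      (fun Z z y hZ hy => by
        obtain ⟨h1, h2⟩ := R.copies_mul_reducedSq_le hf hg hZ z
        have := upper_ratio_drift (x := reducedSum cfg f g Z + β₀) (y := y + β₀)
          (by linarith [reducedSum_nonneg cfg f g Z]) (by linarith)
          (reducedSq_nonneg cfg f g (cfg.rnd z)) h2 hm2 h1
        simpa only [add_right_comm] using this) st
    have hE := lexp_hist_state_le M cfg (a := ENNReal.ofReal (3 ^ m)) (by
      rw [guarded_pos (by simp [initState]; positivity)]
      refine ENNReal.ofReal_le_ofReal (pow_le_pow_left₀ (by positivity) (max_le ?_ (by norm_num)) m)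
      simp only [initState, reducedSum, roundedSum, pairs, List.tail_nil, Multiset.coe_nil,
        Multiset.map_zero, Multiset.sum_zero, zero_add]
      rw [div_self hβ₀pos.ne']; norm_num) hstep hjk
    refine (toOuterMeasure_le_div (a := 6 ^ m) (b := (j + 1) * 3 ^ m) (by positivity)
      (hE.trans_eq ?_) ?_).trans_eq ?_
    · rw [add_mul, ENNReal.ofReal_add (by positivity) (by positivity), one_mul,
        ENNReal.ofReal_mul (by positivity), ENNReal.ofReal_natCast, add_comm]
    · rintro ω - ⟨h1, h2⟩
      rw [guarded_pos h1]
      refine ENNReal.ofReal_le_ofReal (pow_le_pow_left₀ (by norm_num) (le_max_of_le_left ?_) m)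
      rw [le_div_iff₀ (by linarith [roundedSum_nonneg cfg f g h (ω j)])]
      exact h2
    · congr 1
      rw [show (6 : ℝ) = 2 * 3 by norm_num, mul_pow]
      field_simp
  · have hstep := fun st => Regime.lexp_episodeStep_ratio_le (M := M) (cfg := cfg) hh
      (f := f) (g := g) (ψ := fun x y => max ((y + β₀) / (x + β₀)) 4 ^ m) (c := 6 ^ m)
      (fun x y => by positivity) (by positivity) (N := cfg.T ^ 3 / cfg.δ)
      (fun Z z y hZ hy => by
        obtain ⟨h1, h2⟩ := R.copies_mul_reducedSq_le hf hg hZ z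
        have h3 := R.reducedSq_mul_le hf hg (cfg.rnd z)
        have := lower_ratio_drift (x := reducedSum cfg f g Z + β₀) (y := y + β₀)
          (by linarith [reducedSum_nonneg cfg f g Z]) (by linarith)
          (reducedSq_nonneg cfg f g (cfg.rnd z)) h2 hm2 h1 (by linarith)
        simpa only [add_right_comm] using this) st
    have hE := lexp_hist_state_le M cfg (a := ENNReal.ofReal (6 ^ m)) (by
      rw [guarded_pos (by simp [initState]; positivity)]
      refine ENNReal.ofReal_le_ofReal (pow_le_pow_left₀ (by positivity) (max_le ?_ (by norm_num)) m)
      simp only [initState, reducedSum, roundedSum, pairs, List.tail_nil, Multiset.coe_nil,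
        Multiset.map_zero, Multiset.sum_zero, zero_add]
      rw [div_self hβ₀pos.ne']; norm_num) hstep hjk
    refine (toOuterMeasure_le_div (a := 12 ^ m) (b := (j + 1) * 6 ^ m) (by positivity)
      (hE.trans_eq ?_) ?_).trans_eq ?_
    · rw [add_mul, ENNReal.ofReal_add (by positivity) (by positivity), one_mul,
        ENNReal.ofReal_mul (by positivity), ENNReal.ofReal_natCast, add_comm]
    · rintro ω - ⟨h1, h2⟩
      rw [guarded_pos h1]
      refine ENNReal.ofReal_le_ofReal (pow_le_pow_left₀ (by norm_num) (le_max_of_le_left ?_) m)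
      rw [le_div_iff₀ (by linarith [reducedSum_nonneg cfg f g ((ω j).sub h)])]
      exact h2
    · congr 1
      rw [show (12 : ℝ) = 2 * 6 by norm_num, mul_pow]
      field_simp

/-- The sub-sampled dataset represents the full dataset for all pairs of functions. -/
def SubAccurate (H : ℕ) (cfg : Config S A) (h : ℕ) (st : LearnerState S A) : Prop :=
  ∀ f ∈ cfg.F, ∀ g ∈ cfg.F,
    (sqNorm (pairs st.past.tail h) (f - g) ≤ cfg.β / 480 → sqNorm (st.sub h) (f - g) ≤ cfg.β) ∧
    sqNorm (pairs st.past.tail h) (f - g)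
      ≤ 96 * min (sqNorm (st.sub h) (f - g)) (cfg.T * (H + 1) ^ 2) + 4 * cfg.β

theorem card_pairs (l : List (Episode S A)) (h : ℕ) : Multiset.card (pairs l h) = l.length := by
  simp [pairs]

/-- Passing from `f, g` to cover elements, from squares to reduced squares, and from points to
rounded points costs factors two and small additive constants, absorbed by $\beta$. In the second
half the factors multiply to $2\cdot2\cdot12\cdot2=96$. -/
theorem Regime.subAccurate_of_cover {M : EpisodicMDP S A H} {cfg : Config S A} (R : Regime M cfg)
    {C : Finset (S × A → ℝ)} (hCF : (C : Set (S × A → ℝ)) ⊆ cfg.F)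
    (hC : ∀ f ∈ cfg.F, ∃ g ∈ C, ∀ x, |f x - g x| ≤ Real.sqrt (cfg.δ / (64 * cfg.T ^ 3)))
    {h : ℕ} {st : LearnerState S A} (hlen : (st.past.length : ℝ) ≤ cfg.T)
    (hcard : (Multiset.card (st.sub h) : ℝ) ≤ cfg.T ^ 3 / cfg.δ)
    (hup : ∀ f ∈ C, ∀ g ∈ C, reducedSum cfg f g (st.sub h) + cfg.β / 16
      ≤ 6 * (roundedSum cfg f g h st + cfg.β / 16))
    (hlow : ∀ f ∈ C, ∀ g ∈ C, roundedSum cfg f g h st + cfg.β / 16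
      ≤ 12 * (reducedSum cfg f g (st.sub h) + cfg.β / 16)) :
    SubAccurate H cfg h st := by
  intro f hf g hg
  obtain ⟨f', hf', hff⟩ := hC f hf
  obtain ⟨g', hg', hgg⟩ := hC g hg
  have hT := R.T_pos
  have hδ := R.δ_pos
  have hβ := R.β_ge
  set ε₁ := Real.sqrt (cfg.δ / (64 * cfg.T ^ 3)) with hε₁
  have hε₁sq : ε₁ ^ 2 = cfg.δ / (64 * cfg.T ^ 3) := Real.sq_sqrt (by positivity)
  have hε₁mul : ∀ x ≤ cfg.T ^ 3 / cfg.δ, ε₁ ^ 2 * x ≤ 1 / 64 := by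
    intro x hx
    rw [hε₁sq]
    calc _ ≤ cfg.δ / (64 * cfg.T ^ 3) * (cfg.T ^ 3 / cfg.δ) := by gcongr
      _ = _ := by field_simp
  have hcl : ∀ x, |(f - g) x - (f' - g') x| ≤ 2 * ε₁ := fun x => by
    have h1 := abs_le.1 (hff x)
    have h2 := abs_le.1 (hgg x)
    simp only [Pi.sub_apply]
    rw [abs_le]; constructor <;> linarith [h1.1, h1.2, h2.1, h2.2]
  have h1 : ∀ Z : Multiset (S × A), sqNorm Z (f - g)
      ≤ 2 * sqNorm Z (f' - g') + 8 * ε₁ ^ 2 * Multiset.card Z := fun Z =>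
    multiset_sum_map_le_affine Z fun x => sq_le_two_mul_sq_add (hcl x)
  have h2 : ∀ Z : Multiset (S × A), sqNorm Z (f' - g')
      ≤ 2 * sqNorm Z (f - g) + 8 * ε₁ ^ 2 * Multiset.card Z := fun Z =>
    multiset_sum_map_le_affine Z fun x => sq_le_two_mul_sq_add (by rw [abs_sub_comm]; exact hcl x)
  set Z := pairs st.past.tail h with hZ
  set W := st.sub h with hW
  have hZT : (Multiset.card Z : ℝ) ≤ cfg.T := by
    rw [hZ, card_pairs]
    refine le_trans ?_ hlen
    exact_mod_cast by simp
  have hZc : (Multiset.card Z : ℝ) ≤ cfg.T ^ 3 / cfg.δ := hZT.trans R.T_le_cube_div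
  have hf'F := hCF hf'
  have hg'F := hCF hg'
  have e1 := h1 Z
  have e2 := h2 Z
  have e3 := h1 W
  have e4 := h2 W
  have e5 := hε₁mul _ hZc
  have e6 := hε₁mul _ hcard
  have e7 := R.sqNorm_le_reducedSum f' g' hcard
  have e8 := reducedSum_le_sqNorm cfg f' g' W
  have e9 := R.roundAcc_sq_mul_le hZc
  have e10 : roundedSum cfg f' g' h st ≤ 2 * sqNorm Z (f' - g') + 0 * Multiset.card Z :=
    multiset_sum_map_le_affine Z fun x => by
      simpa using R.reducedSq_rnd_le hf'F hg'F x
  have e11 : sqNorm Z (f' - g') ≤ 2 * roundedSum cfg f' g' h st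
      + 24 * cfg.roundAcc ^ 2 * Multiset.card Z :=
    multiset_sum_map_le_affine Z fun x => R.sq_le_reducedSq_rnd hf'F hg'F x
  have e12 := hup f' hf' g' hg'
  have e13 := hlow f' hf' g' hg'
  refine ⟨fun hsmall => by linarith, ?_⟩
  rcases le_total (sqNorm W (f - g)) (cfg.T * (H + 1) ^ 2) with hm | hm
  · rw [min_eq_left hm]; linarith
  -- If the truncation is active, the full norm is trivially at most $T(H+1)^2$.
  · rw [min_eq_right hm]
    have : sqNorm Z (f - g) ≤ ((H : ℝ) + 1) ^ 2 * Multiset.card Z := by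
      have := multiset_sum_map_le_affine Z (f := fun x => (f - g) x ^ 2) (g := fun _ => (0 : ℝ))
        (a := 0) (b := ((H : ℝ) + 1) ^ 2) fun x => by
          simpa using sq_sub_le R.F_mem hf hg x
      simpa [sqNorm] using this
    have h3 : ((H : ℝ) + 1) ^ 2 * Multiset.card Z ≤ ((H : ℝ) + 1) ^ 2 * cfg.T := by gcongr
    have h4 : 0 ≤ cfg.T * ((H : ℝ) + 1) ^ 2 := by positivity
    linarith

end Sampling

/-! ### Size, number of changes and possible values of the sub-sampled datasets -/

section Changes

variable {S : Type u} {A : Type v} {H : ℕ}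

theorem lexp_episodeStep_sub (M : EpisodicMDP S A H) (cfg : Config S A) {h : ℕ} (hh : h < H)
    (G : Multiset (S × A) → ℝ≥0∞) (e : Episode S A) (rest : List (Episode S A))
    (sub ref : ℕ → Multiset (S × A)) :
    lexp (episodeStep M cfg ⟨e :: rest, sub, ref⟩) (fun st => G (st.sub h)) =
      lexp (onlineSample H cfg (sub h) (e.pair h)) G := by
  rw [lexp_episodeStep]
  simp only [nextState, lexp_const, subLaw]
  rw [lexp_sampleAll cfg e h G, if_pos hh]

theorem lexp_episodeStep_sub_nil (M : EpisodicMDP S A H) (cfg : Config S A) (h : ℕ)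
    (G : Multiset (S × A) → ℝ≥0∞) (sub ref : ℕ → Multiset (S × A)) :
    lexp (episodeStep M cfg ⟨[], sub, ref⟩) (fun st => G (st.sub h)) = G (sub h) := by
  rw [lexp_episodeStep]
  simp only [nextState, lexp_const, subLaw, lexp_pure]

/-- One sampling adds $1/p$ points with probability $p$, hence at most one point on average. -/
theorem lexp_card_sub_le (M : EpisodicMDP S A H) (cfg : Config S A) {h : ℕ} (hh : h < H)
    (k : ℕ) : lexp (hist M cfg k)
      (fun ω => ENNReal.ofReal (Multiset.card ((ω k).sub h) : ℝ)) ≤ ENNReal.ofReal k := by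
  have := lexp_hist_state_le M cfg (Φ := fun st => ENNReal.ofReal (Multiset.card (st.sub h) : ℝ))
    (a := 0) (c := 1) (by simp [initState]) (fun st => by
      obtain ⟨past, sub, ref⟩ := st
      cases past with
      | nil =>
        rw [lexp_episodeStep_sub_nil M cfg h
          (fun W => ENNReal.ofReal (Multiset.card W : ℝ))]
        exact le_self_add
      | cons e rest =>
        rw [lexp_episodeStep_sub M cfg hh (fun W => ENNReal.ofReal (Multiset.card W : ℝ)),
          lexp_onlineSample]
        set n := copies H cfg (sub h) (e.pair h)
        have hinv0 : (0 : ℝ) ≤ (n : ℝ)⁻¹ := by positivity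
        have hinv1 : 0 ≤ 1 - (n : ℝ)⁻¹ := sub_nonneg.2 (Nat.cast_inv_le_one _)
        rw [← ENNReal.ofReal_mul hinv0, ← ENNReal.ofReal_mul hinv1,
          ← ENNReal.ofReal_add (by positivity) (by positivity), ← ENNReal.ofReal_one,
          ← ENNReal.ofReal_add (by positivity) (by positivity)]
        refine ENNReal.ofReal_le_ofReal ?_
        rw [Multiset.card_add, Multiset.card_replicate]
        push_cast
        have : (n : ℝ)⁻¹ * n ≤ 1 := inv_mul_le_one
        linarith) (le_refl k)
  simpa using this

theorem prob_card_sub_gt (M : EpisodicMDP S A H) (cfg : Config S A) {h : ℕ} (hh : h < H)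
    (k : ℕ) {N : ℝ} (hN : 0 < N) :
    (hist M cfg k).toOuterMeasure {ω | ¬ (Multiset.card ((ω k).sub h) : ℝ) ≤ N}
      ≤ ENNReal.ofReal (k / N) :=
  toOuterMeasure_le_div hN (lexp_card_sub_le M cfg hh k) fun _ _ hω =>
    ENNReal.ofReal_le_ofReal (not_le.1 hω).le

open Classical in
/-- The indicator of a change of a dataset. -/
noncomputable def changeInd (Z W : Multiset (S × A)) : ℝ := if W ≠ Z then 1 else 0

/-- The full sensitivity of the point that is sampled next. -/
noncomputable def stepSens (cfg : Config S A) (h : ℕ) (st : LearnerState S A) : ℝ :=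
  match st.past with
  | [] => 0
  | e :: rest => fullSens cfg.F cfg.β (pairs rest h) (e.pair h)

variable {M : EpisodicMDP S A H} {cfg : Config S A}

/-- By accuracy the denominator with the full data is at most $96\min\{\cdot\}+5\beta$, so at most
$96$ times the one with the sample. -/
theorem Regime.sensitivity_le_fullSens (R : Regime M cfg) {h : ℕ} {e : Episode S A}
    {rest : List (Episode S A)} {sub ref : ℕ → Multiset (S × A)}
    (hacc : SubAccurate H cfg h ⟨e :: rest, sub, ref⟩) :
    sensitivity cfg.F H cfg.T cfg.β (sub h) (e.pair h)
      ≤ 96 * fullSens cfg.F cfg.β (pairs rest h) (e.pair h) := by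
  obtain ⟨-, -, -, h4⟩ := R.sensitivity_spec (sub h) (e.pair h)
  have hβ := R.β_ge
  have hT := R.T_pos
  have hsq := R.sq_le_β
  obtain ⟨h5, -, -⟩ := fullSens_bounds R.F_mem R.F_nonempty (β := cfg.β) (by linarith)
    (by nlinarith [sq_nonneg ((H : ℝ) + 1)]) (pairs rest h) (e.pair h)
  refine h4 _ fun f hf g hg => ?_
  have h6 := h5 f hf g hg
  have h7 := (hacc f hf g hg).2
  simp only [List.tail_cons] at h7
  have h8 : 0 ≤ min (sqNorm (sub h) (f - g)) (cfg.T * ((H : ℝ) + 1) ^ 2) :=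
    le_min (sqNorm_nonneg _ _) (by positivity)
  have h9 := sqNorm_nonneg (pairs rest h) (f - g)
  rw [div_le_iff₀ (by linarith)] at h6 ⊢
  refine h6.trans ?_
  have h10 : 0 ≤ fullSens cfg.F cfg.β (pairs rest h) (e.pair h) :=
    (fullSens_bounds R.F_mem R.F_nonempty (β := cfg.β) (by linarith)
      (by nlinarith [sq_nonneg ((H : ℝ) + 1)]) (pairs rest h) (e.pair h)).2.1
  nlinarith

/-- A change has probability $p\le2\cdot448\cdot96\,L\,s$, where $s$ is the full sensitivity, and
$1+(e-1)p\le e^{2p}$; therefore $172032=4\cdot448\cdot96$. -/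
theorem Regime.lexp_change_le (R : Regime M cfg) {h : ℕ} (hh : h < H) {st : LearnerState S A}
    (hacc : SubAccurate H cfg h st) :
    lexp (episodeStep M cfg st) (fun st' => ENNReal.ofReal (Real.exp
      (changeInd (st.sub h) (st'.sub h) - 172032 * cfg.logFactor * stepSens cfg h st))) ≤ 1 := by
  classical
  obtain ⟨past, sub, ref⟩ := st
  cases past with
  | nil =>
    rw [lexp_episodeStep_sub_nil M cfg h (fun W => ENNReal.ofReal (Real.exp
      (changeInd (sub h) W - 172032 * cfg.logFactor * stepSens cfg h ⟨[], sub, ref⟩)))]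
    simp [changeInd, stepSens]
  | cons e rest =>
    rw [lexp_episodeStep_sub M cfg hh (fun W => ENNReal.ofReal (Real.exp
      (changeInd (sub h) W - 172032 * cfg.logFactor * stepSens cfg h ⟨e :: rest, sub, ref⟩))),
      lexp_onlineSample]
    have h1 := R.sensitivity_le_fullSens hacc
    obtain ⟨-, h2, -⟩ := R.copies_spec (sub h) (e.pair h)
    have hL := R.one_le_logFactor
    set n := copies H cfg (sub h) (e.pair h)
    set s := stepSens cfg h ⟨e :: rest, sub, ref⟩ with hs
    have hs' : s = fullSens cfg.F cfg.β (pairs rest h) (e.pair h) := rfl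
    rw [← hs'] at h1
    set p : ℝ := (n : ℝ)⁻¹
    have hp0 : 0 ≤ p := by positivity
    have hp1 : 0 ≤ 1 - p := sub_nonneg.2 (Nat.cast_inv_le_one _)
    have hps : 2 * p ≤ 172032 * cfg.logFactor * s := by nlinarith
    rw [← ENNReal.ofReal_mul hp0, ← ENNReal.ofReal_mul hp1,
      ← ENNReal.ofReal_add (by positivity) (by positivity), ENNReal.ofReal_le_one]
    have hc1 : changeInd (sub h) (Multiset.replicate n (cfg.rnd (e.pair h)) + sub h) ≤ 1 := by
      unfold changeInd; split_ifs <;> norm_num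
    have hc2 : changeInd (sub h) (sub h) = 0 := by simp [changeInd]
    rw [hc2]
    set y := 172032 * cfg.logFactor * s
    have he : Real.exp 1 ≤ 3 := Real.exp_one_lt_d9.le.trans (by norm_num)
    calc _ ≤ p * Real.exp (1 - y) + (1 - p) * Real.exp (0 - y) := by gcongr
      _ = Real.exp (-y) * (1 + p * (Real.exp 1 - 1)) := by
          rw [sub_eq_add_neg 1 y, Real.exp_add, zero_sub]; ring
      _ ≤ Real.exp (-y) * (2 * p + 1) := by
          refine mul_le_mul_of_nonneg_left ?_ (Real.exp_pos _).le
          nlinarith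
      _ ≤ Real.exp (-y) * Real.exp (2 * p) := by
          gcongr
          exact Real.add_one_le_exp _
      _ ≤ 1 := by
          rw [← Real.exp_add, Real.exp_le_one_iff]; linarith

theorem Regime.prob_changes_ge (R : Regime M cfg) {h : ℕ} (hh : h < H) (k : ℕ) (x : ℝ) :
    (hist M cfg k).toOuterMeasure {ω | (∀ j < k, SubAccurate H cfg h (ω j)) ∧
        x ≤ ∑ j ∈ Finset.range k, (changeInd ((ω j).sub h) ((ω (j + 1)).sub h)
          - 172032 * cfg.logFactor * stepSens cfg h (ω j))}
      ≤ ENNReal.ofReal (Real.exp (-x)) := by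
  have hE := lexp_hist_le M cfg (Φ := fun k ω => guarded (∀ j < k, SubAccurate H cfg h (ω j))
    (ENNReal.ofReal (Real.exp (∑ j ∈ Finset.range k,
      (changeInd ((ω j).sub h) ((ω (j + 1)).sub h)
          - 172032 * cfg.logFactor * stepSens cfg h (ω j)))))) (a := 1) (c := 0) (n := k)
    (by rw [guarded_pos (by simp)]; simp) (fun i _ ω => by
      have hup : ∀ st, ∀ j ≤ i, Function.update ω (i + 1) st j = ω j := fun st j hj =>
        Function.update_of_ne (by omega) _ _
      -- Accuracy is known only on a good event, so the supermartingale is stopped: its value is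
      -- zero after the first failure.
      by_cases hacc : ∀ j < i + 1, SubAccurate H cfg h (ω j)
      · rw [guarded_pos (fun j hj => hacc j (by omega)), add_zero]
        have hpt : ∀ st, guarded (∀ j < i + 1, SubAccurate H cfg h
            (Function.update ω (i + 1) st j))
            (ENNReal.ofReal (Real.exp (∑ j ∈ Finset.range (i + 1),
              (changeInd ((Function.update ω (i + 1) st j).sub h)
                  ((Function.update ω (i + 1) st (j + 1)).sub h)
                - 172032 * cfg.logFactor * stepSens cfg h (Function.update ω (i + 1) st j)))))
            ≤ ENNReal.ofReal (Real.exp (∑ j ∈ Finset.range i,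
              (changeInd ((ω j).sub h) ((ω (j + 1)).sub h)
                - 172032 * cfg.logFactor * stepSens cfg h (ω j)))) *
              ENNReal.ofReal (Real.exp (changeInd ((ω i).sub h) (st.sub h)
                - 172032 * cfg.logFactor * stepSens cfg h (ω i))) := by
          intro st
          refine (guarded_le _ _).trans_eq ?_
          rw [← ENNReal.ofReal_mul (Real.exp_pos _).le, ← Real.exp_add, Finset.sum_range_succ,
            hup st i le_rfl, Function.update_self]
          congr 3
          refine Finset.sum_congr rfl fun j hj => ?_
          have := Finset.mem_range.1 hj
          rw [hup st j (by omega), hup st (j + 1) (by omega)]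
        refine (lexp_mono hpt).trans ?_
        rw [lexp_const_mul]
        exact (mul_le_mul_right (R.lexp_change_le hh (hacc i (by omega))) _).trans (mul_one _).le
      · refine (lexp_le_of_support (c := 0) fun st _ => ?_).trans zero_le
        rw [guarded_neg]
        intro hall
        refine hacc fun j hj => ?_
        have := hall j hj
        rwa [hup st j (by omega)] at this) k le_rfl
  refine (toOuterMeasure_le_div (a := Real.exp x) (b := 1) (Real.exp_pos x)
    (hE.trans (by rw [mul_zero, add_zero, ENNReal.ofReal_one])) ?_).trans_eq ?_
  · rintro ω - ⟨h1, h2⟩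
    rw [guarded_pos h1]
    exact ENNReal.ofReal_le_ofReal (Real.exp_le_exp.2 h2)
  · rw [Real.exp_neg, one_div]

/-- The number of changes of the sub-sampled dataset of step `h` in the first `k` episodes. -/
noncomputable def numChanges (ω : ℕ → LearnerState S A) (h k : ℕ) : ℕ := by
  classical exact ((Finset.range k).filter fun i => (ω (i + 1)).sub h ≠ (ω i).sub h).card

theorem numChanges_eq_sum (ω : ℕ → LearnerState S A) (h k : ℕ) :
    (numChanges ω h k : ℝ)
      = ∑ j ∈ Finset.range k, changeInd ((ω j).sub h) ((ω (j + 1)).sub h) := by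
  classical
  simp only [numChanges, changeInd, Finset.card_filter]
  push_cast
  rfl

theorem numChanges_mono (ω : ℕ → LearnerState S A) (h : ℕ) {j k : ℕ} (hjk : j ≤ k) :
    numChanges ω h j ≤ numChanges ω h k := by
  classical
  exact Finset.card_le_card (Finset.filter_subset_filter _ (Finset.range_mono hjk))

theorem numChanges_succ (ω : ℕ → LearnerState S A) (h k : ℕ)
    (hne : (ω (k + 1)).sub h ≠ (ω k).sub h) :
    numChanges ω h (k + 1) = numChanges ω h k + 1 := by
  classical
  simp only [numChanges, Finset.card_filter, Finset.sum_range_succ, if_pos hne]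

variable {ω : ℕ → LearnerState S A} {k : ℕ}

theorem IsPath.switches_le_numChanges (hω : IsPath M cfg k ω) :
    switches H (ω k).past ≤ ∑ h ∈ Finset.range H, numChanges ω h k := by
  classical
  refine (hω.switches_le le_rfl).trans_eq (Finset.sum_congr rfl fun h _ => ?_)
  unfold numChanges
  congr

theorem IsPath.pairs_eq (hω : IsPath M cfg k ω) {j : ℕ} (hj : j ≤ k) (h : ℕ) :
    pairs (ω j).past h = (Multiset.range j).map fun i => (ep M cfg ω i).pair h := by
  rw [pairs, hω.past_coe hj, Multiset.map_map]
  rfl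

theorem IsPath.past_length (hω : IsPath M cfg k ω) {j : ℕ} (hj : j ≤ k) :
    (ω j).past.length = j := by
  have := congrArg Multiset.card (hω.past_coe hj)
  simpa using this

theorem IsPath.past_tail (hω : IsPath M cfg k ω) {j : ℕ} (hj : j < k) :
    (ω (j + 1)).past.tail = (ω j).past := by
  rw [hω.past_succ hj, List.tail_cons]

theorem Regime.sum_stepSens_le (R : Regime M cfg) (hω : IsPath M cfg k ω)
    (hk : (k : ℝ) ≤ cfg.T) (hH : (H : ℝ) ≤ cfg.T) (hfin : eluderDim cfg.F (1 / cfg.T) ≠ ⊤)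
    (h : ℕ) :
    ∑ j ∈ Finset.range k, stepSens cfg h (ω j)
      ≤ 1 + 1500 * (eluderDim cfg.F (1 / cfg.T)).toNat * Real.log cfg.T ^ 2 := by
  have hβ := R.β_ge
  have hsq := R.sq_le_β
  have hT := R.le_T
  have hH1 := R.H_pos
  have key := fun (n : ℕ) (hn : (n : ℝ) ≤ cfg.T) =>
    sum_fullSens_le R.F_mem R.F_nonempty (β := cfg.β) (T := cfg.T)
    (by linarith) (by nlinarith [sq_nonneg ((H : ℝ) + 1)]) (by linarith) (by linarith)
    (by linarith) hfin (fun i => (ep M cfg ω i).pair h) n hn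
  cases k with
  | zero => simpa using key 0 (by simp; linarith)
  | succ k =>
    refine le_trans (le_of_eq ?_) (key k (le_trans (by push_cast; linarith) hk))
    -- Nothing is sampled before the first episode, so the sum is shifted by one and runs over the
    -- episodes sampled later.
    rw [Finset.sum_range_succ', stepSens, hω.past_zero, add_zero]
    refine Finset.sum_congr rfl fun j hj => ?_
    have hj := Finset.mem_range.1 hj
    rw [stepSens, hω.past_succ (by omega)]
    simp only
    rw [hω.pairs_eq (by omega)]

/-- The multisets obtained from the empty one by adding at most `m` times at most `N` copies of an
element of `C`. -/
noncomputable def reachable {X : Type*} (C : Finset X) (N : ℕ) : ℕ → Finset (Multiset X)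
  | 0 => {0}
  | m + 1 => by
    classical exact (reachable C N m ×ˢ (C ×ˢ Finset.range (N + 1))).image fun p =>
      Multiset.replicate p.2.2 p.2.1 + p.1

theorem card_reachable_le {X : Type*} (C : Finset X) (N m : ℕ) :
    (reachable C N m).card ≤ (C.card * (N + 1)) ^ m := by
  classical
  induction m with
  | zero => simp [reachable]
  | succ m ih =>
    rw [reachable, pow_succ]
    refine Finset.card_image_le.trans ?_
    rw [Finset.card_product, Finset.card_product, Finset.card_range]
    exact Nat.mul_le_mul_right _ ih

theorem reachable_succ {X : Type*} {C : Finset X} {N m : ℕ} {Z : Multiset X} {x : X} {n : ℕ}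
    (hZ : Z ∈ reachable C N m) (hx : x ∈ C) (hn : n ≤ N) :
    Multiset.replicate n x + Z ∈ reachable C N (m + 1) := by
  classical
  rw [reachable, Finset.mem_image]
  exact ⟨(Z, x, n), by simp [hZ, hx]; omega, rfl⟩

/-- Adding zero copies counts as a step, so "at most `m`" needs only some element of `C`. -/
theorem reachable_mono {X : Type*} {C : Finset X} (hC : C.Nonempty) {N m m' : ℕ} (h : m ≤ m') :
    reachable C N m ⊆ reachable C N m' := by
  induction m', h using Nat.le_induction with
  | base => exact subset_rfl
  | succ m' _ ih =>
    intro Z hZ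
    obtain ⟨x, hx⟩ := hC
    simpa using reachable_succ (ih hZ) hx (Nat.zero_le N)

/-- Datasets never shrink, so the final size bounds every single number of added copies, and only
actual changes use up a step. -/
theorem IsPath.sub_mem_reachable (hω : IsPath M cfg k ω) {C : Finset (S × A)}
    (hC : ∀ x, cfg.rnd x ∈ C) {h N : ℕ} (hcard : Multiset.card ((ω k).sub h) ≤ N) {j : ℕ}
    (hj : j ≤ k) : (ω j).sub h ∈ reachable C N (numChanges ω h j) := by
  induction j with
  | zero => rw [hω.1]; simp [initState, numChanges, reachable]
  | succ j ih =>
    by_cases heq : (ω (j + 1)).sub h = (ω j).sub h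
    · rw [heq]
      exact reachable_mono ⟨_, hC ((ω j).past.headD ⟨plan M cfg [] fun _ => 0, fun _ => M.s₁⟩
        |>.pair h)⟩ (numChanges_mono ω h (by omega)) (ih (by omega))
    · rw [numChanges_succ ω h j heq]
      cases j with
      | zero => exact absurd (by rw [hω.sub_one (by omega), hω.1]; rfl) heq
      | succ j =>
        rcases hω.sub_succ (show j + 1 < k by omega) h with h1 | h1
        · have h2 := Multiset.card_le_card (hω.sub_mono hj le_rfl h)
          rw [h1] at h2 ⊢
          refine reachable_succ (ih (by omega)) (hC _) ?_
          rw [Multiset.card_add, Multiset.card_replicate] at h2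
          omega
        · exact absurd h1 heq

end Changes

/-! ### Least-squares fits are close to Bellman backups -/

section Regression

variable {S : Type u} {A : Type v} {H : ℕ}

/-- The Bellman backup `r_h + P_h V`. -/
noncomputable def backup (M : EpisodicMDP S A H) (h : ℕ) (V : S → ℝ) (z : S × A) : ℝ :=
  M.r h z.1 z.2 + expect (M.P h z.1 z.2) V

/-- The state values of the optimistic estimate built from `f` and the dataset `Z`. -/
noncomputable def valueOf (H : ℕ) (cfg : Config S A) (Z : Multiset (S × A)) (f : S × A → ℝ)
    (s : S) : ℝ := ⨆ a, optimistic cfg.F H cfg.T cfg.β Z f (s, a)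

variable {M : EpisodicMDP S A H} {cfg : Config S A}

theorem bonus_nonneg (F : Set (S × A → ℝ)) (T β : ℝ) (Z : Multiset (S × A)) (z : S × A) :
    0 ≤ bonus F H T β Z z := by
  refine Real.sSup_nonneg ?_
  rintro _ ⟨f, -, g, -, -, rfl⟩
  exact abs_nonneg _

namespace Regime

theorem bddAbove_bonus (R : Regime M cfg) (Z : Multiset (S × A)) (z : S × A) :
    BddAbove {x : ℝ | ∃ f ∈ cfg.F, ∃ g ∈ cfg.F,
      min (sqNorm Z (f - g)) (cfg.T * (H + 1) ^ 2) ≤ cfg.β ∧ x = |f z - g z|} := by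
  refine ⟨H + 1, ?_⟩
  rintro _ ⟨f, hf, g, hg, -, rfl⟩
  exact abs_le_of_sq_le_sq (sq_sub_le R.F_mem hf hg z) (by positivity)

theorem abs_sub_le_bonus (R : Regime M cfg) {Z : Multiset (S × A)} {f g : S × A → ℝ}
    (hf : f ∈ cfg.F) (hg : g ∈ cfg.F) (h : sqNorm Z (f - g) ≤ cfg.β) (z : S × A) :
    |f z - g z| ≤ bonus cfg.F H cfg.T cfg.β Z z :=
  le_csSup (R.bddAbove_bonus Z z) ⟨f, hf, g, hg, (min_le_left _ _).trans h, rfl⟩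

theorem optimistic_mem_Icc (R : Regime M cfg) (Z : Multiset (S × A)) {f : S × A → ℝ}
    (hf : f ∈ cfg.F) (z : S × A) :
    optimistic cfg.F H cfg.T cfg.β Z f z ∈ Set.Icc (0 : ℝ) H :=
  ⟨le_min (add_nonneg (R.F_mem f hf z).1 (bonus_nonneg _ _ _ _ _)) (Nat.cast_nonneg H),
    min_le_right _ _⟩

theorem valueOf_mem_Icc (R : Regime M cfg) (Z : Multiset (S × A)) {f : S × A → ℝ}
    (hf : f ∈ cfg.F) (s : S) : valueOf H cfg Z f s ∈ Set.Icc (0 : ℝ) H :=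
  ⟨Real.iSup_nonneg fun a => (R.optimistic_mem_Icc Z hf (s, a)).1,
    Real.iSup_le (fun a => (R.optimistic_mem_Icc Z hf (s, a)).2) (Nat.cast_nonneg H)⟩

theorem optimistic_le_valueOf (R : Regime M cfg) (Z : Multiset (S × A)) {f : S × A → ℝ}
    (hf : f ∈ cfg.F) (s : S) (a : A) :
    optimistic cfg.F H cfg.T cfg.β Z f (s, a) ≤ valueOf H cfg Z f s :=
  le_ciSup (f := fun a => optimistic cfg.F H cfg.T cfg.β Z f (s, a))
    ⟨H, by rintro _ ⟨a, rfl⟩; exact (R.optimistic_mem_Icc Z hf (s, a)).2⟩ a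

/-- For a fixed dataset the bonus does not depend on the fit, and truncation and supremum are
1-Lipschitz. Covering the fits therefore covers the values. -/
theorem valueOf_le (R : Regime M cfg) (Z : Multiset (S × A)) {f g : S × A → ℝ}
    (hg : g ∈ cfg.F) {ε : ℝ} (hε : 0 ≤ ε) (h : ∀ x, |f x - g x| ≤ ε) (s : S) :
    valueOf H cfg Z f s ≤ valueOf H cfg Z g s + ε := by
  refine Real.iSup_le (fun a => ?_) (add_nonneg (R.valueOf_mem_Icc Z hg s).1 hε)
  refine le_trans ?_ (add_le_add_left (R.optimistic_le_valueOf Z hg s a) ε)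
  have := (abs_le.1 (h (s, a))).2
  unfold optimistic
  rw [← min_add_add_right]
  exact min_le_min (by linarith) (by linarith)

theorem abs_valueOf_sub_le (R : Regime M cfg) (Z : Multiset (S × A)) {f g : S × A → ℝ}
    (hf : f ∈ cfg.F) (hg : g ∈ cfg.F) {ε : ℝ} (hε : 0 ≤ ε) (h : ∀ x, |f x - g x| ≤ ε) (s : S) :
    |valueOf H cfg Z f s - valueOf H cfg Z g s| ≤ ε := by
  have h1 := R.valueOf_le Z hg hε h s
  have h2 := R.valueOf_le Z hf hε (fun x => by rw [abs_sub_comm]; exact h x) s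
  rw [abs_le]; constructor <;> linarith

theorem backup_mem (R : Regime M cfg) {h : ℕ} (hh : h < H) {V : S → ℝ}
    (hV : ∀ s, V s ∈ Set.Icc (0 : ℝ) H) : backup M h V ∈ cfg.F := by
  obtain ⟨f, hf, h1⟩ := R.bellman h hh V hV
  have : backup M h V = f := by
    funext ⟨s, a⟩; exact (h1 s a).symm
  rwa [this]

/-- The exponent of the regression supermartingale: one episode. -/
noncomputable def _root_.LSVI.regTerm (M : EpisodicMDP S A H) (h : ℕ) (V : S → ℝ)
    (f : S × A → ℝ) (e : Episode S A) : ℝ :=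
  1 / (16 * (H : ℝ) ^ 2) * (f (e.pair h) - backup M h V (e.pair h)) *
      (V (e.states (h + 1)) - expect (M.P h (e.pair h).1 (e.pair h).2) V) -
    (1 / (16 * (H : ℝ) ^ 2) * (f (e.pair h) - backup M h V (e.pair h))) ^ 2 * (H : ℝ) ^ 2

/-- For fixed `V` and `f` the exponential of the sum is a supermartingale started at one: whichever
policy is played, the transition noise at step `h` is centred given the state-action pair. -/
theorem prob_regTerm_ge (R : Regime M cfg) {h : ℕ} (hh : h < H) {V : S → ℝ}
    (hV : ∀ s, V s ∈ Set.Icc (0 : ℝ) H) {f : S × A → ℝ} (hf : f ∈ cfg.F) {j k : ℕ} (hjk : j ≤ k)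
    (x : ℝ) :
    (hist M cfg k).toOuterMeasure {ω | x ≤ ((ω j).past.map (regTerm M h V f)).sum}
      ≤ ENNReal.ofReal (Real.exp (-x)) := by
  have hH := R.H_pos
  have hstep : ∀ st, lexp (episodeStep M cfg st) (fun st => ENNReal.ofReal
      (Real.exp (st.past.map (regTerm M h V f)).sum)) ≤
      ENNReal.ofReal (Real.exp (st.past.map (regTerm M h V f)).sum) + 0 := by
    intro st
    rw [lexp_episodeStep, add_zero]
    refine lexp_le_of_support fun sub' _ => ?_
    simp only [nextState, List.map_cons, List.sum_cons]
    rw [show (fun σ => ENNReal.ofReal (Real.exp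
        (regTerm M h V f ⟨nextPolicy M cfg st sub', σ⟩ + (st.past.map (regTerm M h V f)).sum)))
      = fun σ => ENNReal.ofReal (Real.exp (st.past.map (regTerm M h V f)).sum) *
        ENNReal.ofReal (Real.exp (regTerm M h V f ⟨nextPolicy M cfg st sub', σ⟩)) by
          funext σ
          rw [← ENNReal.ofReal_mul (Real.exp_pos _).le, ← Real.exp_add, add_comm],
      lexp_const_mul]
    refine (mul_le_mul_right ?_ _).trans (mul_one _).le
    set π := nextPolicy M cfg st sub'
    refine lexp_rollout_transition_le M π h (G := fun s s' => ENNReal.ofReal (Real.exp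
      (1 / (16 * (H : ℝ) ^ 2) * (f (s, π h s) - backup M h V (s, π h s)) *
        (V s' - expect (M.P h s (π h s)) V) -
      (1 / (16 * (H : ℝ) ^ 2) * (f (s, π h s) - backup M h V (s, π h s))) ^ 2 * (H : ℝ) ^ 2)))
      (fun s => lexp_exp_centred_le _ hV ?_) H 0 _ (Nat.zero_le h) (by omega)
    -- The scale $1/(16H^2)$ makes the exponent admissible in `lexp_exp_centred_le`:
    -- $(H+1)H\le16H^2$.
    have h1 : |f (s, π h s) - backup M h V (s, π h s)| ≤ (H : ℝ) + 1 :=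
      abs_le_of_sq_le_sq (sq_sub_le R.F_mem hf (R.backup_mem hh hV) _) (by positivity)
    rw [abs_mul, abs_of_nonneg (by positivity : 0 ≤ 1 / (16 * (H : ℝ) ^ 2))]
    calc _ ≤ 1 / (16 * (H : ℝ) ^ 2) * ((H : ℝ) + 1) * H := by gcongr
      _ ≤ 1 := by
        rw [div_mul_eq_mul_div, div_mul_eq_mul_div, div_le_one (by positivity)]
        nlinarith
  have hE := lexp_hist_state_le M cfg (a := 1) (by simp [initState]) hstep hjk
  refine (toOuterMeasure_le_div (a := Real.exp x) (b := 1) (Real.exp_pos x)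
    (hE.trans (by simp)) ?_).trans_eq ?_
  · intro ω _ hω
    exact ENNReal.ofReal_le_ofReal (Real.exp_le_exp.2 hω)
  · rw [Real.exp_neg, one_div]

/-- A least-squares fit is close to the Bellman backup when no exponent near it is large. -/
theorem sqNorm_lsq_sub_backup_le (R : Regime M cfg) {h : ℕ} (hh : h < H) {V V' : S → ℝ}
    (hV : ∀ s, V s ∈ Set.Icc (0 : ℝ) H) (hV' : ∀ s, V' s ∈ Set.Icc (0 : ℝ) H) {ε : ℝ}
    (hε0 : 0 ≤ ε) (hVV : ∀ s, |V s - V' s| ≤ ε) (past : List (Episode S A))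
    {f f' : S × A → ℝ}
    (hfl : f = cfg.lsq ((past : Multiset (Episode S A)).map fun e =>
      (e.pair h, M.r h (e.pair h).1 (e.pair h).2 + V (e.states (h + 1)))))
    (hff : ∀ z, |f z - f' z| ≤ ε) {x : ℝ} (hx0 : 0 ≤ x) (hx : (past.map (regTerm M h V' f')).sum ≤ x) :
    sqNorm (pairs past h) (f - backup M h V)
      ≤ 43 * (H : ℝ) ^ 2 * x + (16 * H * ε + 2 * ε ^ 2) * past.length := by
  have hH := R.H_pos
  have hTV := R.backup_mem hh hV
  have hTV' := R.backup_mem hh hV'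
  set D := (past : Multiset (Episode S A)).map fun e =>
      (e.pair h, M.r h (e.pair h).1 (e.pair h).2 + V (e.states (h + 1))) with hD
  have hfF : f ∈ cfg.F := hfl ▸ (R.lsq D).1
  have hmin : sqLoss D f ≤ sqLoss D (backup M h V) := hfl ▸ (R.lsq D).2 _ hTV
  rw [sqLoss, sqLoss, hD, Multiset.map_map, Multiset.map_map, Multiset.map_coe, Multiset.map_coe,
    Multiset.sum_coe, Multiset.sum_coe] at hmin
  rw [sqNorm, pairs, Multiset.map_map, Multiset.map_coe, Multiset.sum_coe]
  -- With $\varphi$ the deviation of the fit and $\xi$ the noise, the excess loss is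
  -- $\varphi^2-2\varphi\xi$. The cross term is charged to `regTerm` at the approximations
  -- $\varphi',\xi'$, whose compensator $\varphi'^2/8\le\varphi^2/4+\varepsilon^2$ leaves
  -- $\frac34\varphi^2$.
  have hterm : ∀ e : Episode S A,
      3 / 4 * (f - backup M h V) (e.pair h) ^ 2 ≤
        ((f (e.pair h) - (M.r h (e.pair h).1 (e.pair h).2 + V (e.states (h + 1)))) ^ 2
        - (backup M h V (e.pair h) - (M.r h (e.pair h).1 (e.pair h).2 +
          V (e.states (h + 1)))) ^ 2) + 32 * (H : ℝ) ^ 2 * regTerm M h V' f' e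
        + (12 * H * ε + ε ^ 2) := by
    intro e
    set z := e.pair h with hz
    set s' := e.states (h + 1)
    set m := expect (M.P h z.1 z.2) V with hm
    set m' := expect (M.P h z.1 z.2) V' with hm'
    set r := M.r h z.1 z.2
    have e1 : |m - m'| ≤ ε := abs_expect_sub_le _ hV hV' hVV
    have e2 := abs_le.1 e1
    have e3 := abs_le.1 (hVV s')
    have e4 := abs_le.1 (hff z)
    have e5 : |f z - (r + m)| ≤ H + 1 :=
      abs_le_of_sq_le_sq (sq_sub_le R.F_mem hfF hTV z) (by positivity)
    have e6 := expect_mem_Icc (M.P h z.1 z.2) hV'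
    rw [← hm'] at e6
    have e7 : |V' s' - m'| ≤ H := by
      have := hV' s'
      rw [abs_le]; constructor <;> linarith [this.1, this.2, e6.1, e6.2]
    have hb : backup M h V z = r + m := rfl
    have hb' : backup M h V' z = r + m' := rfl
    set φ := f z - (r + m) with hφ
    set φ' := f' z - (r + m') with hφ'
    set ξ := V s' - m with hξ
    set ξ' := V' s' - m' with hξ'
    have d1 : |φ - φ'| ≤ 2 * ε := by
      rw [abs_le]; constructor <;> linarith [e2.1, e2.2, e4.1, e4.2]
    have d2 : |ξ - ξ'| ≤ 2 * ε := by
      rw [abs_le]; constructor <;> linarith [e2.1, e2.2, e3.1, e3.2]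
    have d3 : φ * ξ - φ' * ξ' ≤ 6 * H * ε := by
      have a1 : φ * (ξ - ξ') ≤ (H + 1) * (2 * ε) := by
        refine (le_abs_self _).trans ?_
        rw [abs_mul]; gcongr
      have a2 : (φ - φ') * ξ' ≤ 2 * ε * H := by
        refine (le_abs_self _).trans ?_
        rw [abs_mul]; gcongr
      nlinarith
    have d4 : φ' ^ 2 ≤ 2 * φ ^ 2 + 8 * ε ^ 2 :=
      sq_le_two_mul_sq_add (by rw [abs_sub_comm]; exact d1)
    have hreg : 32 * (H : ℝ) ^ 2 * regTerm M h V' f' e = 2 * (φ' * ξ') - φ' ^ 2 / 8 := by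
      rw [regTerm, ← hz, hb']
      have : (H : ℝ) ≠ 0 := by positivity
      field_simp
      ring
    have hsq : (f z - (r + V s')) ^ 2 - (backup M h V z - (r + V s')) ^ 2
        = φ ^ 2 - 2 * (φ * ξ) := by
      rw [hb, hφ, hξ]; ring
    rw [hreg, hsq, Pi.sub_apply, hb, ← hφ]
    linarith
  have hsum : 3 / 4 * (past.map fun e => (f - backup M h V) (e.pair h) ^ 2).sum ≤
      ((past.map fun e =>
        (f (e.pair h) - (M.r h (e.pair h).1 (e.pair h).2 + V (e.states (h + 1)))) ^ 2).sum
      - (past.map fun e => (backup M h V (e.pair h) - (M.r h (e.pair h).1 (e.pair h).2 +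
          V (e.states (h + 1)))) ^ 2).sum) + 32 * (H : ℝ) ^ 2 * (past.map (regTerm M h V' f')).sum
        + (12 * H * ε + ε ^ 2) * past.length := by
    clear hmin hx hx0 hfl
    clear_value D
    clear hD
    induction past with
    | nil => simp
    | cons e l ih =>
      have := hterm e
      simp only [List.map_cons, List.sum_cons, List.length_cons]
      push_cast
      linarith
  have hmin' : (past.map fun e =>
        (f (e.pair h) - (M.r h (e.pair h).1 (e.pair h).2 + V (e.states (h + 1)))) ^ 2).sum
      ≤ (past.map fun e => (backup M h V (e.pair h) - (M.r h (e.pair h).1 (e.pair h).2 +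
          V (e.states (h + 1)))) ^ 2).sum := hmin
  have hx' : 32 * (H : ℝ) ^ 2 * (past.map (regTerm M h V' f')).sum ≤ 32 * (H : ℝ) ^ 2 * x := by
    gcongr
  -- Dividing by $3/4$ gives $\frac43\cdot32<43$ and $\frac43\cdot12=16$.
  have hfin : (past.map fun e => (f - backup M h V) (e.pair h) ^ 2).sum
      ≤ 4 / 3 * (32 * (H : ℝ) ^ 2 * x) + 4 / 3 * ((12 * H * ε + ε ^ 2) * past.length) := by
    linarith
  have hgoal : (past.map ((fun x => (f - backup M h V) x ^ 2) ∘ fun e => e.pair h)).sum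
      = (past.map fun e => (f - backup M h V) (e.pair h) ^ 2).sum := rfl
  rw [hgoal]
  have h1 : 0 ≤ ε ^ 2 * (past.length : ℝ) := by positivity
  have h2 : 0 ≤ (H : ℝ) ^ 2 * x := by positivity
  linarith

end Regime

end Regression

/-! ### From bonuses to regret -/

section Regret

variable {S : Type u} {A : Type v} {H : ℕ}

/-- The state values of the estimates of the algorithm. -/
noncomputable def planV (M : EpisodicMDP S A H) (cfg : Config S A) (past : List (Episode S A))
    (W : ℕ → Multiset (S × A)) (h : ℕ) (s : S) : ℝ := ⨆ a, estQ M cfg past W (H - h) (s, a)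

/-- The least-squares fits of the algorithm. -/
noncomputable def planFit (M : EpisodicMDP S A H) (cfg : Config S A) (past : List (Episode S A))
    (W : ℕ → Multiset (S × A)) (h : ℕ) : S × A → ℝ :=
  cfg.lsq ((past : Multiset (Episode S A)).map fun e =>
      (e.pair h, M.r h (e.pair h).1 (e.pair h).2 + planV M cfg past W (h + 1) (e.states (h + 1))))

variable {M : EpisodicMDP S A H} {cfg : Config S A}

theorem estQ_eq (past : List (Episode S A)) (W : ℕ → Multiset (S × A)) {h : ℕ} (hh : h < H) :
    estQ M cfg past W (H - h)
      = optimistic cfg.F H cfg.T cfg.β (W h) (planFit M cfg past W h) := by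
  obtain ⟨n, hn⟩ : ∃ n, H - h = n + 1 := ⟨H - h - 1, by omega⟩
  have h1 : H - (n + 1) = h := by omega
  have h2 : H - (h + 1) = n := by omega
  rw [hn, estQ, h1]
  simp only [planFit, planV, h2]

theorem planV_eq (past : List (Episode S A)) (W : ℕ → Multiset (S × A)) {h : ℕ} (hh : h < H)
    (s : S) : planV M cfg past W h s = valueOf H cfg (W h) (planFit M cfg past W h) s := by
  rw [planV, estQ_eq past W hh, valueOf]

theorem planV_horizon (past : List (Episode S A)) (W : ℕ → Multiset (S × A)) (s : S) :
    planV M cfg past W H s = 0 := by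
  simp [planV, estQ]

/-- The doubled bonus, clipped at the level `x₀`. -/
noncomputable def clippedBonus (H : ℕ) (cfg : Config S A) (x₀ : ℝ) (Z : Multiset (S × A))
    (z : S × A) : ℝ :=
  if x₀ < 2 * bonus cfg.F H cfg.T cfg.β Z z then min (2 * bonus cfg.F H cfg.T cfg.β Z z) H else 0

theorem clippedBonus_mem_Icc (x₀ : ℝ) (Z : Multiset (S × A)) (z : S × A) :
    clippedBonus H cfg x₀ Z z ∈ Set.Icc (0 : ℝ) H := by
  have := bonus_nonneg (H := H) cfg.F cfg.T cfg.β Z z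
  unfold clippedBonus
  split_ifs
  · exact ⟨le_min (by linarith) (Nat.cast_nonneg H), min_le_right _ _⟩
  · exact ⟨le_rfl, Nat.cast_nonneg H⟩

namespace Regime

theorem planFit_mem (R : Regime M cfg) (past : List (Episode S A)) (W : ℕ → Multiset (S × A))
    (h : ℕ) : planFit M cfg past W h ∈ cfg.F := (R.lsq _).1

theorem planV_mem_Icc (R : Regime M cfg) (past : List (Episode S A)) (W : ℕ → Multiset (S × A))
    {h : ℕ} (hh : h ≤ H) (s : S) : planV M cfg past W h s ∈ Set.Icc (0 : ℝ) H := by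
  rcases hh.eq_or_lt with rfl | hh
  · rw [planV_horizon]; exact ⟨le_rfl, Nat.cast_nonneg h⟩
  · rw [planV_eq past W hh]; exact R.valueOf_mem_Icc _ (R.planFit_mem past W h) s

/-- The regret of a plan whose fits are within the bonus of the Bellman backups. -/
theorem regret_plan_le (R : Regime M cfg) (hpos : 0 < gapMin M) {past : List (Episode S A)}
    {W W' : ℕ → Multiset (S × A)} (hWW : ∀ h < H, W' h = W h)
    (hfit : ∀ h < H, ∀ z, |planFit M cfg past W h z - backup M h (planV M cfg past W (h + 1)) z|
      ≤ bonus cfg.F H cfg.T cfg.β (W h) z) (s : S) :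
    optV M 0 s - valueV M (plan M cfg past W) 0 s ≤
      2 * polVal M (plan M cfg past W) (fun h s => clippedBonus H cfg (gapMin M / (2 * H)) (W' h)
        (s, plan M cfg past W h s)) H 0 s := by
  set π := plan M cfg past W with hπ
  have hV := fun {h} (hh : h ≤ H) => R.planV_mem_Icc past W hh
  have hback : ∀ h < H, ∀ s a, M.r h s a + expect (M.P h s a) (planV M cfg past W (h + 1))
      = backup M h (planV M cfg past W (h + 1)) (s, a) := fun _ _ _ _ => rfl
  -- The surplus is capped at `H` as well, which bounds the clipped bonus and later scales the
  -- Chernoff bound.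
  refine optV_sub_valueV_le M π hpos (W := planV M cfg past W) (B := H)
    (E := fun h s => min (2 * bonus cfg.F H cfg.T cfg.β (W h) (s, π h s)) H)
    (fun h hh => hV hh) (planV_horizon past W) (fun h s => clippedBonus_mem_Icc _ _ _)
    (optV_le_of_optimistic M π (fun h hh => hV hh) fun h hh s a => ?_) (fun h hh s => ?_)
    (fun h hh s => ?_) 0 (Nat.zero_le H) s
  · rw [hback h hh, planV_eq past W hh]
    refine le_trans ?_ (R.optimistic_le_valueOf _ (R.planFit_mem past W h) s a)
    refine min_le_min ?_ le_rfl
    have := (abs_le.1 (hfit h hh (s, a))).1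
    linarith
  · rw [hback h hh, planV_eq past W hh]
    have h1 : valueOf H cfg (W h) (planFit M cfg past W h) s ≤
        optimistic cfg.F H cfg.T cfg.β (W h) (planFit M cfg past W h) (s, π h s) := by
      refine Real.iSup_le (fun a => ?_) (R.optimistic_mem_Icc _ (R.planFit_mem past W h) _).1
      have := R.greedy _ (R.planFit_mem past W h) (W h) s a
      rw [← estQ_eq past W hh] at this ⊢
      exact this
    refine h1.trans ?_
    have h2 := (abs_le.1 (hfit h hh (s, π h s))).2
    have h3 := (R.F_mem _ (R.backup_mem hh (hV (h := h + 1) hh)) (s, π h s)).1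
    -- The fit plus bonus is at most the backup plus two bonuses; the cap `H` is at most the backup
    -- plus `H`, since the backup is nonnegative.
    rw [← min_add_add_left]
    refine le_min ?_ ?_
    · refine (min_le_left _ _).trans ?_
      linarith
    · refine (min_le_right _ _).trans ?_
      linarith
  · simp only [clippedBonus, hWW h hh]
    split_ifs with hc
    · have : 0 ≤ gapMin M / (2 * (H : ℝ)) := by positivity
      linarith
    · refine (min_le_left _ _).trans ?_
      linarith

/-- The expected clipped bonus of the last episode. -/
noncomputable def _root_.LSVI.meanClipped (M : EpisodicMDP S A H) (cfg : Config S A) (x₀ : ℝ)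
    (st : LearnerState S A) : ℝ :=
  match st.past with
  | [] => 0
  | e :: _ => polVal M e.policy (fun h s => clippedBonus H cfg x₀ (st.sub h) (s, e.policy h s))
      H 0 M.s₁

/-- The clipped bonus collected in the last episode. -/
noncomputable def _root_.LSVI.sumClipped (H : ℕ) (cfg : Config S A) (x₀ : ℝ)
    (st : LearnerState S A) : ℝ :=
  match st.past with
  | [] => 0
  | e :: _ => ∑ h ∈ Finset.range H, clippedBonus H cfg x₀ (st.sub h) (e.pair h)

/-- The clipped bonuses of one episode sum to at most $H^2$, and the mean of this sum is the policy
value of the clipped bonuses. So `lexp_exp_half_mean_le` applies episode by episode. Comparing with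
half the mean avoids any deviation term of order $\sqrt T$. -/
theorem prob_meanClipped_ge (R : Regime M cfg) (x₀ : ℝ) (k : ℕ) (x : ℝ) :
    (hist M cfg k).toOuterMeasure {ω | x ≤ ∑ j ∈ Finset.range k,
        (meanClipped M cfg x₀ (ω (j + 1)) / 2 - sumClipped H cfg x₀ (ω (j + 1))) / (H : ℝ) ^ 2}
      ≤ ENNReal.ofReal (Real.exp (-x)) := by
  have hH := R.H_pos
  have hone : ∀ st, lexp (episodeStep M cfg st) (fun st' => ENNReal.ofReal (Real.exp
      ((meanClipped M cfg x₀ st' / 2 - sumClipped H cfg x₀ st') / (H : ℝ) ^ 2))) ≤ 1 := by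
    intro st
    rw [lexp_episodeStep]
    refine lexp_le_of_support fun sub' _ => ?_
    simp only [meanClipped, sumClipped, nextState]
    set π := nextPolicy M cfg st sub'
    have h1 := expect_rollout_sum M π (g := fun h s => clippedBonus H cfg x₀ (sub' h)
      (s, π h s)) (B := H) (fun h s => clippedBonus_mem_Icc _ _ _) H 0 (fun _ => M.s₁)
    rw [zero_add, Nat.Ico_zero_eq_range] at h1
    rw [← h1]
    refine lexp_exp_half_mean_le _ (by positivity) fun σ _ => ?_
    have := sum_mem_Icc (Finset.range H) (f := fun h => clippedBonus H cfg x₀ (sub' h)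
      (σ h, π h (σ h))) (B := H) fun h _ => clippedBonus_mem_Icc _ _ _
    rwa [Finset.card_range, ← sq] at this
  have hE := lexp_hist_le M cfg (Φ := fun k ω => ENNReal.ofReal (Real.exp
    (∑ j ∈ Finset.range k, (meanClipped M cfg x₀ (ω (j + 1)) / 2
      - sumClipped H cfg x₀ (ω (j + 1))) / (H : ℝ) ^ 2))) (a := 1) (c := 0) (n := k) (by simp)
    (fun i _ ω => by
      have hup : ∀ st, ∀ j ≤ i, Function.update ω (i + 1) st j = ω j := fun st j hj =>
        Function.update_of_ne (by omega) _ _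
      rw [add_zero]
      have hpt : ∀ st, ENNReal.ofReal (Real.exp (∑ j ∈ Finset.range (i + 1),
          (meanClipped M cfg x₀ (Function.update ω (i + 1) st (j + 1)) / 2
            - sumClipped H cfg x₀ (Function.update ω (i + 1) st (j + 1))) / (H : ℝ) ^ 2))
          = ENNReal.ofReal (Real.exp (∑ j ∈ Finset.range i, (meanClipped M cfg x₀ (ω (j + 1)) / 2
            - sumClipped H cfg x₀ (ω (j + 1))) / (H : ℝ) ^ 2)) * ENNReal.ofReal (Real.exp
            ((meanClipped M cfg x₀ st / 2 - sumClipped H cfg x₀ st) / (H : ℝ) ^ 2)) := by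
        intro st
        rw [← ENNReal.ofReal_mul (Real.exp_pos _).le, ← Real.exp_add, Finset.sum_range_succ,
          Function.update_self]
        congr 3
        refine Finset.sum_congr rfl fun j hj => ?_
        have := Finset.mem_range.1 hj
        rw [hup st (j + 1) (by omega)]
      simp only [hpt]
      rw [lexp_const_mul]
      exact (mul_le_mul_right (hone (ω i)) _).trans (mul_one _).le) k le_rfl
  refine (toOuterMeasure_le_div (a := Real.exp x) (b := 1) (Real.exp_pos x)
    (hE.trans (by rw [mul_zero, add_zero, ENNReal.ofReal_one])) ?_).trans_eq ?_
  · intro ω _ hω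
    exact ENNReal.ofReal_le_ofReal (Real.exp_le_exp.2 hω)
  · rw [Real.exp_neg, one_div]

variable {ω : ℕ → LearnerState S A} {k : ℕ}

/-- A doubled bonus above $x$ is witnessed by two functions more than $x/2$ apart, with truncated
sample norm at most $\beta$. Accuracy bounds their norm on all the past data by
$100\beta=(400\beta/x^2)(x/2)^2$, which is the input of the eluder count. -/
theorem sum_clippedBonus_le (R : Regime M cfg) (hω : IsPath M cfg k ω)
    (hfin : eluderDim cfg.F (1 / cfg.T) ≠ ⊤) {x₀ : ℝ} (hx₀ : 2 / cfg.T ≤ x₀) (hx₀H : x₀ < H)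
    {h : ℕ} (hacc : ∀ j < k, SubAccurate H cfg h (ω (j + 1))) :
    ∑ j ∈ Finset.range k, clippedBonus H cfg x₀ ((ω (j + 1)).sub h) ((ep M cfg ω j).pair h)
      ≤ 1600 * (eluderDim cfg.F (1 / cfg.T)).toNat * cfg.β / x₀
        + 4 * (eluderDim cfg.F (1 / cfg.T)).toNat * H := by
  have hT := R.T_pos
  have hβ := R.β_ge
  have hx0 : 0 < x₀ := lt_of_lt_of_le (by positivity) hx₀
  have := sum_clipped_le (Y := fun j => clippedBonus H cfg x₀ ((ω (j + 1)).sub h)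
    ((ep M cfg ω j).pair h)) (n := k) (x₀ := x₀) (Hr := H) (b := 400 * cfg.β)
    (d := (((eluderDim cfg.F (1 / cfg.T)).toNat : ℕ) : ℝ)) hx0
    (Nat.cast_nonneg _) (by linarith) (Nat.cast_nonneg H)
    (fun j _ => (clippedBonus_mem_Icc _ _ _).2) (fun j _ => by
      unfold clippedBonus
      split_ifs with hc
      · exact Or.inr (lt_min hc hx₀H)
      · exact Or.inl rfl) (fun x hx => by
      have hxpos : 0 < x := hx0.trans_le hx
      refine card_le_eluderDim (ε := x / 2) (R := 400 * cfg.β / x ^ 2) (by positivity) ?_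
        (by positivity) hfin (fun j => (ep M cfg ω j).pair h) _ fun j hj => ?_
      · have : 2 / cfg.T ≤ x := hx₀.trans hx
        have e : 2 / cfg.T = 2 * (1 / cfg.T) := by ring
        linarith
      · obtain ⟨hjk, hxy⟩ := Finset.mem_filter.1 hj
        have hjk := Finset.mem_range.1 hjk
        have hb : x / 2 < bonus cfg.F H cfg.T cfg.β ((ω (j + 1)).sub h)
            ((ep M cfg ω j).pair h) := by
          unfold clippedBonus at hxy
          split_ifs at hxy with hc
          · have := hxy.trans_le (min_le_left _ _)
            linarith
          · linarith
        have hne : {x : ℝ | ∃ f ∈ cfg.F, ∃ g ∈ cfg.F,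
            min (sqNorm ((ω (j + 1)).sub h) (f - g)) (cfg.T * (H + 1) ^ 2) ≤ cfg.β ∧
              x = |f ((ep M cfg ω j).pair h) - g ((ep M cfg ω j).pair h)|}.Nonempty := by
          obtain ⟨f, hf⟩ := R.F_nonempty
          refine ⟨_, f, hf, f, hf, (min_le_left _ _).trans ?_, rfl⟩
          have : sqNorm ((ω (j + 1)).sub h) (f - f) = 0 := by simp [sqNorm]
          rw [this]; linarith
        obtain ⟨_, ⟨f, hf, g, hg, hmin, rfl⟩, hlt⟩ := exists_lt_of_lt_csSup hne hb
        refine ⟨f, hf, g, hg, hlt, ?_⟩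
        have h1 := (hacc j hjk f hf g hg).2
        rw [hω.past_tail hjk, hω.pairs_eq hjk.le] at h1
        rw [show 400 * cfg.β / x ^ 2 * (x / 2) ^ 2 = 100 * cfg.β by field_simp; norm_num]
        linarith)
  refine this.trans_eq ?_
  ring

/-- On the good event the regret is small. -/
theorem regret_le (R : Regime M cfg) (hpos : 0 < gapMin M) (hω : IsPath M cfg k ω)
    (hfin : eluderDim cfg.F (1 / cfg.T) ≠ ⊤) (hgap : 2 / cfg.T ≤ gapMin M / (2 * H))
    (hgapH : gapMin M / (2 * H) < H)
    (hacc : ∀ h < H, ∀ j < k, SubAccurate H cfg h (ω (j + 1)))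
    (hfit : ∀ j < k, ∀ h < H, sqNorm (pairs (ω j).past h)
      (planFit M cfg (ω j).past (ω (j + 1)).sub h -
        backup M h (planV M cfg (ω j).past (ω (j + 1)).sub (h + 1))) ≤ cfg.β / 480)
    {x : ℝ} (hx : ∑ j ∈ Finset.range k,
        (meanClipped M cfg (gapMin M / (2 * H)) (ω (j + 1)) / 2
          - sumClipped H cfg (gapMin M / (2 * H)) (ω (j + 1))) / (H : ℝ) ^ 2 ≤ x) :
    regret M (ω k).past ≤ 4 * (H * (1600 * (eluderDim cfg.F (1 / cfg.T)).toNat * cfg.β /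
      (gapMin M / (2 * H)) + 4 * (eluderDim cfg.F (1 / cfg.T)).toNat * H)) + 4 * H ^ 2 * x := by
  have hH := R.H_pos
  set x₀ := gapMin M / (2 * H) with hx₀
  have hep : ∀ j < k, optV M 0 M.s₁ - valueV M (ep M cfg ω j).policy 0 M.s₁
      ≤ 2 * meanClipped M cfg x₀ (ω (j + 1)) := by
    intro j hj
    -- The policy of episode `j` was computed at an earlier episode `i` with the same datasets, so
    -- the bonuses are current although the fits are those of episode `i`.
    obtain ⟨i, hij, hpol, hsub⟩ := hω.policy_eq hj
    have h1 := R.regret_plan_le hpos (past := (ω i).past) hsub (fun h hh z => by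
      refine R.abs_sub_le_bonus (R.planFit_mem _ _ h)
        (R.backup_mem hh (R.planV_mem_Icc _ _ (h := h + 1) hh)) ?_ z
      have h2 := (hacc h hh i (by omega) _ (R.planFit_mem (ω i).past (ω (i + 1)).sub h) _
        (R.backup_mem hh (R.planV_mem_Icc (ω i).past (ω (i + 1)).sub (h := h + 1) hh))).1
      rw [hω.past_tail (by omega)] at h2
      exact h2 (hfit i (by omega) h hh)) M.s₁
    simp only [meanClipped, hω.past_succ hj]
    rw [hpol]
    exact h1
  have hX : ∑ j ∈ Finset.range k, sumClipped H cfg x₀ (ω (j + 1)) ≤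
      H * (1600 * (eluderDim cfg.F (1 / cfg.T)).toNat * cfg.β / x₀
        + 4 * (eluderDim cfg.F (1 / cfg.T)).toNat * H) := by
    have e1 : ∀ j ∈ Finset.range k, sumClipped H cfg x₀ (ω (j + 1)) = ∑ h ∈ Finset.range H,
        clippedBonus H cfg x₀ ((ω (j + 1)).sub h) ((ep M cfg ω j).pair h) := fun j hj => by
      rw [sumClipped, hω.past_succ (Finset.mem_range.1 hj)]
    rw [Finset.sum_congr rfl e1, Finset.sum_comm]
    refine (Finset.sum_le_card_nsmul _ _ _ fun h hh =>
      R.sum_clippedBonus_le hω hfin hgap hgapH (hacc h (Finset.mem_range.1 hh))).trans ?_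
    rw [Finset.card_range, nsmul_eq_mul]
  rw [← Finset.sum_div, div_le_iff₀ (by positivity), Finset.sum_sub_distrib,
    ← Finset.sum_div] at hx
  rw [hω.regret_eq le_rfl]
  have h3 : ∑ i ∈ Finset.range k, (optV M 0 M.s₁ - valueV M (ep M cfg ω i).policy 0 M.s₁)
      ≤ 2 * ∑ j ∈ Finset.range k, meanClipped M cfg x₀ (ω (j + 1)) := by
    rw [Finset.mul_sum]
    exact Finset.sum_le_sum fun j hj => hep j (Finset.mem_range.1 hj)
  linarith

end Regime

end Regret

/-! ### Deterministic value family, union bound and the good event -/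

section Union

variable {S : Type u} {A : Type v} {H : ℕ}

theorem outerMeasure_exists_le {Ω ι : Type*} (μ : MeasureTheory.OuterMeasure Ω) (s : Finset ι)
    (E : ι → Set Ω) {c : ℝ} (h : ∀ i ∈ s, μ (E i) ≤ ENNReal.ofReal c) :
    μ {ω | ∃ i ∈ s, ω ∈ E i} ≤ ENNReal.ofReal (s.card * c) := by
  have e : {ω | ∃ i ∈ s, ω ∈ E i} = ⋃ i ∈ s, E i := by ext ω; simp
  rw [e]
  refine (MeasureTheory.measure_biUnion_finset_le s E).trans ?_
  refine (Finset.sum_le_card_nsmul _ _ _ h).trans_eq ?_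
  rw [nsmul_eq_mul, ENNReal.ofReal_mul (Nat.cast_nonneg _), ENNReal.ofReal_natCast]

variable {M : EpisodicMDP S A H} {cfg : Config S A}

/-- The candidates for the regression targets: the zero function, and the state values of the
estimates built from a function of a cover and a reachable dataset. -/
noncomputable def valueCover (H : ℕ) (cfg : Config S A) (C : Finset (S × A → ℝ))
    (D : Finset (Multiset (S × A))) : Finset (S → ℝ) := by
  classical exact insert (fun _ => 0) ((C ×ˢ D).image fun p => valueOf H cfg p.2 p.1)

theorem card_valueCover_le (C : Finset (S × A → ℝ)) (D : Finset (Multiset (S × A))) :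
    (valueCover H cfg C D).card ≤ C.card * D.card + 1 := by
  classical
  refine (Finset.card_insert_le _ _).trans ?_
  gcongr
  exact Finset.card_image_le.trans_eq (Finset.card_product _ _)

namespace Regime

theorem valueCover_mem_Icc (R : Regime M cfg) {C : Finset (S × A → ℝ)}
    (hC : (C : Set (S × A → ℝ)) ⊆ cfg.F) (D : Finset (Multiset (S × A))) {V : S → ℝ}
    (hV : V ∈ valueCover H cfg C D) (s : S) : V s ∈ Set.Icc (0 : ℝ) H := by
  classical
  rw [valueCover, Finset.mem_insert, Finset.mem_image] at hV
  rcases hV with rfl | ⟨p, hp, rfl⟩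
  · exact ⟨le_rfl, Nat.cast_nonneg H⟩
  · exact R.valueOf_mem_Icc _ (hC (Finset.mem_product.1 hp).1) s

/-- The next-step value is zero at the horizon; before it, it is determined by one fit and one
dataset, and only the fit needs approximation. -/
theorem exists_valueCover (R : Regime M cfg) {C : Finset (S × A → ℝ)}
    (hCF : (C : Set (S × A → ℝ)) ⊆ cfg.F) {ε : ℝ} (hε : 0 ≤ ε)
    (hC : ∀ f ∈ cfg.F, ∃ g ∈ C, ∀ x, |f x - g x| ≤ ε) {D : Finset (Multiset (S × A))}
    (past : List (Episode S A)) {W : ℕ → Multiset (S × A)} {h : ℕ} (hh : h < H)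
    (hW : ∀ h < H, W h ∈ D) :
    ∃ V ∈ valueCover H cfg C D, ∀ s, |planV M cfg past W (h + 1) s - V s| ≤ ε := by
  classical
  rcases Nat.lt_or_ge (h + 1) H with h1 | h1
  · obtain ⟨g, hg, hfg⟩ := hC _ (R.planFit_mem past W (h + 1))
    refine ⟨valueOf H cfg (W (h + 1)) g, ?_, fun s => ?_⟩
    · exact Finset.mem_insert_of_mem (Finset.mem_image.2
        ⟨(g, W (h + 1)), Finset.mem_product.2 ⟨hg, hW _ h1⟩, rfl⟩)
    · rw [planV_eq past W h1]
      exact R.abs_valueOf_sub_le _ (R.planFit_mem past W (h + 1)) (hCF hg) hε hfg s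
  · obtain rfl : h + 1 = H := by omega
    refine ⟨fun _ => 0, Finset.mem_insert_self _ _, fun s => ?_⟩
    rw [planV_horizon, sub_zero, abs_zero]
    exact hε

/-- The failure probability is split into eight parts, six of which are used: oversized datasets,
the two ratio bounds, too many changes, the regression noise, and the clipped bonuses. -/
theorem prob_bad_le (R : Regime M cfg) {K : ℕ} (hK : 1 ≤ K) (hT : cfg.T = (K : ℝ) * H)
    {C₁ : Finset (S × A → ℝ)} (hC₁F : (C₁ : Set (S × A → ℝ)) ⊆ cfg.F)
    (hC₁card : 32 * cfg.T ^ 2 * (C₁.card : ℝ) ^ 2 ≤ cfg.δ * 2 ^ ⌊7 * cfg.logFactor⌋₊)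
    {C : Finset (S × A → ℝ)} (hCF : (C : Set (S × A → ℝ)) ⊆ cfg.F)
    (D : Finset (Multiset (S × A))) {x : ℝ}
    (hx : 8 * (H * (K + 1)) * ((C.card * D.card + 1) * C.card) ≤ cfg.δ * Real.exp x) (x₀ : ℝ) :
    (hist M cfg K).toOuterMeasure
      {ω | (∃ h ∈ Finset.range H, ¬ (Multiset.card ((ω K).sub h) : ℝ) ≤ cfg.T ^ 3 / cfg.δ) ∨
        (∃ p ∈ (Finset.range H ×ˢ Finset.range (K + 1)) ×ˢ (C₁ ×ˢ C₁),
          (Multiset.card ((ω p.1.2).sub p.1.1) : ℝ) ≤ cfg.T ^ 3 / cfg.δ ∧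
          6 * (roundedSum cfg p.2.1 p.2.2 p.1.1 (ω p.1.2) + cfg.β / 16)
            ≤ reducedSum cfg p.2.1 p.2.2 ((ω p.1.2).sub p.1.1) + cfg.β / 16) ∨
        (∃ p ∈ (Finset.range H ×ˢ Finset.range (K + 1)) ×ˢ (C₁ ×ˢ C₁),
          (Multiset.card ((ω p.1.2).sub p.1.1) : ℝ) ≤ cfg.T ^ 3 / cfg.δ ∧
          12 * (reducedSum cfg p.2.1 p.2.2 ((ω p.1.2).sub p.1.1) + cfg.β / 16)
            ≤ roundedSum cfg p.2.1 p.2.2 p.1.1 (ω p.1.2) + cfg.β / 16) ∨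
        (∃ h ∈ Finset.range H, (∀ j < K, SubAccurate H cfg h (ω j)) ∧
          Real.log (8 * H / cfg.δ) ≤ ∑ j ∈ Finset.range K,
            (changeInd ((ω j).sub h) ((ω (j + 1)).sub h)
              - 172032 * cfg.logFactor * stepSens cfg h (ω j))) ∨
        (∃ p ∈ (Finset.range H ×ˢ Finset.range (K + 1)) ×ˢ (valueCover H cfg C D ×ˢ C),
          x ≤ ((ω p.1.2).past.map (regTerm M p.1.1 p.2.1 p.2.2)).sum) ∨
        Real.log (8 / cfg.δ) ≤ ∑ j ∈ Finset.range K,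
          (meanClipped M cfg x₀ (ω (j + 1)) / 2 - sumClipped H cfg x₀ (ω (j + 1))) / (H : ℝ) ^ 2}
      ≤ ENNReal.ofReal cfg.δ := by
  have hδ := R.δ_pos
  have hTpos := R.T_pos
  have hTge := R.le_T
  have hH := R.H_pos
  have hKr : (1 : ℝ) ≤ K := by exact_mod_cast hK
  set μ := (hist M cfg K).toOuterMeasure
  -- One factor $K+1$ counts the times in the union bound, the other comes from the accumulated
  -- drift.
  have hHK : (H : ℝ) * (K + 1) * (K + 1) ≤ 4 * cfg.T ^ 2 := by
    rw [hT]
    calc (H : ℝ) * (K + 1) * (K + 1) ≤ H * (2 * K) * (2 * K) * H := by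
          have : (K : ℝ) + 1 ≤ 2 * K := by linarith
          calc (H : ℝ) * (K + 1) * (K + 1) ≤ H * (2 * K) * (2 * K) := by gcongr
            _ ≤ H * (2 * K) * (2 * K) * H := le_mul_of_one_le_right (by positivity) hH
      _ = _ := by ring
  have b1 : μ {ω | ∃ h ∈ Finset.range H,
      ¬ (Multiset.card ((ω K).sub h) : ℝ) ≤ cfg.T ^ 3 / cfg.δ} ≤ ENNReal.ofReal (cfg.δ / 8) := by
    refine (outerMeasure_exists_le μ (Finset.range H) _ fun h hh =>
      prob_card_sub_gt M cfg (Finset.mem_range.1 hh) K (by positivity)).trans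
        (ENNReal.ofReal_le_ofReal ?_)
    rw [Finset.card_range]
    calc (H : ℝ) * (K / (cfg.T ^ 3 / cfg.δ)) = cfg.δ / cfg.T ^ 2 := by
          have : (H : ℝ) * K = cfg.T := by rw [hT]; ring
          rw [← mul_div_assoc, this]; field_simp
      _ ≤ cfg.δ / 8 := by gcongr; nlinarith
  have hcount : (((Finset.range H ×ˢ Finset.range (K + 1)) ×ˢ (C₁ ×ˢ C₁)).card : ℝ) *
      ((K + 1) / 2 ^ ⌊7 * cfg.logFactor⌋₊) ≤ cfg.δ / 8 := by
    rw [Finset.card_product, Finset.card_product, Finset.card_product, Finset.card_range,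
      Finset.card_range]
    push_cast
    rw [← mul_div_assoc, div_le_iff₀ (by positivity)]
    calc (H : ℝ) * (K + 1) * (C₁.card * C₁.card) * (K + 1)
        = H * (K + 1) * (K + 1) * (C₁.card : ℝ) ^ 2 := by ring
      _ ≤ 4 * cfg.T ^ 2 * (C₁.card : ℝ) ^ 2 := by gcongr
      _ ≤ _ := by linarith
  have hj : ∀ j ∈ Finset.range (K + 1),
      ENNReal.ofReal (((j : ℕ) + 1) / 2 ^ ⌊7 * cfg.logFactor⌋₊)
        ≤ ENNReal.ofReal ((K + 1) / 2 ^ ⌊7 * cfg.logFactor⌋₊) := fun j hj => by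
    refine ENNReal.ofReal_le_ofReal ?_
    have : (j : ℝ) ≤ K := by exact_mod_cast Nat.lt_succ_iff.1 (Finset.mem_range.1 hj)
    gcongr
  have b2 := (outerMeasure_exists_le μ ((Finset.range H ×ˢ Finset.range (K + 1)) ×ˢ (C₁ ×ˢ C₁))
    (fun p => {ω | (Multiset.card ((ω p.1.2).sub p.1.1) : ℝ) ≤ cfg.T ^ 3 / cfg.δ ∧
          6 * (roundedSum cfg p.2.1 p.2.2 p.1.1 (ω p.1.2) + cfg.β / 16)
            ≤ reducedSum cfg p.2.1 p.2.2 ((ω p.1.2).sub p.1.1) + cfg.β / 16}) fun p hp => by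
      simp only [Finset.mem_product] at hp
      exact ((R.prob_ratio_ge (Finset.mem_range.1 hp.1.1) (hC₁F hp.2.1) (hC₁F hp.2.2)
        (Nat.lt_succ_iff.1 (Finset.mem_range.1 hp.1.2))).1).trans (hj _ hp.1.2)).trans
        (ENNReal.ofReal_le_ofReal hcount)
  have b3 := (outerMeasure_exists_le μ ((Finset.range H ×ˢ Finset.range (K + 1)) ×ˢ (C₁ ×ˢ C₁))
    (fun p => {ω | (Multiset.card ((ω p.1.2).sub p.1.1) : ℝ) ≤ cfg.T ^ 3 / cfg.δ ∧
          12 * (reducedSum cfg p.2.1 p.2.2 ((ω p.1.2).sub p.1.1) + cfg.β / 16)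
            ≤ roundedSum cfg p.2.1 p.2.2 p.1.1 (ω p.1.2) + cfg.β / 16}) fun p hp => by
      simp only [Finset.mem_product] at hp
      exact ((R.prob_ratio_ge (Finset.mem_range.1 hp.1.1) (hC₁F hp.2.1) (hC₁F hp.2.2)
        (Nat.lt_succ_iff.1 (Finset.mem_range.1 hp.1.2))).2).trans (hj _ hp.1.2)).trans
        (ENNReal.ofReal_le_ofReal hcount)
  have b4 := (outerMeasure_exists_le μ (Finset.range H)
    (fun h => {ω | (∀ j < K, SubAccurate H cfg h (ω j)) ∧
          Real.log (8 * H / cfg.δ) ≤ ∑ j ∈ Finset.range K,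
            (changeInd ((ω j).sub h) ((ω (j + 1)).sub h)
              - 172032 * cfg.logFactor * stepSens cfg h (ω j))}) fun h hh =>
      R.prob_changes_ge (Finset.mem_range.1 hh) K _).trans_eq
        (show _ = ENNReal.ofReal (cfg.δ / 8) by
          rw [Real.exp_neg, Real.exp_log (by positivity), Finset.card_range]
          congr 1
          have : (H : ℝ) ≠ 0 := by positivity
          field_simp)
  have b5 := (outerMeasure_exists_le μ
    ((Finset.range H ×ˢ Finset.range (K + 1)) ×ˢ (valueCover H cfg C D ×ˢ C))
    (fun p => {ω | x ≤ ((ω p.1.2).past.map (regTerm M p.1.1 p.2.1 p.2.2)).sum}) fun p hp => by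
      simp only [Finset.mem_product] at hp
      exact R.prob_regTerm_ge (Finset.mem_range.1 hp.1.1) (R.valueCover_mem_Icc hCF D hp.2.1)
        (hCF hp.2.2) (Nat.lt_succ_iff.1 (Finset.mem_range.1 hp.1.2)) x).trans
        (show _ ≤ ENNReal.ofReal (cfg.δ / 8) by
          refine ENNReal.ofReal_le_ofReal ?_
          rw [Finset.card_product, Finset.card_product, Finset.card_product, Finset.card_range,
            Finset.card_range]
          have h1 : ((valueCover H cfg C D).card : ℝ) ≤ C.card * D.card + 1 := by
            exact_mod_cast card_valueCover_le C D
          push_cast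
          rw [Real.exp_neg, ← div_eq_mul_inv, div_le_iff₀ (Real.exp_pos x)]
          have h2 : (H : ℝ) * (K + 1) * ((valueCover H cfg C D).card * C.card)
              ≤ H * (K + 1) * ((C.card * D.card + 1) * C.card) := by gcongr
          linarith)
  have b6 := (R.prob_meanClipped_ge x₀ K (Real.log (8 / cfg.δ))).trans_eq
    (show _ = ENNReal.ofReal (cfg.δ / 8) by
      rw [Real.exp_neg, Real.exp_log (by positivity)]
      congr 1
      field_simp)
  have hfin : ENNReal.ofReal (cfg.δ / 8) + (ENNReal.ofReal (cfg.δ / 8) +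
      (ENNReal.ofReal (cfg.δ / 8) + (ENNReal.ofReal (cfg.δ / 8) +
      (ENNReal.ofReal (cfg.δ / 8) + ENNReal.ofReal (cfg.δ / 8))))) ≤ ENNReal.ofReal cfg.δ := by
    rw [← ENNReal.ofReal_add, ← ENNReal.ofReal_add, ← ENNReal.ofReal_add, ← ENNReal.ofReal_add,
      ← ENNReal.ofReal_add]
    · exact ENNReal.ofReal_le_ofReal (by linarith)
    all_goals positivity
  refine le_trans ?_ hfin
  refine (MeasureTheory.measure_union_le _ _).trans (add_le_add b1 ?_)
  refine (MeasureTheory.measure_union_le _ _).trans (add_le_add b2 ?_)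
  refine (MeasureTheory.measure_union_le _ _).trans (add_le_add b3 ?_)
  refine (MeasureTheory.measure_union_le _ _).trans (add_le_add b4 ?_)
  exact (MeasureTheory.measure_union_le _ _).trans (add_le_add b5 b6)

/-- The regret bound and the bound on the number of switches, for given covers. -/
theorem prob_good (R : Regime M cfg) {K : ℕ} (hK : 1 ≤ K) (hT : cfg.T = (K : ℝ) * H)
    (hpos : 0 < gapMin M) (hfin : eluderDim cfg.F (1 / cfg.T) ≠ ⊤)
    {C₁ : Finset (S × A → ℝ)} (hC₁F : (C₁ : Set (S × A → ℝ)) ⊆ cfg.F)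
    (hC₁ : ∀ f ∈ cfg.F, ∃ g ∈ C₁, ∀ x, |f x - g x| ≤ Real.sqrt (cfg.δ / (64 * cfg.T ^ 3)))
    (hC₁card : 32 * cfg.T ^ 2 * (C₁.card : ℝ) ^ 2 ≤ cfg.δ * 2 ^ ⌊7 * cfg.logFactor⌋₊)
    {C : Finset (S × A → ℝ)} (hCF : (C : Set (S × A → ℝ)) ⊆ cfg.F) {ε : ℝ} (hε : 0 ≤ ε)
    (hC : ∀ f ∈ cfg.F, ∃ g ∈ C, ∀ x, |f x - g x| ≤ ε)
    {Cr : Finset (S × A)} (hCr : ∀ x, cfg.rnd x ∈ Cr) {B : ℝ}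
    (hB : 172032 * cfg.logFactor * (1 + 1500 * (eluderDim cfg.F (1 / cfg.T)).toNat *
      Real.log cfg.T ^ 2) + Real.log (8 * H / cfg.δ) ≤ B) {x : ℝ} (hx0 : 0 ≤ x)
    (hx : 8 * (H * (K + 1)) * ((C.card * ((Cr.card * (⌊cfg.T ^ 3 / cfg.δ⌋₊ + 1)) ^ ⌊B⌋₊ : ℕ) + 1)
      * C.card) ≤ cfg.δ * Real.exp x)
    (hβ : 43 * (H : ℝ) ^ 2 * x + (16 * H * ε + 2 * ε ^ 2) * cfg.T ≤ cfg.β / 480) :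
    (runLaw M cfg K).toOuterMeasure {st | ¬ ((2 / cfg.T ≤ gapMin M / (2 * H) → regret M st.past ≤
        4 * (H * (1600 * (eluderDim cfg.F (1 / cfg.T)).toNat * cfg.β /
          (gapMin M / (2 * H)) + 4 * (eluderDim cfg.F (1 / cfg.T)).toNat * H))
          + 4 * H ^ 2 * Real.log (8 / cfg.δ)) ∧
        (switches H st.past : ℝ) ≤ H * B)} ≤ ENNReal.ofReal cfg.δ := by
  have hδ := R.δ_pos
  have hTpos := R.T_pos
  have hH := R.H_pos
  have hKr : (1 : ℝ) ≤ K := by exact_mod_cast hK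
  have hKT : (K : ℝ) ≤ cfg.T := by rw [hT]; exact le_mul_of_one_le_right (by linarith) hH
  have hHT : (H : ℝ) ≤ cfg.T := by rw [hT]; exact le_mul_of_one_le_left (by linarith) hKr
  have hgapH : gapMin M / (2 * H) < H := by
    have := gapMin_le M (plan M cfg [] fun _ => 0) hpos
    rw [div_lt_iff₀ (by linarith)]
    nlinarith
  rw [← hist_map, PMF.toOuterMeasure_map_apply]
  -- A deterministic family containing all datasets that occur on the good event; this makes a union
  -- bound possible although the targets depend on the data.
  set D := reachable Cr ⌊cfg.T ^ 3 / cfg.δ⌋₊ ⌊B⌋₊ with hD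
  refine le_trans (PMF.toOuterMeasure_mono _ ?_) (R.prob_bad_le hK hT hC₁F hC₁card hCF D (x := x)
    (le_trans ?_ hx) (gapMin M / (2 * H)))
  swap
  · have : (D.card : ℝ) ≤ ((Cr.card * (⌊cfg.T ^ 3 / cfg.δ⌋₊ + 1)) ^ ⌊B⌋₊ : ℕ) := by
      exact_mod_cast card_reachable_le Cr _ _
    gcongr
  rintro ω ⟨hbad, hsupp⟩
  have hω := isPath_of_mem_support M cfg K ω hsupp
  by_contra hcon
  simp only [Set.mem_ofPred_eq, not_or, not_exists, not_and, not_le, not_lt] at hcon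
  obtain ⟨c1, c2, c3, c4, c5, c6⟩ := hcon
  refine hbad ?_
  have hcard : ∀ h < H, ∀ j ≤ K, (Multiset.card ((ω j).sub h) : ℝ) ≤ cfg.T ^ 3 / cfg.δ :=
    fun h hh j hj => by
      refine le_trans ?_ (c1 h (Finset.mem_range.2 hh))
      exact_mod_cast Multiset.card_le_card (hω.sub_mono hj le_rfl h)
  have hacc : ∀ h < H, ∀ j ≤ K, SubAccurate H cfg h (ω j) := fun h hh j hj => by
    refine R.subAccurate_of_cover hC₁F hC₁ ?_ (hcard h hh j hj) (fun f hf g hg => ?_)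
      (fun f hf g hg => ?_)
    · rw [hω.past_length hj]
      refine le_trans ?_ hKT
      exact_mod_cast hj
    · exact (c2 ((h, j), (f, g)) (by simp [hh, hf, hg]; omega) (hcard h hh j hj)).le
    · exact (c3 ((h, j), (f, g)) (by simp [hh, hf, hg]; omega) (hcard h hh j hj)).le
  have hL := R.one_le_logFactor
  have hchg : ∀ h < H, (numChanges ω h K : ℝ) ≤ B := fun h hh => by
    have h1 := c4 h (Finset.mem_range.2 hh) fun j hj => hacc h hh j hj.le
    rw [Finset.sum_sub_distrib, ← numChanges_eq_sum, ← Finset.mul_sum] at h1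
    have h2 := R.sum_stepSens_le hω hKT hHT hfin h
    have h3 := mul_le_mul_of_nonneg_left h2
      (show 0 ≤ 172032 * cfg.logFactor by positivity)
    linarith
  have hCrne : Cr.Nonempty := ⟨_, hCr (M.s₁, plan M cfg [] (fun _ => 0) 0 M.s₁)⟩
  have hreach : ∀ h < H, ∀ j ≤ K, (ω j).sub h ∈ D := fun h hh j hj => by
    have h1 := hω.sub_mem_reachable hCr (Nat.le_floor (hcard h hh K le_rfl)) hj
    refine reachable_mono hCrne (Nat.le_floor ?_) h1
    refine le_trans ?_ (hchg h hh)
    exact_mod_cast numChanges_mono ω h hj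
  constructor
  · intro hgap
    refine R.regret_le hpos hω hfin hgap hgapH (fun h hh j hj => hacc h hh (j + 1) hj)
      (fun j hj h hh => ?_) c6.le
    -- The true target and fit are random; the noise is controlled only at their deterministic
    -- approximations.
    obtain ⟨V', hV', hVV⟩ := R.exists_valueCover hCF hε hC (ω j).past hh
      (W := (ω (j + 1)).sub) fun h' hh' => hreach h' hh' (j + 1) hj
    obtain ⟨f', hf', hff⟩ := hC _ (R.planFit_mem (ω j).past (ω (j + 1)).sub h)
    have h1 := c5 ((h, j), (V', f')) (by simp [hh, hV', hf']; omega)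
    refine (R.sqNorm_lsq_sub_backup_le hh (R.planV_mem_Icc _ _ (h := h + 1) hh)
      (R.valueCover_mem_Icc hCF D hV') hε hVV (ω j).past rfl hff hx0 h1.le).trans
      (le_trans ?_ hβ)
    rw [hω.past_length hj.le]
    have : (j : ℝ) ≤ cfg.T := le_trans (by exact_mod_cast hj.le) hKT
    gcongr
  · have h1 := hω.switches_le_numChanges
    calc (switches H (ω K).past : ℝ) ≤ ((∑ h ∈ Finset.range H, numChanges ω h K : ℕ) : ℝ) := by
          exact_mod_cast h1
      _ = ∑ h ∈ Finset.range H, (numChanges ω h K : ℝ) := by push_cast; rfl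
      _ ≤ (Finset.range H).card • B :=
          Finset.sum_le_card_nsmul _ _ _ fun h hh => hchg h (Finset.mem_range.1 hh)
      _ = H * B := by rw [Finset.card_range, nsmul_eq_mul]

end Regime

end Union

/-! ### Trivial bounds and nondegeneracy of the complexities -/

section Conclusion

variable {S : Type u} {A : Type v} {H : ℕ}

/-- Backups of the constants `H` and `0` differ by `H` everywhere. This keeps the eluder dimension
and the covering numbers away from their degenerate values. -/
theorem BellmanClosed.exists_sub_eq {M : EpisodicMDP S A H} {F : Set (S × A → ℝ)}
    (hB : BellmanClosed M F) (hH : 1 ≤ H) :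
    ∃ f ∈ F, ∃ g ∈ F, ∀ z, f z - g z = (H : ℝ) := by
  obtain ⟨f, hf, h1⟩ := hB 0 hH (fun _ => (H : ℝ)) fun _ => ⟨Nat.cast_nonneg H, le_rfl⟩
  obtain ⟨g, hg, h2⟩ := hB 0 hH (fun _ => 0) fun _ => ⟨le_rfl, Nat.cast_nonneg H⟩
  refine ⟨f, hf, g, hg, fun ⟨s, a⟩ => ?_⟩
  rw [h1, h2, expect_const, expect_const]
  ring

theorem BellmanClosed.one_le_eluderDim {M : EpisodicMDP S A H} {F : Set (S × A → ℝ)}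
    (hB : BellmanClosed M F) (hH : 1 ≤ H) (z : S × A) {T : ℝ} (hT : 2 ≤ T)
    (hfin : eluderDim F (1 / T) ≠ ⊤) : (1 : ℝ) ≤ (eluderDim F (1 / T)).toNat := by
  obtain ⟨f, hf, g, hg, hfg⟩ := hB.exists_sub_eq hH
  have hHr : (1 : ℝ) ≤ H := by exact_mod_cast hH
  have h1 : IndepSeq F (1 / T) [z] := by
    refine ⟨fun hdep => ?_, trivial⟩
    have := hdep f hf g hg (by
      rw [Multiset.coe_nil, sqNorm_zero, Real.sqrt_zero]; positivity)
    rw [hfg, abs_of_nonneg (by linarith), le_div_iff₀ (by linarith)] at this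
    nlinarith
  have h2 := h1.length_le le_rfl
  rw [← ENat.natCast_toNat hfin] at h2
  exact_mod_cast h2

/-- Two functions at distance $H\ge1>2\varepsilon$ cannot share a centre. A cover size of at least
two makes the logarithms in $\beta$ bounded below. -/
theorem BellmanClosed.two_le_card_cover {M : EpisodicMDP S A H} {F : Set (S × A → ℝ)}
    (hB : BellmanClosed M F) (hH : 1 ≤ H) (z : S × A) {ε : ℝ} (hε : ε < 1 / 2)
    {C : Finset (S × A → ℝ)} (hC : ∀ f ∈ F, ∃ g ∈ C, ∀ x, |f x - g x| ≤ ε) :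
    2 ≤ C.card := by
  obtain ⟨f, hf, g, hg, hfg⟩ := hB.exists_sub_eq hH
  have hHr : (1 : ℝ) ≤ H := by exact_mod_cast hH
  obtain ⟨f', hf', h1⟩ := hC f hf
  obtain ⟨g', hg', h2⟩ := hC g hg
  by_contra hcon
  obtain rfl := Finset.card_le_one.1 (by omega : C.card ≤ 1) f' hf' g' hg'
  have h3 := abs_le.1 (h1 z)
  have h4 := abs_le.1 (h2 z)
  have h5 := hfg z
  linarith [h3.1, h3.2, h4.1, h4.2]

theorem regret_le_length (M : EpisodicMDP S A H) (l : List (Episode S A)) :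
    regret M l ≤ l.length * H := by
  induction l with
  | nil => simp [regret]
  | cons e l ih =>
    have h1 := optV_mem_Icc M e.policy (Nat.zero_le H) M.s₁
    have h2 := valueV_mem_Icc M e.policy (Nat.zero_le H) M.s₁
    simp only [regret, List.map_cons, List.sum_cons, List.length_cons] at ih ⊢
    push_cast
    linarith [h1.2, h2.1]

theorem switches_le_length (H : ℕ) : ∀ l : List (Episode S A), switches H l ≤ l.length - 1
  | [] => le_rfl
  | [_] => le_rfl
  | e :: e' :: l => by
    have := switches_le_length H (e' :: l)
    rw [switches]
    simp only [List.length_cons] at this ⊢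
    split_ifs <;> omega

theorem past_length_of_mem_support {M : EpisodicMDP S A H} {cfg : Config S A} {K : ℕ}
    {st : LearnerState S A} (hst : st ∈ (runLaw M cfg K).support) : st.past.length = K := by
  rw [← hist_map, PMF.mem_support_map_iff] at hst
  obtain ⟨ω, hω, rfl⟩ := hst
  exact (isPath_of_mem_support M cfg K ω hω).past_length le_rfl

theorem le_toReal_prob_of_bad {Ω : Type*} (p : PMF Ω) {s t : Set Ω} {δ : ℝ} (hδ : 0 ≤ δ)
    (ht : p.toOuterMeasure t ≤ ENNReal.ofReal δ) (hst : ∀ ω ∈ p.support, ω ∉ t → ω ∈ s) :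
    1 - δ ≤ (p.toOuterMeasure s).toReal := by
  have h1 : (1 : ℝ≥0∞) ≤ p.toOuterMeasure s + ENNReal.ofReal δ := by
    have h2 : p.toOuterMeasure (s ∪ t) = 1 :=
      (PMF.toOuterMeasure_apply_eq_one_iff p _).2 fun ω hω => by
        by_cases h : ω ∈ t
        · exact Or.inr h
        · exact Or.inl (hst ω hω h)
    rw [← h2]
    exact (MeasureTheory.measure_union_le s t).trans (by gcongr)
  have hle : p.toOuterMeasure s ≤ 1 := by
    rw [← (PMF.toOuterMeasure_apply_eq_one_iff p Set.univ).2 (Set.subset_univ _)]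
    exact MeasureTheory.measure_mono (Set.subset_univ _)
  have h3 := ENNReal.toReal_mono (by simp [hle.trans_lt ENNReal.one_lt_top |>.ne]) h1
  rw [ENNReal.toReal_add (hle.trans_lt ENNReal.one_lt_top).ne ENNReal.ofReal_ne_top,
    ENNReal.toReal_ofReal hδ, ENNReal.toReal_one] at h3
  linarith

theorem two_thirds_le_log {x : ℝ} (hx : 2 ≤ x) : 2 / 3 ≤ Real.log x := by
  have h1 := Real.log_le_log (by norm_num) hx
  have h2 := Real.log_two_gt_d9
  linarith

/-- A lower bound for the main term of the regret bound. -/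
theorem div_le_main_term {d a b Hr l g : ℝ} (hd : 1 ≤ d) (ha : 2 / 3 ≤ a) (hb : 2 / 3 ≤ b)
    (hH : 1 ≤ Hr) (hl : 2 / 3 ≤ l) (hg : 0 < g) :
    Hr / g ≤ 12 * (d ^ 2 * a * b * Hr ^ 5 * l ^ 4 / g) := by
  rw [← mul_div_assoc]
  gcongr
  have h1 : (2 / 3) * (2 / 3) * (2 / 3) ^ 4 ≤ a * b * l ^ 4 := by gcongr
  have h2 : Hr * 1 ≤ Hr ^ 5 * d ^ 2 := by
    have e1 : (1 : ℝ) ≤ d ^ 2 := one_le_pow₀ hd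
    have e2 : Hr ≤ Hr ^ 5 := le_self_pow₀ hH (by norm_num)
    gcongr
  calc Hr ≤ 12 * ((Hr * 1) * ((2 / 3) * (2 / 3) * (2 / 3) ^ 4)) := by nlinarith
    _ ≤ 12 * ((Hr ^ 5 * d ^ 2) * (a * b * l ^ 4)) := by gcongr
    _ = _ := by ring

end Conclusion

/-! ### Comparison of accuracies and constants -/

section Numerics

/-- The constant of the bound on the number of points added to a sub-sampled dataset. -/
abbrev sampleConst : ℝ := 260000000

/-- The constant of `β`. -/
abbrev betaConst : ℝ := 520000 * sampleConst

variable {T δ N N₁ P d : ℝ}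

/-- Together with antitonicity of the cover bound, this controls the cover in the sampling
probability by the one in $\beta$. -/
theorem div_sq_le_sqrt (hT : 16384 ≤ T) (hδ : 0 < δ) (hδ1 : δ < 1) :
    δ / T ^ 2 ≤ Real.sqrt (δ / (64 * T ^ 3)) := by
  apply Real.le_sqrt_of_sq_le
  calc (δ / T ^ 2) ^ 2 = δ * (δ / (T ^ 3 * T)) := by field_simp
    _ ≤ 1 * (δ / (T ^ 3 * 64)) := by gcongr; linarith
    _ = _ := by rw [one_mul, mul_comm (64 : ℝ)]

theorem sqrt_div_sq_le_sqrt (hT : 16384 ≤ T) (hδ : 0 < δ) :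
    Real.sqrt δ / T ^ 2 ≤ Real.sqrt (δ / (64 * T ^ 3)) := by
  apply Real.le_sqrt_of_sq_le
  rw [div_pow, Real.sq_sqrt hδ.le]
  gcongr
  calc 64 * T ^ 3 ≤ T * T ^ 3 := by gcongr; linarith
    _ = _ := by ring

/-- The threshold $16384=64\cdot16^2$ for `T` is what this comparison with the rounding accuracy
requires. -/
theorem div_sq_le_inv_sqrt (hT : 16384 ≤ T) (hδ : 0 < δ) (hδ1 : δ < 1) :
    δ / T ^ 2 ≤ 1 / (16 * Real.sqrt (64 * T ^ 3 / δ)) := by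
  have h1 : Real.sqrt (64 * T ^ 3 / δ) ≤ T ^ 2 / (16 * δ) := by
    apply Real.sqrt_le_iff.2 ⟨by positivity, ?_⟩
    rw [div_pow, div_le_div_iff₀ hδ (by positivity)]
    calc 64 * T ^ 3 * (16 * δ) ^ 2 = (T ^ 3 * δ) * (16384 * δ) := by ring
      _ ≤ (T ^ 3 * δ) * (T * 1) := by gcongr
      _ = _ := by ring
  calc δ / T ^ 2 = 1 / (16 * (T ^ 2 / (16 * δ))) := by field_simp
    _ ≤ _ := by gcongr

theorem log_factor_le (hT : 16384 ≤ T) (hδ : 0 < δ) (hδ1 : δ < 1) (hN₁ : 1 ≤ N₁) (hN : 2 ≤ N)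
    (hle : N₁ ≤ N) : Real.log (T * N₁ / δ) ≤ 5 / 2 * (Real.log (N / δ) * Real.log T) := by
  have h1 : Real.log (T * N₁ / δ) ≤ Real.log T + Real.log (N / δ) := by
    rw [← Real.log_mul (by positivity) (by positivity), mul_div_assoc]
    gcongr
  have ha : 2 / 3 ≤ Real.log (N / δ) :=
    two_thirds_le_log (by rw [le_div_iff₀ hδ]; linarith)
  have hl : 1 ≤ Real.log T := by
    rw [Real.le_log_iff_exp_le (by linarith)]
    linarith [Real.exp_one_lt_d9]
  nlinarith

theorem log_eight_div_le (hδ : 0 < δ) (hδ1 : δ < 1) (hN : 2 ≤ N) :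
    Real.log (8 / δ) ≤ 3 * Real.log (N / δ) := by
  have e : 3 * Real.log (N / δ) = Real.log ((N / δ) ^ 3) := by
    rw [Real.log_pow]; norm_num
  rw [e]
  apply Real.log_le_log (by positivity)
  calc 8 / δ = 2 ^ 3 / δ := by norm_num
    _ ≤ 2 ^ 3 / δ ^ 3 := by
      gcongr
      exact pow_le_of_le_one hδ.le hδ1.le (by norm_num)
    _ ≤ _ := by rw [div_pow]; gcongr

theorem one_le_log_factor (hT : 16384 ≤ T) (hδ : 0 < δ) (hδ1 : δ < 1) (hN₁ : 1 ≤ N₁) :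
    1 ≤ Real.log (T * N₁ / δ) := by
  rw [Real.le_log_iff_exp_le (by positivity), le_div_iff₀ hδ]
  have := Real.exp_one_lt_d9
  nlinarith [Real.exp_pos 1]

/-- With $L\ge1$ the floor loses at most $L$, and $\log2\ge2/3$, so $2^{\lfloor7L\rfloor}\ge
e^{4L}=(TN_1/\delta)^4$. This is enough for pairs of cover elements, times, and the division by
$\delta$. -/
theorem card_sq_le_two_pow {n : ℕ} (hT : 16384 ≤ T) (hδ : 0 < δ) (hδ1 : δ < 1) (hN₁ : 1 ≤ N₁)
    (hn : (n : ℝ) ≤ N₁) :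
    32 * T ^ 2 * (n : ℝ) ^ 2 ≤ δ * 2 ^ ⌊7 * Real.log (T * N₁ / δ)⌋₊ := by
  have hL := one_le_log_factor hT hδ hδ1 hN₁
  set L := Real.log (T * N₁ / δ) with hLdef
  have hexp : Real.exp L = T * N₁ / δ := Real.exp_log (by positivity)
  have hfl : 6 * L ≤ (⌊7 * L⌋₊ : ℝ) := by
    have := Nat.lt_floor_add_one (7 * L)
    linarith
  have h2 : Real.exp (4 * L) ≤ 2 ^ ⌊7 * L⌋₊ := by
    rw [← Real.rpow_natCast, Real.rpow_def_of_pos (by norm_num)]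
    refine Real.exp_le_exp.2 ?_
    have h3 : 2 / 3 * (6 * L) ≤ Real.log 2 * ⌊7 * L⌋₊ :=
      mul_le_mul (two_thirds_le_log le_rfl) hfl (by linarith) (Real.log_nonneg (by norm_num))
    linarith
  have h4 : Real.exp (4 * L) = (T * N₁ / δ) ^ 4 := by
    rw [← hexp, ← Real.exp_nat_mul]
    norm_num
  have h5 : T * N₁ ≤ T * N₁ / δ := le_div_self (by positivity) hδ hδ1.le
  have h6 : 1 ≤ T * N₁ := by nlinarith
  calc 32 * T ^ 2 * (n : ℝ) ^ 2 ≤ 32 * T ^ 2 * N₁ ^ 2 := by gcongr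
    _ = 32 * (T * N₁) ^ 2 := by ring
    _ ≤ (T * N₁) ^ 3 := by
      rw [pow_succ (T * N₁) 2, mul_comm]
      gcongr
      nlinarith
    _ = δ * ((T * N₁) ^ 3 / δ) := by field_simp
    _ ≤ δ * (T * N₁ / δ) ^ 4 := by
      gcongr
      calc (T * N₁) ^ 3 / δ ≤ (T * N₁) ^ 3 * (T * N₁ / δ) := by
            rw [mul_div_assoc']
            gcongr
            nlinarith [pow_pos (by linarith : 0 < T * N₁) 3]
        _ ≤ (T * N₁ / δ) ^ 3 * (T * N₁ / δ) := by gcongr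
        _ = _ := by ring
    _ ≤ _ := by
      rw [← h4]
      gcongr

/-- The leading constant is $172032\cdot1500=258048000$; the remaining terms fit under the rounded
value. -/
theorem sample_budget_le {Hr : ℝ} (hT : 16384 ≤ T) (hδ : 0 < δ) (hδ1 : δ < 1) (hN₁ : 1 ≤ N₁)
    (hd : 1 ≤ d) (hH : 1 ≤ Hr) (hHT : Hr ≤ T) :
    172032 * Real.log (T * N₁ / δ) * (1 + 1500 * d * Real.log T ^ 2) + Real.log (8 * Hr / δ) ≤
      sampleConst * Real.log (T * N₁ / δ) * d * Real.log T ^ 2 := by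
  have hL := one_le_log_factor hT hδ hδ1 hN₁
  have hl : 1 ≤ Real.log T := by
    rw [Real.le_log_iff_exp_le (by linarith)]
    linarith [Real.exp_one_lt_d9]
  have h1 : Real.log (8 * Hr / δ) ≤ 2 * Real.log (T * N₁ / δ) := by
    have : 2 * Real.log (T * N₁ / δ) = Real.log ((T * N₁ / δ) ^ 2) := by
      rw [Real.log_pow]; norm_num
    rw [this]
    apply Real.log_le_log (by positivity)
    have h5 : T ≤ T * N₁ / δ := by
      rw [le_div_iff₀ hδ]
      nlinarith
    have h6 : T / δ ≤ T * N₁ / δ := by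
      gcongr
      nlinarith
    calc 8 * Hr / δ ≤ T * T / δ := by
          gcongr
          linarith
      _ = T * (T / δ) := by ring
      _ ≤ (T * N₁ / δ) * (T * N₁ / δ) := by gcongr
      _ = _ := by ring
  set L := Real.log (T * N₁ / δ)
  have h2 : 1 ≤ d * Real.log T ^ 2 := one_le_mul_of_one_le_of_one_le hd (one_le_pow₀ hl)
  have h3 : L ≤ L * (d * Real.log T ^ 2) := le_mul_of_one_le_right (by linarith) h2
  simp only [sampleConst]
  nlinarith

/-- Each of the at most `B` changes offers at most $(P/\delta)T^4$ choices of a point and a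
multiplicity. The other terms of the exponent absorb the two choices from the cover of $\mathcal F$,
the step and the episode. -/
theorem history_card_le {n m K : ℕ} {Hr B : ℝ} (hT : 16384 ≤ T) (hδ : 0 < δ) (hδ1 : δ < 1)
    (hN : 2 ≤ N) (hP : 1 ≤ P) (hB : 0 ≤ B) (hH : 0 ≤ Hr) (hK : 1 ≤ K) (hTK : T = K * Hr)
    (hn : (n : ℝ) ≤ N) (hm : (m : ℝ) ≤ P) :
    8 * (Hr * (K + 1)) * (((n * (m * (⌊T ^ 3 / δ⌋₊ + 1)) ^ ⌊B⌋₊ + 1) * n : ℕ) : ℝ) ≤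
      δ * Real.exp (B * (Real.log (P / δ) + 4 * Real.log T) + 2 * Real.log (N / δ)
        + 2 * Real.log T) := by
  have hK' : (1 : ℝ) ≤ K := by exact_mod_cast hK
  have hPδ : 1 ≤ P / δ := by rw [le_div_iff₀ hδ]; linarith
  have hW : (m : ℝ) * (⌊T ^ 3 / δ⌋₊ + 1) ≤ P / δ * T ^ 4 := by
    have h1 : (⌊T ^ 3 / δ⌋₊ : ℝ) ≤ T ^ 3 / δ := Nat.floor_le (by positivity)
    have h2 : (1 : ℝ) ≤ T ^ 3 / δ := by
      rw [le_div_iff₀ hδ]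
      have : (1 : ℝ) ≤ T ^ 3 := one_le_pow₀ (by linarith)
      linarith
    calc (m : ℝ) * (⌊T ^ 3 / δ⌋₊ + 1) ≤ P * (T ^ 3 / δ + T ^ 3 / δ) := by gcongr
      _ = P / δ * (T ^ 3 * 2) := by ring
      _ ≤ P / δ * (T ^ 3 * T) := by gcongr; linarith
      _ = _ := by ring
  have hWexp : P / δ * T ^ 4 = Real.exp (Real.log (P / δ) + 4 * Real.log T) := by
    have : 4 * Real.log T = Real.log (T ^ 4) := by rw [Real.log_pow]; norm_num
    rw [this, Real.exp_add, Real.exp_log (by positivity), Real.exp_log (by positivity)]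
  have hw0 : 0 ≤ Real.log (P / δ) + 4 * Real.log T := by
    have := Real.log_nonneg hPδ
    have := Real.log_nonneg (by linarith : 1 ≤ T)
    linarith
  set E := Real.exp (B * (Real.log (P / δ) + 4 * Real.log T)) with hE
  have hY : ((m : ℝ) * (⌊T ^ 3 / δ⌋₊ + 1)) ^ ⌊B⌋₊ ≤ E := by
    calc ((m : ℝ) * (⌊T ^ 3 / δ⌋₊ + 1)) ^ ⌊B⌋₊ ≤ (P / δ * T ^ 4) ^ ⌊B⌋₊ := by gcongr
      _ = Real.exp (⌊B⌋₊ * (Real.log (P / δ) + 4 * Real.log T)) := by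
        rw [hWexp, ← Real.exp_nat_mul]
      _ ≤ E := by
        rw [hE]
        gcongr
        exact Nat.floor_le hB
  have hE1 : 1 ≤ E := Real.one_le_exp (mul_nonneg hB hw0)
  have hsplit : Real.exp (B * (Real.log (P / δ) + 4 * Real.log T) + 2 * Real.log (N / δ)
      + 2 * Real.log T) = E * (N / δ) ^ 2 * T ^ 2 := by
    have e1 : 2 * Real.log (N / δ) = Real.log ((N / δ) ^ 2) := by rw [Real.log_pow]; norm_num
    have e2 : 2 * Real.log T = Real.log (T ^ 2) := by rw [Real.log_pow]; norm_num
    rw [e1, e2, Real.exp_add, Real.exp_add, Real.exp_log (by positivity),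
      Real.exp_log (by positivity)]
  rw [hsplit]
  push_cast
  calc 8 * (Hr * (K + 1)) * (((n : ℝ) * ((m : ℝ) * (⌊T ^ 3 / δ⌋₊ + 1)) ^ ⌊B⌋₊ + 1) * n)
      ≤ 8 * (Hr * (K + K)) * ((N * E + N * E) * N) := by
        gcongr
        nlinarith
    _ = 32 * T * (N ^ 2 * E) := by rw [hTK]; ring
    _ ≤ T * T * (N ^ 2 * E) := by gcongr; linarith
    _ = δ * (E * (N ^ 2 / δ) * T ^ 2) := by field_simp
    _ ≤ _ := by
      gcongr
      rw [div_pow]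
      gcongr
      nlinarith

/-- This fixes the size of $\beta$: the leading term has constant
$43\cdot\frac{35}{2}\cdot480=361200$ times `sampleConst`, leaving room for the rest in `betaConst`.
-/
theorem deviation_le_beta {a b l L Hr ε : ℝ} (hT : 16384 ≤ T) (hd : 1 ≤ d) (ha : 2 / 3 ≤ a)
    (hb : 2 / 3 ≤ b) (hl : 1 ≤ l) (hL : L ≤ 5 / 2 * (a * l)) (hH : 1 ≤ Hr)
    (hε0 : 0 < ε) (hε : ε ≤ 1 / T ^ 2) :
    43 * Hr ^ 2 * (sampleConst * L * d * l ^ 2 * (b + 4 * l) + 2 * a + 2 * l)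
      + (16 * Hr * ε + 2 * ε ^ 2) * T ≤ betaConst * (a * d * b) * Hr ^ 2 * l ^ 4 / 480 := by
  have hab : 4 / 9 ≤ a * b := by nlinarith
  have hl4 : l ≤ l ^ 4 := le_self_pow₀ hl (by norm_num)
  have hdl : l ≤ d * l ^ 4 := by nlinarith
  set Q := a * b * (d * l ^ 4) with hQ
  have hQ1 : 4 / 9 ≤ Q := by
    have : 4 / 9 * 1 ≤ Q := by rw [hQ]; gcongr; linarith
    linarith
  have hlQ : l ≤ 9 / 4 * Q := by
    have : 4 / 9 * l ≤ Q := by rw [hQ]; gcongr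
    linarith
  have haQ : a ≤ 3 / 2 * Q := by
    have : a * (2 / 3) * 1 ≤ Q := by rw [hQ]; gcongr; linarith
    linarith
  have hx : L * d * l ^ 2 * (b + 4 * l) ≤ 35 / 2 * Q := by
    have h1 : b + 4 * l ≤ 7 * (b * l) := by nlinarith
    calc L * d * l ^ 2 * (b + 4 * l) ≤ (5 / 2 * (a * l)) * d * l ^ 2 * (7 * (b * l)) := by gcongr
      _ = 35 / 2 * Q := by rw [hQ]; ring
  have hsmall : (16 * Hr * ε + 2 * ε ^ 2) * T ≤ Hr ^ 2 * (9 / 4 * Q) := by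
    have hTpos : 0 < T := by linarith
    have h1 : ε * T ≤ 1 / 16384 := by
      calc ε * T ≤ 1 / T ^ 2 * T := by gcongr
        _ = 1 / T := by field_simp
        _ ≤ _ := by gcongr
    have h2 : ε ≤ 1 := hε.trans (by rw [div_le_one (by positivity)]; nlinarith)
    have h3 : (16 * Hr * ε + 2 * ε ^ 2) * T ≤ Hr := by
      have : ε * (ε * T) ≤ 1 * (1 / 16384) := by gcongr
      nlinarith
    have h4 : Hr * 1 ≤ Hr ^ 2 * (9 / 4 * Q) := by
      have : Hr ≤ Hr ^ 2 := le_self_pow₀ hH (by norm_num)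
      gcongr
      linarith
    linarith
  have h5 : Hr ^ 2 * (sampleConst * L * d * l ^ 2 * (b + 4 * l) + 2 * a + 2 * l) ≤
      Hr ^ 2 * (sampleConst * (35 / 2 * Q) + 3 * Q + 9 / 2 * Q) := by
    have : sampleConst * L * d * l ^ 2 * (b + 4 * l) =
        sampleConst * (L * d * l ^ 2 * (b + 4 * l)) := by ring
    rw [this]
    gcongr ?_ * (?_ + ?_ + ?_)
    · gcongr
    · linarith
    · linarith
  have h6 : betaConst * (a * d * b) * Hr ^ 2 * l ^ 4 = betaConst * (Hr ^ 2 * Q) := by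
    rw [hQ]; ring
  rw [h6]
  have h7 : 0 ≤ Hr ^ 2 * Q := by positivity
  simp only [sampleConst, betaConst] at *
  nlinarith

theorem factor_mul_sq_le_beta {a b l L Hr : ℝ} (hd : 1 ≤ d) (ha : 2 / 3 ≤ a) (hb : 2 / 3 ≤ b)
    (hl : 1 ≤ l) (hL : L ≤ 5 / 2 * (a * l)) (hH : 1 ≤ Hr) :
    448 * L * (Hr + 1) ^ 2 ≤ betaConst * (a * d * b) * Hr ^ 2 * l ^ 4 := by
  have h1 : (Hr + 1) ^ 2 ≤ 4 * Hr ^ 2 := by nlinarith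
  have h2 : a * l * (1 * (2 / 3)) ≤ a * l ^ 4 * (d * b) := by
    have := le_self_pow₀ hl (by norm_num : (4 : ℕ) ≠ 0)
    gcongr
  set q := a * l ^ 4 * (d * b) with hq
  have h0 : 0 ≤ q := by positivity
  calc 448 * L * (Hr + 1) ^ 2 ≤ 448 * (15 / 4 * q) * (4 * Hr ^ 2) := by
        gcongr
        linarith
    _ = 6720 * (q * Hr ^ 2) := by ring
    _ ≤ betaConst * (q * Hr ^ 2) := by gcongr; norm_num [betaConst, sampleConst]
    _ = _ := by rw [hq]; ring

/-- Replacing $1/x_0$ by $2H/\mathrm{gap}_{\min}$ yields the leading constant $4\cdot3200=12800$.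
Terms without the gap are absorbed through $\mathrm{gap}_{\min}\le H$. -/
theorem regret_terms_le {a b l Hr g β y : ℝ} (hd : 1 ≤ d) (ha : 2 / 3 ≤ a)
    (hb : 2 / 3 ≤ b) (hl : 1 ≤ l) (hH : 1 ≤ Hr) (hg : 0 < g) (hgH : g ≤ Hr)
    (hβ : β = betaConst * (a * d * b) * Hr ^ 2 * l ^ 4) (hy : y ≤ 3 * a) :
    4 * (Hr * (1600 * d * β / (g / (2 * Hr)) + 4 * d * Hr)) + 4 * Hr ^ 2 * y ≤
      13000 * betaConst * (d ^ 2 * a * b * Hr ^ 5 * l ^ 4 / g) := by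
  set Q := d ^ 2 * a * b * Hr ^ 5 * l ^ 4 / g with hQ
  have hHp : 0 < Hr := by linarith
  have hlow : d ^ 2 * a * b * Hr ^ 4 * l ^ 4 ≤ Q := by
    rw [hQ, le_div_iff₀ hg]
    calc d ^ 2 * a * b * Hr ^ 4 * l ^ 4 * g ≤ d ^ 2 * a * b * Hr ^ 4 * l ^ 4 * Hr := by gcongr
      _ = _ := by ring
  have hl4 : 1 ≤ l ^ 4 := one_le_pow₀ hl
  have hH4 : Hr ^ 2 ≤ Hr ^ 4 := pow_le_pow_right₀ hH (by norm_num)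
  have hd2 : d ≤ d ^ 2 := le_self_pow₀ hd (by norm_num)
  have h1 : d * Hr ^ 2 ≤ 9 / 4 * Q := by
    have : d * (2 / 3) * (2 / 3) * Hr ^ 2 * 1 ≤ d ^ 2 * a * b * Hr ^ 4 * l ^ 4 := by gcongr
    linarith
  have h2 : a * Hr ^ 2 ≤ 3 / 2 * Q := by
    have : 1 * a * (2 / 3) * Hr ^ 2 * 1 ≤ d ^ 2 * a * b * Hr ^ 4 * l ^ 4 := by
      gcongr
      linarith
    linarith
  have h3 : Hr ^ 2 * y ≤ 9 / 2 * Q := by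
    calc Hr ^ 2 * y ≤ Hr ^ 2 * (3 * a) := by gcongr
      _ = 3 * (a * Hr ^ 2) := by ring
      _ ≤ _ := by linarith
  have h4 : Hr * (1600 * d * β / (g / (2 * Hr))) ≤ 3200 * betaConst * Q := by
    have e : Hr * (1600 * d * β / (g / (2 * Hr))) =
        3200 * betaConst * (d ^ 2 * a * b * Hr ^ 4 * l ^ 4 / g) := by
      rw [hβ]; field_simp; ring
    rw [e, hQ]
    gcongr
    norm_num
  have h0 : 0 ≤ Q := by positivity
  simp only [betaConst, sampleConst] at *
  nlinarith

end Numerics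

/-! ### Assembly of the bounds for all ranges of the horizon -/

section Theorem

variable {S : Type u} {A : Type v} {H K : ℕ} {M : EpisodicMDP S A H}

/-- This range is separate because $\log T=0$ annihilates the main terms: only the additive constant
is left, and there is a single episode. -/
theorem regret_and_switches_le_of_T_lt_two {l : List (Episode S A)} (hl : l.length = K)
    (hH : 1 ≤ H) (hT : (K : ℝ) * H < 2) : regret M l ≤ 2 ∧ switches H l = 0 := by
  have h1 : K * H < 2 := by exact_mod_cast hT
  have h2 : K < 2 := by nlinarith
  refine ⟨(regret_le_length M l).trans (by rw [hl]; exact hT.le), ?_⟩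
  have := switches_le_length H l
  omega

set_option maxHeartbeats 1000000 in
theorem prob_regret_and_switches {cfg : Config S A} {P : ℝ → ℝ} {ε d : ℝ}
    (hH : 1 ≤ H) (hK : 1 ≤ K) (hTK : cfg.T = (K : ℝ) * H) (hδ : 0 < cfg.δ) (hδ1 : cfg.δ < 1)
    (hc : cfg.c = 448) (hpos : 0 < gapMin M)
    (hF : ∀ f ∈ cfg.F, ∀ z, f z ∈ Set.Icc (0 : ℝ) (H + 1)) (hB : BellmanClosed M cfg.F)
    (hN : FunctionCoverBound cfg.F cfg.NF) (hP : PointCoverBound cfg.F P)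
    (hfin : eluderDim cfg.F (1 / cfg.T) ≠ ⊤)
    (hd : d = ((eluderDim cfg.F (1 / cfg.T)).toNat : ℝ))
    (hε0 : 0 < ε) (hε : ε ≤ cfg.δ / cfg.T ^ 2) (hPε : 2 * cfg.δ ≤ P ε)
    (hβ : cfg.β = betaConst * (Real.log (cfg.NF ε / cfg.δ) * d * Real.log (P ε / cfg.δ)) * H ^ 2
      * Real.log cfg.T ^ 4)
    (hlsq : IsLeastSquares cfg.F cfg.lsq) (hgr : IsGreedy cfg.F H cfg.T cfg.β cfg.greedy)
    (hrnd : IsRounding cfg.F (1 / (16 * Real.sqrt (64 * cfg.T ^ 3 / cfg.δ)))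
      (P (1 / (16 * Real.sqrt (64 * cfg.T ^ 3 / cfg.δ)))) cfg.rnd) :
    1 - cfg.δ ≤ ((runLaw M cfg K).toOuterMeasure
      {st | regret M st.past ≤ 13000 * betaConst * (d ^ 2 * Real.log (cfg.NF ε / cfg.δ)
              * Real.log (P ε / cfg.δ) * H ^ 5 * Real.log cfg.T ^ 4 / gapMin M) + 2 ∧
            (switches H st.past : ℝ) ≤ sampleConst * (H *
              Real.log (cfg.T * cfg.NF (Real.sqrt cfg.δ / cfg.T ^ 2) / cfg.δ) * d
                * Real.log cfg.T ^ 2)}).toReal := by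
  have hHr : (1 : ℝ) ≤ H := by exact_mod_cast hH
  have hKr : (1 : ℝ) ≤ K := by exact_mod_cast hK
  have hHT : (H : ℝ) ≤ cfg.T := by rw [hTK]; nlinarith
  have hKT : (K : ℝ) ≤ cfg.T := by rw [hTK]; nlinarith
  have hTpos : 0 < cfg.T := by linarith
  have z : S × A := (M.s₁, cfg.greedy (fun _ => 0) M.s₁)
  have hgH : gapMin M ≤ H := gapMin_le M (fun _ => cfg.greedy fun _ => 0) hpos
  have hreg : ∀ st ∈ (runLaw M cfg K).support, regret M st.past ≤ cfg.T := fun st hst =>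
    (regret_le_length M st.past).trans (by rw [past_length_of_mem_support hst, hTK])
  have hsw : ∀ st ∈ (runLaw M cfg K).support, (switches H st.past : ℝ) ≤ cfg.T := by
    intro st hst
    refine le_trans ?_ hKT
    have h1 := switches_le_length H st.past
    rw [past_length_of_mem_support hst] at h1
    exact_mod_cast h1.trans (Nat.sub_le K 1)
  have hcoverpos : ∀ ε > 0, 1 ≤ cfg.NF ε := by
    intro ε hε
    obtain ⟨C, -, hcard, hC⟩ := hN.2 ε hε
    obtain ⟨f, hf, -⟩ := hB.exists_sub_eq hH
    obtain ⟨g, hg, -⟩ := hC f hf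
    refine le_trans ?_ hcard
    exact_mod_cast Finset.card_pos.2 ⟨g, hg⟩
  have hacc : 0 < Real.sqrt cfg.δ / cfg.T ^ 2 := div_pos (Real.sqrt_pos.2 hδ) (by positivity)
  set L' := Real.log (cfg.T * cfg.NF (Real.sqrt cfg.δ / cfg.T ^ 2) / cfg.δ) with hL'
  have hN' := hcoverpos _ hacc
  rcases lt_or_ge cfg.T 2 with hT2 | hT2
  · have hT1 : cfg.T = 1 := by
      have h1 : K * H < 2 := by rw [hTK] at hT2; exact_mod_cast hT2
      have h2 : K * H = 1 := by nlinarith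
      rw [hTK]; exact_mod_cast h2
    refine le_toReal_prob_of_bad _ hδ.le (t := ∅) (by simp) fun st hst _ => ?_
    have := regret_and_switches_le_of_T_lt_two (M := M) (past_length_of_mem_support hst) hH
      (hTK ▸ hT2)
    simp [hT1, this.1, this.2]
  obtain ⟨C, hCF, hCcard, hC⟩ := hN.2 ε hε0
  have hεhalf : ε < 1 / 2 := by
    refine hε.trans_lt ?_
    rw [div_lt_iff₀ (by positivity)]
    nlinarith
  have hN2 : 2 ≤ cfg.NF ε := by
    refine le_trans ?_ hCcard
    exact_mod_cast hB.two_le_card_cover hH z hεhalf hC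
  have ha : 2 / 3 ≤ Real.log (cfg.NF ε / cfg.δ) :=
    two_thirds_le_log (by rw [le_div_iff₀ hδ]; linarith)
  have hb : 2 / 3 ≤ Real.log (P ε / cfg.δ) := two_thirds_le_log (by rwa [le_div_iff₀ hδ])
  have hl : 2 / 3 ≤ Real.log cfg.T := two_thirds_le_log hT2
  have hd1 : 1 ≤ d := hd ▸ hB.one_le_eluderDim hH z hT2 hfin
  have hmain := div_le_main_term hd1 ha hb hHr hl hpos
  have hmain0 : 0 ≤ d ^ 2 * Real.log (cfg.NF ε / cfg.δ) * Real.log (P ε / cfg.δ) * H ^ 5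
      * Real.log cfg.T ^ 4 / gapMin M := by positivity
  set Q := d ^ 2 * Real.log (cfg.NF ε / cfg.δ) * Real.log (P ε / cfg.δ) * H ^ 5
      * Real.log cfg.T ^ 4 / gapMin M with hQ
  -- Below the threshold both quantities are at most `T`, and the main terms with their large
  -- constants exceed it.
  rcases lt_or_ge cfg.T 16384 with hT | hT
  · refine le_toReal_prob_of_bad _ hδ.le (t := ∅) (by simp) fun st hst _ => ⟨?_, ?_⟩
    · have h1 : 1 ≤ (H : ℝ) / gapMin M := by rwa [one_le_div hpos]
      have h2 := hreg st hst
      simp only [betaConst, sampleConst]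
      linarith
    · refine (hsw st hst).trans (hT.le.trans ?_)
      have h1 : 2 / 3 ≤ L' := two_thirds_le_log (by
        rw [le_div_iff₀ hδ]
        nlinarith)
      have h2 : 1 * (2 / 3) * 1 * (2 / 3) ^ 2 ≤ (H : ℝ) * L' * d * Real.log cfg.T ^ 2 := by
        gcongr
      simp only [sampleConst]
      linarith
  have hl1 : 1 ≤ Real.log cfg.T := by
    rw [Real.le_log_iff_exp_le hTpos]
    linarith [Real.exp_one_lt_d9]
  have hε₁pos : 0 < Real.sqrt (cfg.δ / (64 * cfg.T ^ 3)) := Real.sqrt_pos.2 (by positivity)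
  have hεε₁ := hε.trans (div_sq_le_sqrt hT hδ hδ1)
  have haccle := sqrt_div_sq_le_sqrt hT hδ
  have hε₀pos : 0 < 1 / (16 * Real.sqrt (64 * cfg.T ^ 3 / cfg.δ)) := by positivity
  have hεε₀ := hε.trans (div_sq_le_inv_sqrt hT hδ hδ1)
  obtain ⟨C₁, hC₁F, hC₁card, hC₁⟩ := hN.2 _ hε₁pos
  have hN₁ := hcoverpos _ hε₁pos
  have hN₁N : cfg.NF (Real.sqrt (cfg.δ / (64 * cfg.T ^ 3))) ≤ cfg.NF ε :=
    hN.1 (Set.mem_Ioi.2 hε0) (Set.mem_Ioi.2 hε₁pos) hεε₁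
  have hL := log_factor_le hT hδ hδ1 hN₁ hN2 hN₁N
  have hL1 := one_le_log_factor hT hδ hδ1 hN₁
  have hLL' : cfg.logFactor ≤ L' := by
    rw [Config.logFactor, hL']
    have := hN.1 (Set.mem_Ioi.2 hacc) (Set.mem_Ioi.2 hε₁pos) haccle
    gcongr
  obtain ⟨Cr, hCrcard, hCr⟩ := hrnd
  have hCrP : (Cr.card : ℝ) ≤ P ε :=
    hCrcard.trans (hP.1 (Set.mem_Ioi.2 hε0) (Set.mem_Ioi.2 hε₀pos) hεε₀)
  have hP1 : 1 ≤ P ε := by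
    refine le_trans ?_ hCrP
    exact_mod_cast Finset.card_pos.2 ⟨_, (hCr z).1⟩
  have hεT : ε ≤ 1 / cfg.T ^ 2 := hε.trans (by gcongr)
  have R : Regime M cfg :=
    { one_le_H := hH
      le_T := hT
      δ_pos := hδ
      δ_lt := hδ1
      F_mem := hF
      bellman := hB
      c_eq := hc
      one_le_logFactor := hL1
      le_β := by
        rw [hβ]
        exact factor_mul_sq_le_beta hd1 ha hb hl1 hL hHr
      rnd_close := fun f hf x => (hCr x).2 f hf
      lsq := hlsq
      greedy := hgr }
  set B := sampleConst * cfg.logFactor * d * Real.log cfg.T ^ 2 with hBdef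
  have hB0 : 0 ≤ B := by
    have : 0 ≤ cfg.logFactor := by linarith [R.one_le_logFactor]
    rw [hBdef]
    positivity
  have hbudget := sample_budget_le hT hδ hδ1 hN₁ hd1 hHr hHT
  have hgood := R.prob_good hK hTK hpos hfin hC₁F hC₁
    (card_sq_le_two_pow hT hδ hδ1 hN₁ hC₁card) hCF hε0.le hC (fun x => (hCr x).1) (B := B)
    (by rw [← hd]; exact hbudget)
    (x := B * (Real.log (P ε / cfg.δ) + 4 * Real.log cfg.T)
      + 2 * Real.log (cfg.NF ε / cfg.δ) + 2 * Real.log cfg.T) (by positivity)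
    (by
      have := history_card_le hT hδ hδ1 hN2 hP1 hB0 (by positivity) hK hTK hCcard hCrP
      refine le_trans (le_of_eq ?_) this
      push_cast
      ring)
    (by
      rw [hβ]
      exact deviation_le_beta hT hd1 ha hb hl1 hL hHr hε0 hεT)
  refine le_toReal_prob_of_bad _ hδ.le hgood fun st hst hbad => ?_
  obtain ⟨h1, h2⟩ := not_not.1 hbad
  rw [← hd] at h1
  refine ⟨?_, h2.trans ?_⟩
  -- The eluder count is available only for deviations of at least $1/T$. If the clipping level is
  -- smaller, then $T<4H/\mathrm{gap}_{\min}$ and the trivial bound suffices.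
  · by_cases hcase : 2 / cfg.T ≤ gapMin M / (2 * H)
    · have hy : Real.log (8 / cfg.δ) ≤ 3 * Real.log (cfg.NF ε / cfg.δ) :=
        log_eight_div_le hδ hδ1 hN2
      linarith [h1 hcase, regret_terms_le hd1 ha hb hl1 hHr hpos hgH hβ hy]
    · have h3 : cfg.T ≤ 4 * (H / gapMin M) := by
        rw [not_le, div_lt_div_iff₀ (by positivity) hTpos] at hcase
        rw [← mul_div_assoc, le_div_iff₀ hpos]
        nlinarith
      have h4 := hreg st hst
      simp only [betaConst, sampleConst]
      linarith
  · calc (H : ℝ) * B = sampleConst * (H * cfg.logFactor * d * Real.log cfg.T ^ 2) := by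
          rw [hBdef]; ring
      _ ≤ _ := by gcongr

end Theorem

end LSVI

theorem theorem1 :
    -- absolute constants: of the sampling routine, of `β`, of the regret bound, of the `O(·)`
    ∃ c Cβ C C' : ℝ, 0 < c ∧ 0 < Cβ ∧ 0 < C ∧ 0 < C' ∧
    ∀ (S : Type u) (A : Type v) (H K : ℕ) (M : EpisodicMDP S A H) (F : Set (S × A → ℝ))
      (NF NSA : ℝ → ℝ) (δ τ T d ε d' β : ℝ)
      (lsq : Multiset ((S × A) × ℝ) → S × A → ℝ) (greedy : (S × A → ℝ) → S → A)
      (rnd : S × A → S × A),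
      1 ≤ H → 1 ≤ K → T = (K : ℝ) * H → 0 < δ → δ < 1 → 0 < τ →
      0 < gapMin M →
      (∀ f ∈ F, ∀ z, f z ∈ Set.Icc (0 : ℝ) (H + 1)) →
      BellmanClosed M F →
      FunctionCoverBound F NF → PointCoverBound F NSA →
      eluderDim F (1 / T) ≠ ⊤ → d = ((eluderDim F (1 / T)).toNat : ℝ) →
      -- the accuracy of the covers in `β` and in the regret bound
      ε = δ / T ^ 2 ∨ ε = δ / T ^ 3 →
      2 * δ ≤ NSA ε →
      d' = Real.log (NF ε / δ) * d * Real.log (NSA ε / δ) →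
      β = Cβ * d' * H ^ 2 * Real.log T ^ 4 →
      IsLeastSquares F lsq → IsGreedy F H T β greedy →
      IsRounding F (1 / (16 * Real.sqrt (64 * T ^ 3 / δ)))
        (NSA (1 / (16 * Real.sqrt (64 * T ^ 3 / δ)))) rnd →
      1 - ⌈Real.log T⌉₊ * Real.exp (-τ) - δ ≤
        ((runLaw M ⟨F, NF, δ, T, β, c, lsq, greedy, rnd⟩ K).toOuterMeasure
          {st | regret M st.past ≤
                C * (d ^ 2 * Real.log (NF ε / δ) * Real.log (NSA ε / δ)) * H ^ 5 * Real.log T ^ 4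
                    / gapMin M + 16 * H ^ 2 * τ / 3 + 2 ∧
              (switches H st.past : ℝ) ≤
                C' * (H * Real.log (T * NF (Real.sqrt δ / T ^ 2) / δ) * d
                  * Real.log T ^ 2)}).toReal := by
  refine ⟨448, betaConst, 13000 * betaConst, sampleConst, by norm_num, by norm_num, by norm_num,
    by norm_num, ?_⟩
  intro S A H K M F NF NSA δ τ T d ε d' β lsq greedy rnd hH hK hT hδ hδ1 hτ hpos hF hB hN hP hfin
    hd hε hNSA hd' hβ hlsq hgr hrnd
  have hT1 : 1 ≤ T := by
    rw [hT]
    exact_mod_cast Nat.one_le_iff_ne_zero.2 (by positivity)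
  have hε0 : 0 < ε := by rcases hε with rfl | rfl <;> positivity
  have hε2 : ε ≤ δ / T ^ 2 := by
    rcases hε with rfl | rfl
    · exact le_rfl
    · gcongr
      norm_num
  have key := prob_regret_and_switches (M := M) (cfg := ⟨F, NF, δ, T, β, 448, lsq, greedy, rnd⟩)
    hH hK hT hδ hδ1 rfl hpos hF hB hN hP hfin hd hε0 hε2 hNSA (by rw [hβ, hd']) hlsq hgr
    hrnd
  -- The terms with $\tau$ only weaken the estimate: the deviation of the clipped bonuses has
  -- already been paid for by $\delta$ and the main term.
  have h1 : 0 ≤ (⌈Real.log T⌉₊ : ℝ) * Real.exp (-τ) := by positivity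
  refine (by linarith : 1 - ⌈Real.log T⌉₊ * Real.exp (-τ) - δ ≤ 1 - δ).trans (key.trans ?_)
  refine ENNReal.toReal_mono ?_ (MeasureTheory.measure_mono fun st hst => ⟨hst.1.trans ?_, hst.2⟩)
  · refine ne_top_of_le_ne_top ENNReal.one_ne_top ?_
    rw [← (PMF.toOuterMeasure_apply_eq_one_iff (runLaw M _ K) Set.univ).2 (Set.subset_univ _)]
    exact MeasureTheory.measure_mono (Set.subset_univ _)
  · have h2 : (0 : ℝ) ≤ 16 * H ^ 2 * τ / 3 := by positivity
    have h3 : 13000 * betaConst * (d ^ 2 * Real.log (NF ε / δ) * Real.log (NSA ε / δ)) * H ^ 5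
        * Real.log T ^ 4 / gapMin M = 13000 * betaConst * (d ^ 2 * Real.log (NF ε / δ)
          * Real.log (NSA ε / δ) * H ^ 5 * Real.log T ^ 4 / gapMin M) := by ring
    rw [h3]
    dsimp only
    linarith
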